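/- Let $\mathcal H_0,\mathcal G_0$ be separable complex Hilbert spaces and $(\Lambda,\mathcal A)$ a measurable space. For Hilbert spaces $\mathcal H,\mathcal G$, let $\mathcal L_b(\mathcal H,\mathcal G)$ be the bounded operators, $\mathcal S_1(\mathcal H,\mathcal G)$ and $\mathcal S_2(\mathcal H,\mathcal G)$ the trace-class and Hilbert–Schmidt operators, $\|\cdot\|_1$ the trace norm, and $\mathcal O(\mathcal H,\mathcal G)$ the set of linear operators $T$ from a linear subspace $\mathcal D(T)\subset\mathcal H$ to $\mathcal G$; a sum $T+S$ has domain $\mathcal D(T)\cap\mathcal D(S)$, and $PT$ has domain $\mathcal D(T)$ for $P$ bounded. Let $\nu$ be a trace-class positive operator valued measure on $(\Lambda,\mathcal A,\mathcal H_0)$: a map from $\mathcal A$ to the positive trace-class operators on $\mathcal H_0$ that is countably additive in the weak operator topology. Let $\|\nu\|_1$ be its variation measure for the trace norm. Then $\nu$ has a density $f=\frac{d\nu}{d\|\nu\|_1}\in L^1(\Lambda,\mathcal S_1(\mathcal H_0),\|\nu\|_1)$, i.e. $\nu(A)=\int_A f\,d\|\nu\|_1$ for all $A\in\mathcal A$;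 fix a version of it. A function $\Phi:\Lambda\to\mathcal O(\mathcal H_0,\mathcal G_0)$ is $\mathcal O$-measurable if $\{\lambda: x\in\mathcal D(\Phi(\lambda))\}\in\mathcal A$ for every $x\in\mathcal H_0$ and there are $\Phi_n:\Lambda\to\mathcal L_b(\mathcal H_0,\mathcal G_0)$ such that $\lambda\mapsto\Phi_n(\lambda)x$ is measurable for all $x\in\mathcal H_0$ and $n$, and $\Phi_n(\lambda)x\to\Phi(\lambda)x$ for all $\lambda$ and all $x\in\mathcal D(\Phi(\lambda))$. A pair $(\Phi,\Psi)$ of $\mathcal O$-measurable functions is $\nu$-integrable if, $\|\nu\|_1$-a.e., $\mathrm{Im}(f^{1/2})\subset\mathcal D(\Phi)\cap\mathcal D(\Psi)$ and $\Phi f^{1/2},\Psi f^{1/2}\in\mathcal S_2(\mathcal H_0,\mathcal G_0)$, and $(\Phi f^{1/2})(\Psi f^{1/2})^{\mathsf H}$ is Bochner integrable in $\mathcal S_1(\mathcal G_0)$ with respect to $\|\nu\|_1$; then $$\int\Phi\,d\nu\,\Psi^{\mathsf H}:=\int(\Phi f^{1/2})(\Psi f^{1/2})^{\mathsf H}\,d\|\nu\|_1\in\mathcal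 S_1(\mathcal G_0).$$ Let $\mathscr L^2=\mathscr L^2(\Lambda,\mathcal A,\mathcal O(\mathcal H_0,\mathcal G_0),\nu)$ be the set of $\mathcal O$-measurable $\Phi$ such that $(\Phi,\Phi)$ is $\nu$-integrable. **Theorem.** 1. $\mathscr L^2$ contains $0$ and is stable under pointwise sums, under $\Phi\mapsto-\Phi$, and under the action $(P\bullet\Phi)(\lambda)=P\,\Phi(\lambda)$ of $P\in\mathcal L_b(\mathcal G_0)$. Addition is commutative and associative with neutral element $0$, and $P\bullet(\Phi+\Psi)=P\bullet\Phi+P\bullet\Psi$, $(P+Q)\bullet\Phi=P\bullet\Phi+Q\bullet\Phi$, $(PQ)\bullet\Phi=P\bullet(Q\bullet\Phi)$, $\mathrm{Id}\bullet\Phi=\Phi$. Moreover $\|\Phi+(-\Phi)\|_\nu=0$, with $\|\cdot\|_\nu$ as in 3. Thus $\mathscr L^2$ is an $\mathcal L_b(\mathcal G_0)$-module, with additive inverses up to elements of zero norm. 2. For all $\Phi,\Psi\in\mathscr L^2$ the pair $(\Phi,\Psi)$ is $\nu$-integrable, and $[\Phi,\Psi]_\nu:=\int\Phi\,d\nu\,\Psi^{\mathsf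 H}\in\mathcal S_1(\mathcal G_0)$ is a pseudo-Gramian: for all $\Phi,\Psi,\Theta\in\mathscr L^2$ and $P\in\mathcal L_b(\mathcal G_0)$, $[\Phi,\Phi]_\nu$ is positive, $[\Phi+P\bullet\Psi,\Theta]_\nu=[\Phi,\Theta]_\nu+P[\Psi,\Theta]_\nu$, and $[\Psi,\Phi]_\nu=[\Phi,\Psi]_\nu^{\mathsf H}$. 3. For $\Phi\in\mathscr L^2$, $\|\Phi\|_\nu:=\|[\Phi,\Phi]_\nu\|_1^{1/2}=0$ if and only if $\Phi f^{1/2}=0$ $\|\nu\|_1$-a.e. 4. The relation $\|\Phi-\Psi\|_\nu=0$ is an equivalence relation on $\mathscr L^2$. The operations and $[\cdot,\cdot]_\nu$ pass to the quotient $\mathsf L^2(\Lambda,\mathcal A,\mathcal O(\mathcal H_0,\mathcal G_0),\nu):=\mathscr L^2/\{\|\cdot\|_\nu=0\}$ and make it a normal Hilbert $\mathcal L_b(\mathcal G_0)$-module: it is an $\mathcal L_b(\mathcal G_0)$-module (an abelian group with an action satisfying the identities in 1), $[\cdot,\cdot]_\nu$ is $\mathcal S_1(\mathcal G_0)$-valued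 with the properties in 2, $[x,x]_\nu=0$ if and only if $x=0$, and the quotient is complete for the norm $\|x\|_\nu=\|[x,x]_\nu\|_1^{1/2}$. -/

import Mathlib

open MeasureTheory ContinuousLinearMap Filter Topology
open scoped ENNReal InnerProductSpace

namespace PovmL2

section Schatten

variable {H G : Type*} [NormedAddCommGroup H] [InnerProductSpace ℂ H] [CompleteSpace H]
  [NormedAddCommGroup G] [InnerProductSpace ℂ G] [CompleteSpace G]

/-- The trace `∑ᵢ ⟪A eᵢ, eᵢ⟫ ∈ [0, ∞]` of a positive operator `A`. The supremum over finite
orthonormal systems is the value of the series in any Hilbert basis. -/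
noncomputable def eTrace (A : H →L[ℂ] H) : ℝ≥0∞ :=
  ⨆ (s : Finset H) (_ : Orthonormal ℂ (fun e : s => (e : H))),
    ∑ e ∈ s, ENNReal.ofReal (RCLike.re ⟪A e, e⟫_ℂ)

/-- The absolute value `|T| = (Tᴴ T)^{1/2}`. -/
noncomputable def opAbs (T : H →L[ℂ] G) : H →L[ℂ] H := CFC.sqrt (adjoint T ∘L T)

/-- The extended trace norm `‖T‖₁ = Tr |T| ∈ [0, ∞]`. -/
noncomputable def eTraceNorm (T : H →L[ℂ] G) : ℝ≥0∞ := eTrace (opAbs T)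

/-- `T` is a Hilbert-Schmidt operator (Schatten class `2`): `Tr (Tᴴ T) < ∞`. -/
def IsHilbertSchmidt (T : H →L[ℂ] G) : Prop := eTrace (adjoint T ∘L T) < ∞

/-- `T` is a trace-class operator (Schatten class `1`): `Tr |T| < ∞`. -/
def IsTraceClass (T : H →L[ℂ] G) : Prop := eTraceNorm T < ∞

theorem sum_le_eTrace (A : H →L[ℂ] H) (s : Finset H)
    (hs : Orthonormal ℂ (fun e : s => (e : H))) :
    ∑ e ∈ s, ENNReal.ofReal (RCLike.re ⟪A e, e⟫_ℂ) ≤ eTrace A :=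
  le_iSup₂_of_le s hs le_rfl

theorem adjoint_comp_self_nonneg (T : H →L[ℂ] G) : 0 ≤ adjoint T ∘L T := by
  rw [nonneg_iff_isPositive]
  exact isPositive_adjoint_comp_self T

theorem opAbs_nonneg (T : H →L[ℂ] G) : 0 ≤ opAbs T := CFC.sqrt_nonneg _

theorem opAbs_of_nonneg {A : H →L[ℂ] H} (hA : 0 ≤ A) : opAbs A = A := by
  have h : adjoint A = A := ((nonneg_iff_isPositive A).1 hA).isSelfAdjoint.adjoint_eq
  rw [opAbs, h]
  exact CFC.sqrt_mul_self A hA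

theorem inner_opAbs_opAbs (T : H →L[ℂ] G) (x y : H) :
    ⟪opAbs T x, opAbs T y⟫_ℂ = ⟪T x, T y⟫_ℂ := by
  have h : adjoint (opAbs T) = opAbs T :=
    ((nonneg_iff_isPositive _).1 (opAbs_nonneg T)).isSelfAdjoint.adjoint_eq
  have h2 : opAbs T * opAbs T = adjoint T ∘L T :=
    CFC.sqrt_mul_sqrt_self _ (adjoint_comp_self_nonneg T)
  have h3 : opAbs T (opAbs T y) = adjoint T (T y) := congrArg (fun S : H →L[ℂ] H => S y) h2
  rw [← adjoint_inner_right, h, h3, adjoint_inner_right]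

theorem norm_opAbs_apply (T : H →L[ℂ] G) (x : H) : ‖opAbs T x‖ = ‖T x‖ := by
  rw [@norm_eq_sqrt_re_inner ℂ, @norm_eq_sqrt_re_inner ℂ, inner_opAbs_opAbs]

/-- Polar decomposition `T = U |T|`, with a contraction `U`. -/
theorem exists_polar (T : H →L[ℂ] G) :
    ∃ U : H →L[ℂ] G, ‖U‖ ≤ 1 ∧ (∀ x, U (opAbs T x) = T x) ∧
      ∀ x, adjoint U (T x) = opAbs T x := by
  let K : Submodule ℂ H := (LinearMap.range (opAbs T).toLinearMap).topologicalClosure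
  have hmem : ∀ x, opAbs T x ∈ K := fun x =>
    Submodule.le_topologicalClosure _ (LinearMap.mem_range_self _ x)
  let e : H →ₗ[ℂ] K := (opAbs T).toLinearMap.codRestrict K hmem
  have hd : DenseRange e := by
    intro y
    rw [Metric.mem_closure_iff]
    intro ε hε
    have hy : (y : H) ∈ closure (LinearMap.range (opAbs T).toLinearMap : Set H) := y.2
    obtain ⟨z, ⟨x, rfl⟩, hz⟩ := Metric.mem_closure_iff.1 hy ε hε
    exact ⟨e x, ⟨x, rfl⟩, hz⟩
  have hn : ∀ x, ‖T.toLinearMap x‖ ≤ 1 * ‖e x‖ := fun x => by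
    rw [one_mul]
    exact (norm_opAbs_apply T x).ge
  have : CompleteSpace K := (Submodule.isClosed_topologicalClosure _).completeSpace_coe
  let V : K →L[ℂ] G := T.toLinearMap.extendOfNorm e
  let U : H →L[ℂ] G := V ∘L K.orthogonalProjectionOnto
  have hU : ‖U‖ ≤ 1 := by
    refine (opNorm_comp_le _ _).trans ?_
    exact mul_le_one₀ (LinearMap.opNorm_extendOfNorm_le hd zero_le_one hn) (norm_nonneg _)
      (Submodule.orthogonalProjectionOnto_norm_le K)
  have hUT : ∀ x, U (opAbs T x) = T x := by
    intro x
    have h1 : K.orthogonalProjectionOnto (opAbs T x) = e x :=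
      Submodule.orthogonalProjectionOnto_mem_subspace_eq_self (e x)
    change V (K.orthogonalProjectionOnto (opAbs T x)) = T x
    rw [h1]
    exact LinearMap.extendOfNorm_eq hd ⟨1, hn⟩ x
  refine ⟨U, hU, hUT, fun x => ?_⟩
  have h1 : ‖adjoint U (T x)‖ ≤ ‖T x‖ := by
    refine (le_opNorm _ _).trans ?_
    rw [LinearIsometryEquiv.norm_map]
    exact mul_le_of_le_one_left (norm_nonneg _) hU
  have h2 : RCLike.re ⟪adjoint U (T x), opAbs T x⟫_ℂ = ‖T x‖ ^ 2 := by
    rw [adjoint_inner_left, hUT, inner_self_eq_norm_sq]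
  have h3 := @norm_sub_sq ℂ H _ _ _ (adjoint U (T x)) (opAbs T x)
  rw [h2, norm_opAbs_apply] at h3
  have h4 : ‖adjoint U (T x)‖ ^ 2 ≤ ‖T x‖ ^ 2 := by gcongr
  have h5 : ‖adjoint U (T x) - opAbs T x‖ ^ 2 = 0 := le_antisymm (by linarith) (sq_nonneg _)
  exact sub_eq_zero.1 (norm_eq_zero.1 (pow_eq_zero_iff two_ne_zero |>.1 h5))

theorem sum_norm_sq_comp_le (B : H →L[ℂ] H) (K : G →L[ℂ] H) (hK : ‖K‖ ≤ 1) (s : Finset G)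
    (hs : Orthonormal ℂ (fun e : s => (e : G))) :
    ∑ e ∈ s, ENNReal.ofReal (‖B (K e)‖ ^ 2) ≤ eTrace (B ∘L adjoint B) := by
  obtain ⟨w, b, -⟩ := exists_hilbertBasis ℂ H
  have hbas : ∀ y : H, ENNReal.ofReal (‖y‖ ^ 2) = ∑' i, ENNReal.ofReal (‖⟪b i, y⟫_ℂ‖ ^ 2) := by
    intro y
    have h := b.hasSum_inner_mul_inner y y
    have h2 : HasSum (fun i => ‖⟪b i, y⟫_ℂ‖ ^ 2) (‖y‖ ^ 2) := by
      have h3 := RCLike.hasSum_re (𝕜 := ℂ) h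
      rw [inner_self_eq_norm_sq] at h3
      convert h3 using 2 with i
      rw [← inner_conj_symm y (b i), RCLike.conj_mul]
      norm_cast
    rw [← h2.tsum_eq, ENNReal.ofReal_tsum_of_nonneg (fun _ => sq_nonneg _) h2.summable]
  have hcol : ∀ i, ∑ e ∈ s, ENNReal.ofReal (‖⟪b i, B (K e)⟫_ℂ‖ ^ 2) ≤
      ENNReal.ofReal (RCLike.re ⟪(B ∘L adjoint B) (b i), b i⟫_ℂ) := by
    intro i
    rw [← ENNReal.ofReal_sum_of_nonneg (fun _ _ => sq_nonneg _)]
    apply ENNReal.ofReal_le_ofReal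
    have h1 : ∀ e : G, ⟪b i, B (K e)⟫_ℂ = ⟪adjoint K (adjoint B (b i)), e⟫_ℂ := fun e => by
      rw [adjoint_inner_left, adjoint_inner_left]
    have h2 := hs.sum_inner_products_le (adjoint K (adjoint B (b i))) (s := Finset.univ)
    rw [Finset.univ_eq_attach, Finset.sum_attach s
      (fun e => ‖⟪e, adjoint K (adjoint B (b i))⟫_ℂ‖ ^ 2)] at h2
    have h3 : ‖adjoint K (adjoint B (b i))‖ ≤ ‖adjoint B (b i)‖ := by
      refine (le_opNorm _ _).trans ?_
      rw [LinearIsometryEquiv.norm_map]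
      exact mul_le_of_le_one_left (norm_nonneg _) hK
    calc ∑ e ∈ s, ‖⟪b i, B (K e)⟫_ℂ‖ ^ 2
        = ∑ e ∈ s, ‖⟪e, adjoint K (adjoint B (b i))⟫_ℂ‖ ^ 2 := by
          refine Finset.sum_congr rfl fun e _ => ?_
          rw [h1, norm_inner_symm]
      _ ≤ ‖adjoint K (adjoint B (b i))‖ ^ 2 := h2
      _ ≤ ‖adjoint B (b i)‖ ^ 2 := by gcongr
      _ = RCLike.re ⟪(B ∘L adjoint B) (b i), b i⟫_ℂ := by
          rw [ContinuousLinearMap.coe_comp, Function.comp_apply, ← adjoint_inner_right,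
            inner_self_eq_norm_sq]
  calc ∑ e ∈ s, ENNReal.ofReal (‖B (K e)‖ ^ 2)
      = ∑' i, ∑ e ∈ s, ENNReal.ofReal (‖⟪b i, B (K e)⟫_ℂ‖ ^ 2) := by
        rw [Summable.tsum_finsetSum (fun _ _ => ENNReal.summable)]
        exact Finset.sum_congr rfl fun e _ => hbas _
    _ ≤ ∑' i, ENNReal.ofReal (RCLike.re ⟪(B ∘L adjoint B) (b i), b i⟫_ℂ) :=
        ENNReal.tsum_le_tsum hcol
    _ ≤ eTrace (B ∘L adjoint B) := by
        refine ENNReal.summable.tsum_le_of_sum_le fun t => ?_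
        classical
        have hinj : Function.Injective b := b.orthonormal.linearIndependent.injective
        rw [← Finset.sum_image (f := fun e => ENNReal.ofReal
          (RCLike.re ⟪(B ∘L adjoint B) e, e⟫_ℂ)) (g := b) (fun i _ j _ h => hinj h)]
        refine sum_le_eTrace _ _ ?_
        have h : Orthonormal ℂ ((↑) : Set.range b → H) := Orthonormal.toSubtypeRange b.orthonormal
        exact h.comp (fun e : (t.image b : Finset H) => (⟨(e : H), by
          obtain ⟨i, -, hi⟩ := Finset.mem_image.1 e.2
          exact ⟨i, hi⟩⟩ : Set.range b)) (fun e e' h => by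
            have h' := congrArg (fun z : Set.range b => (z : H)) h
            exact Subtype.ext h')

theorem exists_sqrt_opAbs (T : H →L[ℂ] G) :
    ∃ B : H →L[ℂ] H, adjoint B = B ∧ B ∘L B = opAbs T :=
  ⟨CFC.sqrt (opAbs T),
    ((nonneg_iff_isPositive (CFC.sqrt (opAbs T))).1
      (CFC.sqrt_nonneg (opAbs T))).isSelfAdjoint.adjoint_eq,
    CFC.sqrt_mul_sqrt_self (opAbs T) (opAbs_nonneg T)⟩

/-- `∑ |⟪T e, C e⟫| ≤ ‖T‖₁` for every finite orthonormal system and every contraction `C`. -/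
theorem sum_norm_inner_le (T C : H →L[ℂ] G) (hC : ‖C‖ ≤ 1) (s : Finset H)
    (hs : Orthonormal ℂ (fun e : s => (e : H))) :
    ∑ e ∈ s, ENNReal.ofReal ‖⟪T e, C e⟫_ℂ‖ ≤ eTraceNorm T := by
  obtain ⟨U, hU, hUT, -⟩ := exists_polar T
  obtain ⟨B, hBadj, hBB⟩ := exists_sqrt_opAbs T
  let K : H →L[ℂ] H := adjoint U ∘L C
  have hK : ‖K‖ ≤ 1 := by
    refine (opNorm_comp_le _ _).trans ?_
    rw [LinearIsometryEquiv.norm_map]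
    exact mul_le_one₀ hU (norm_nonneg _) hC
  have h1 := sum_norm_sq_comp_le B K hK s hs
  have h2 := sum_norm_sq_comp_le B (ContinuousLinearMap.id ℂ H) norm_id_le s hs
  rw [hBadj, hBB] at h1 h2
  have hpt : ∀ e : H, ‖⟪T e, C e⟫_ℂ‖ ≤ (‖B (K e)‖ ^ 2 + ‖B e‖ ^ 2) / 2 := by
    intro e
    have h3 : ⟪T e, C e⟫_ℂ = ⟪B e, B (K e)⟫_ℂ := by
      have h4 : B (B e) = opAbs T e := congrArg (fun S : H →L[ℂ] H => S e) hBB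
      have h5 : ⟪B e, B (K e)⟫_ℂ = ⟪opAbs T e, adjoint U (C e)⟫_ℂ := by
        rw [← adjoint_inner_left B, hBadj, h4]
        rfl
      rw [h5, adjoint_inner_right, hUT]
    rw [h3]
    have h5 := norm_inner_le_norm (𝕜 := ℂ) (B e) (B (K e))
    nlinarith [sq_nonneg (‖B e‖ - ‖B (K e)‖)]
  calc ∑ e ∈ s, ENNReal.ofReal ‖⟪T e, C e⟫_ℂ‖
      ≤ ∑ e ∈ s, (ENNReal.ofReal (‖B (K e)‖ ^ 2) + ENNReal.ofReal (‖B e‖ ^ 2)) / 2 := by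
        refine Finset.sum_le_sum fun e _ => ?_
        rw [← ENNReal.ofReal_add (sq_nonneg _) (sq_nonneg _), ← ENNReal.ofReal_ofNat,
          ← ENNReal.ofReal_div_of_pos two_pos]
        exact ENNReal.ofReal_le_ofReal (hpt e)
    _ = (∑ e ∈ s, ENNReal.ofReal (‖B (K e)‖ ^ 2) + ∑ e ∈ s, ENNReal.ofReal (‖B e‖ ^ 2)) / 2 := by
        simp only [div_eq_mul_inv]
        rw [← Finset.sum_mul, Finset.sum_add_distrib]
    _ ≤ (eTraceNorm T + eTraceNorm T) / 2 := by
        gcongr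
        · exact h1
        · exact h2
    _ = eTraceNorm T := by
        rw [← two_mul, mul_div_assoc, ENNReal.mul_div_cancel two_ne_zero ENNReal.ofNat_ne_top]

/-- Criterion for bounding the trace norm from above. -/
theorem eTraceNorm_le (T : H →L[ℂ] G) (c : ℝ≥0∞)
    (h : ∀ (C : H →L[ℂ] G), ‖C‖ ≤ 1 → ∀ s : Finset H, Orthonormal ℂ (fun e : s => (e : H)) →
      ∑ e ∈ s, ENNReal.ofReal ‖⟪T e, C e⟫_ℂ‖ ≤ c) : eTraceNorm T ≤ c := by
  obtain ⟨U, hU, -, hUT⟩ := exists_polar T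
  refine iSup₂_le fun s hs => (Finset.sum_le_sum fun e _ => ?_).trans (h U hU s hs)
  apply ENNReal.ofReal_le_ofReal
  have h1 : ⟪opAbs T e, e⟫_ℂ = ⟪T e, U e⟫_ℂ := by
    rw [← hUT, adjoint_inner_left]
  rw [h1]
  exact RCLike.re_le_norm _

theorem eTraceNorm_add_le (T S : H →L[ℂ] G) :
    eTraceNorm (T + S) ≤ eTraceNorm T + eTraceNorm S := by
  refine eTraceNorm_le _ _ fun C hC s hs => ?_
  refine le_trans ?_ (add_le_add (sum_norm_inner_le T C hC s hs) (sum_norm_inner_le S C hC s hs))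
  rw [← Finset.sum_add_distrib]
  refine Finset.sum_le_sum fun e _ => ?_
  rw [← ENNReal.ofReal_add (norm_nonneg _) (norm_nonneg _), add_apply, inner_add_left]
  exact ENNReal.ofReal_le_ofReal (norm_add_le _ _)

theorem eTraceNorm_smul_le (c : ℂ) (T : H →L[ℂ] G) :
    eTraceNorm (c • T) ≤ ‖c‖ₑ * eTraceNorm T := by
  refine eTraceNorm_le _ _ fun C hC s hs => ?_
  refine le_trans ?_ (mul_le_mul_right (sum_norm_inner_le T C hC s hs) _)
  rw [Finset.mul_sum]
  refine Finset.sum_le_sum fun e _ => ?_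
  rw [smul_apply, inner_smul_left, norm_mul, RCLike.norm_conj,
    ENNReal.ofReal_mul (norm_nonneg _), ofReal_norm]

theorem opNorm_le_eTraceNorm (T : H →L[ℂ] G) : ‖T‖ₑ ≤ eTraceNorm T := by
  rcases eq_or_ne (eTraceNorm T) ∞ with h | h
  · rw [h]
    exact le_top
  rw [← ofReal_norm, ← ENNReal.ofReal_toReal h]
  apply ENNReal.ofReal_le_ofReal
  refine opNorm_le_of_unit_norm ENNReal.toReal_nonneg fun e he => ?_
  rcases eq_or_ne (T e) 0 with h0 | h0
  · rw [h0, norm_zero]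
    exact ENNReal.toReal_nonneg
  have hpos : 0 < ‖T e‖ := norm_pos_iff.2 h0
  let C : H →L[ℂ] G := (innerSL ℂ e).smulRight (((‖T e‖ : ℂ)⁻¹) • T e)
  have hC : ‖C‖ ≤ 1 := by
    rw [norm_smulRight_apply, innerSL_apply_norm, he, norm_smul, norm_inv, Complex.norm_real,
      norm_norm, inv_mul_cancel₀ hpos.ne', mul_one]
  have hs : Orthonormal ℂ (fun x : ({e} : Finset H) => (x : H)) := by
    refine ⟨fun x => ?_, fun x y hxy => ?_⟩
    · change ‖(x : H)‖ = 1
      rw [Finset.mem_singleton.1 x.2, he]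
    · exact absurd (Subtype.ext ((Finset.mem_singleton.1 x.2).trans
        (Finset.mem_singleton.1 y.2).symm)) hxy
  have h1 := sum_norm_inner_le T C hC {e} hs
  rw [Finset.sum_singleton] at h1
  have h2 : C e = ((‖T e‖ : ℂ)⁻¹) • T e := by
    simp [C, inner_self_eq_norm_sq_to_K, he]
  have h3 : ‖⟪T e, C e⟫_ℂ‖ = ‖T e‖ := by
    rw [h2, inner_smul_right, inner_self_eq_norm_sq_to_K, norm_mul, norm_inv, norm_pow]
    simp only [Complex.norm_real, Complex.coe_algebraMap, norm_norm]
    field_simp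
  rw [h3] at h1
  exact (ENNReal.ofReal_le_iff_le_toReal h).1 h1

theorem eTraceNorm_zero : eTraceNorm (0 : H →L[ℂ] G) = 0 := by
  have h := eTraceNorm_smul_le 0 (0 : H →L[ℂ] G)
  simpa using h

variable (H G) in
/-- The Schatten class `S₁(H, G)` of trace-class operators, as a subspace of `L_b(H, G)`. -/
def traceClassSubmodule : Submodule ℂ (H →L[ℂ] G) where
  carrier := {T | IsTraceClass T}
  zero_mem' := by
    change eTraceNorm _ < ∞
    rw [eTraceNorm_zero]
    exact ENNReal.zero_lt_top
  add_mem' {T S} hT hS := (eTraceNorm_add_le T S).trans_lt (ENNReal.add_lt_top.2 ⟨hT, hS⟩)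
  smul_mem' c T hT :=
    (eTraceNorm_smul_le c T).trans_lt (ENNReal.mul_lt_top enorm_lt_top hT)

variable (H G) in
/-- The space `S₁(H, G)`; it carries the trace norm, not the operator norm. -/
def TraceClass : Type _ := traceClassSubmodule H G

namespace TraceClass

/-- A trace-class operator as an element of `S₁(H, G)`. -/
def mk (T : H →L[ℂ] G) (hT : IsTraceClass T) : TraceClass H G := ⟨T, hT⟩

open scoped Classical in
/-- A bounded operator, regarded as an element of `S₁(H, G)` when it is of trace class. -/
noncomputable def ofOp (T : H →L[ℂ] G) : TraceClass H G :=
  if hT : IsTraceClass T then ⟨T, hT⟩ else ⟨0, (traceClassSubmodule H G).zero_mem⟩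

/-- The underlying bounded operator. -/
def toOp (T : TraceClass H G) : H →L[ℂ] G := T.1

noncomputable instance : AddCommGroup (TraceClass H G) :=
  inferInstanceAs (AddCommGroup (traceClassSubmodule H G))

noncomputable instance : Module ℂ (TraceClass H G) :=
  inferInstanceAs (Module ℂ (traceClassSubmodule H G))

noncomputable instance : Norm (TraceClass H G) := ⟨fun T => (eTraceNorm T.toOp).toReal⟩

theorem norm_def (T : TraceClass H G) : ‖T‖ = (eTraceNorm T.toOp).toReal := rfl

theorem eTraceNorm_ne_top (T : TraceClass H G) : eTraceNorm T.toOp ≠ ∞ := ne_of_lt T.2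

theorem opNorm_le_norm (T : TraceClass H G) : ‖T.toOp‖ ≤ ‖T‖ := by
  have h := ENNReal.toReal_mono T.eTraceNorm_ne_top (opNorm_le_eTraceNorm T.toOp)
  rwa [toReal_enorm] at h

theorem norm_smul_le' (c : ℂ) (T : TraceClass H G) : ‖c • T‖ ≤ ‖c‖ * ‖T‖ := by
  have h := ENNReal.toReal_mono (ENNReal.mul_ne_top enorm_ne_top T.eTraceNorm_ne_top)
    (eTraceNorm_smul_le c T.toOp)
  rw [ENNReal.toReal_mul, toReal_enorm] at h
  exact h

theorem norm_neg_le' (T : TraceClass H G) : ‖-T‖ ≤ ‖T‖ := by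
  simpa using norm_smul_le' (-1) T

noncomputable instance : NormedAddCommGroup (TraceClass H G) :=
  AddGroupNorm.toNormedAddCommGroup
    { toFun := fun T => ‖T‖
      map_zero' := by
        change (eTraceNorm (0 : H →L[ℂ] G)).toReal = 0
        rw [eTraceNorm_zero, ENNReal.toReal_zero]
      add_le' := fun T S => by
        rw [norm_def, norm_def, norm_def,
          ← ENNReal.toReal_add T.eTraceNorm_ne_top S.eTraceNorm_ne_top]
        exact ENNReal.toReal_mono
          (ENNReal.add_ne_top.2 ⟨T.eTraceNorm_ne_top, S.eTraceNorm_ne_top⟩)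
          (eTraceNorm_add_le T.toOp S.toOp)
      neg' := fun T => by
        refine le_antisymm (norm_neg_le' T) ?_
        simpa using norm_neg_le' (-T)
      eq_zero_of_map_eq_zero' := fun T hT => by
        have h := opNorm_le_norm T
        have h2 : ‖T‖ = 0 := hT
        rw [h2] at h
        exact Subtype.ext (norm_le_zero_iff.1 h) }

noncomputable instance : NormedSpace ℂ (TraceClass H G) where
  norm_smul_le := norm_smul_le'

instance : CompleteSpace (TraceClass H G) := by
  refine Metric.complete_of_cauchySeq_tendsto fun u hu => ?_
  have hu' : CauchySeq fun n => (u n).toOp := by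
    rw [Metric.cauchySeq_iff] at hu ⊢
    intro ε hε
    obtain ⟨N, hN⟩ := hu ε hε
    refine ⟨N, fun m hm n hn => lt_of_le_of_lt ?_ (hN m hm n hn)⟩
    rw [dist_eq_norm, dist_eq_norm]
    exact opNorm_le_norm (u m - u n)
  obtain ⟨T, hT⟩ := cauchySeq_tendsto_of_complete hu'
  have key : ∀ ε : ℝ, 0 < ε → ∃ N, ∀ m ≥ N, eTraceNorm (T - (u m).toOp) ≤ ENNReal.ofReal ε := by
    intro ε hε
    obtain ⟨N, hN⟩ := Metric.cauchySeq_iff.1 hu ε hε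
    refine ⟨N, fun m hm => eTraceNorm_le _ _ fun C hC s hs => ?_⟩
    have hlim : Tendsto (fun n => ∑ e ∈ s,
        ENNReal.ofReal ‖⟪((u n).toOp - (u m).toOp) e, C e⟫_ℂ‖) atTop
        (𝓝 (∑ e ∈ s, ENNReal.ofReal ‖⟪(T - (u m).toOp) e, C e⟫_ℂ‖)) := by
      refine tendsto_finsetSum s fun e _ => ?_
      refine ENNReal.tendsto_ofReal (Tendsto.norm ?_)
      refine Tendsto.inner ?_ tendsto_const_nhds
      exact ((ContinuousLinearMap.apply ℂ G e).continuous.tendsto _).comp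
        (hT.sub tendsto_const_nhds)
    refine le_of_tendsto hlim (eventually_atTop.2 ⟨N, fun n hn => ?_⟩)
    refine (sum_norm_inner_le _ C hC s hs).trans ?_
    have h1 := hN n hn m hm
    rw [dist_eq_norm] at h1
    exact (ENNReal.le_ofReal_iff_toReal_le (u n - u m).eTraceNorm_ne_top hε.le).2 h1.le
  obtain ⟨N₁, hN₁⟩ := key 1 one_pos
  have hTc : IsTraceClass T := by
    have h := eTraceNorm_add_le (T - (u N₁).toOp) (u N₁).toOp
    rw [sub_add_cancel] at h
    exact h.trans_lt (ENNReal.add_lt_top.2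
      ⟨(hN₁ N₁ le_rfl).trans_lt ENNReal.ofReal_lt_top, (u N₁).2⟩)
  refine ⟨mk T hTc, Metric.tendsto_atTop.2 fun ε hε => ?_⟩
  obtain ⟨N, hN⟩ := key (ε / 2) (half_pos hε)
  refine ⟨N, fun n hn => ?_⟩
  rw [dist_comm, dist_eq_norm]
  refine lt_of_le_of_lt ?_ (half_lt_self hε)
  exact ENNReal.toReal_le_of_le_ofReal (half_pos hε).le (hN n hn)

end TraceClass

end Schatten

section Modules

variable {G X : Type*} [NormedAddCommGroup G] [InnerProductSpace ℂ G] [CompleteSpace G]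

/-- The norm `‖x‖ = ‖[x, x]‖₁^{1/2}` of a Gramian. -/
noncomputable def gramianNorm (gram : X → X → TraceClass G G) (x : X) : ℝ :=
  Real.sqrt ‖gram x x‖

/-- `gram` is a Gramian on the `L_b(G)`-module `X`: `X` is a normal pre-Hilbert
`L_b(G)`-module. -/
structure IsNormalPreHilbertModule [AddCommGroup X] [Module (G →L[ℂ] G) X]
    (gram : X → X → TraceClass G G) : Prop where
  isPositive : ∀ x, (gram x x).toOp.IsPositive
  definite : ∀ x, gram x x = 0 ↔ x = 0
  add_smul_left : ∀ (x y z : X) (P : G →L[ℂ] G),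
    (gram (x + P • y) z).toOp = (gram x z).toOp + P ∘L (gram y z).toOp
  adjoint_swap : ∀ x y, (gram y x).toOp = adjoint (gram x y).toOp

/-- `X` with the Gramian `gram` is a normal Hilbert `L_b(G)`-module: a normal pre-Hilbert module
that is complete for the norm of the Gramian. -/
structure IsNormalHilbertModule [AddCommGroup X] [Module (G →L[ℂ] G) X]
    (gram : X → X → TraceClass G G) : Prop extends IsNormalPreHilbertModule gram where
  complete : ∀ u : ℕ → X,
    (∀ ε : ℝ, 0 < ε → ∃ N, ∀ m ≥ N, ∀ n ≥ N, gramianNorm gram (u m - u n) < ε) →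
      ∃ x, Tendsto (fun n => gramianNorm gram (u n - x)) atTop (𝓝 0)

end Modules

section Measurability

variable {Λ H G : Type*} [MeasurableSpace Λ]
  [NormedAddCommGroup H] [InnerProductSpace ℂ H] [NormedAddCommGroup G] [InnerProductSpace ℂ G]

/-- Simple measurability of a function with values in `L_b(H, G)`. -/
def SimplyMeasurable (Φ : Λ → H →L[ℂ] G) : Prop :=
  ∀ x, StronglyMeasurable fun l => Φ l x

/-- `O`-measurability of a function with values in the set `O(H, G)` of (possibly unbounded) linear
operators defined on a linear subspace of `H`. -/
structure OMeasurable (Φ : Λ → H →ₗ.[ℂ] G) : Prop where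
  measurableSet_domain : ∀ x, MeasurableSet {l | x ∈ (Φ l).domain}
  exists_approx : ∃ F : ℕ → Λ → H →L[ℂ] G, (∀ n, SimplyMeasurable (F n)) ∧
    ∀ l, ∀ x : (Φ l).domain, Tendsto (fun n => F n l (x : H)) atTop (𝓝 (Φ l x))

/-- `T = Φ A`: the image of `A` is contained in the domain of `Φ`, and `T x = Φ (A x)` for
every `x`. -/
def IsComp (Φ : H →ₗ.[ℂ] G) (A : H →L[ℂ] H) (T : H →L[ℂ] G) : Prop :=
  ∀ x, ∃ hx : A x ∈ Φ.domain, Φ ⟨A x, hx⟩ = T x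

open scoped Classical in
/-- The operator `Φ A` when it is everywhere defined and bounded (and `0` otherwise). -/
noncomputable def pcomp (Φ : H →ₗ.[ℂ] G) (A : H →L[ℂ] H) : H →L[ℂ] G :=
  if h : ∃ T, IsComp Φ A T then h.choose else 0

/-- The module action `(P • Φ)(l) = P Φ(l)`. -/
def opAct (P : G →L[ℂ] G) (Φ : Λ → H →ₗ.[ℂ] G) : Λ → H →ₗ.[ℂ] G :=
  fun l => P.toLinearMap.compPMap (Φ l)

end Measurability

/-- Positive operator valued measures on `(Λ, H)`. Only the values on measurable sets matter. -/
structure POVM (Λ H : Type*) [MeasurableSpace Λ] [NormedAddCommGroup H] [InnerProductSpace ℂ H] where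
  toFun : Set Λ → H →L[ℂ] H
  isPositive : ∀ A, MeasurableSet A → (toFun A).IsPositive
  /-- Countable additivity in the weak operator topology. -/
  hasSum_iUnion : ∀ A : ℕ → Set Λ, (∀ n, MeasurableSet (A n)) →
    Pairwise (Function.onFun Disjoint A) →
      ∀ x y : H, HasSum (fun n => ⟪toFun (A n) x, y⟫_ℂ) ⟪toFun (⋃ n, A n) x, y⟫_ℂ

namespace POVM

variable {Λ H G I : Type*} [MeasurableSpace Λ]
  [NormedAddCommGroup H] [InnerProductSpace ℂ H] [CompleteSpace H]
  [NormedAddCommGroup G] [InnerProductSpace ℂ G] [CompleteSpace G]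
  [NormedAddCommGroup I] [InnerProductSpace ℂ I] [CompleteSpace I]

/-- A p.o.v.m. is trace-class if its values are trace-class operators. -/
def IsTraceClass (ν : POVM Λ H) : Prop :=
  ∀ A, MeasurableSet A → PovmL2.IsTraceClass (ν.toFun A)

theorem toFun_empty (ν : POVM Λ H) : ν.toFun ∅ = 0 := by
  refine ContinuousLinearMap.ext fun x => ext_inner_right ℂ fun y => ?_
  have h := ν.hasSum_iUnion (fun _ => ∅) (fun _ => MeasurableSet.empty)
    (fun _ _ _ => disjoint_bot_left) x y
  have h0 : ⟪ν.toFun ∅ x, y⟫_ℂ = 0 :=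
    tendsto_nhds_unique tendsto_const_nhds h.summable.tendsto_atTop_zero
  rw [h0, zero_apply, inner_zero_left]

theorem isSigmaSubadditive (ν : POVM Λ H) :
    IsSigmaSubadditiveSetFun fun A => eTraceNorm (ν.toFun A) := by
  intro A hA
  have hm : ∀ n, MeasurableSet (A n : Set Λ) := fun n => (A n).2
  have habs : ∀ B, MeasurableSet B → eTraceNorm (ν.toFun B) = eTrace (ν.toFun B) := fun B hB => by
    rw [eTraceNorm, opAbs_of_nonneg ((nonneg_iff_isPositive _).2 (ν.isPositive B hB))]
  change eTraceNorm (ν.toFun (⋃ n, (A n : Set Λ))) ≤ ∑' n, eTraceNorm (ν.toFun (A n))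
  rw [habs _ (MeasurableSet.iUnion hm)]
  refine iSup₂_le fun s hs => ?_
  have hsum : ∀ e : H, ENNReal.ofReal (RCLike.re ⟪ν.toFun (⋃ n, (A n : Set Λ)) e, e⟫_ℂ) =
      ∑' n, ENNReal.ofReal (RCLike.re ⟪ν.toFun (A n) e, e⟫_ℂ) := fun e => by
    have h := RCLike.hasSum_re (𝕜 := ℂ) (ν.hasSum_iUnion (fun n => A n) hm hA e e)
    rw [← h.tsum_eq, ENNReal.ofReal_tsum_of_nonneg
      (fun n => (ν.isPositive _ (hm n)).re_inner_nonneg_left e) h.summable]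
  calc ∑ e ∈ s, ENNReal.ofReal (RCLike.re ⟪ν.toFun (⋃ n, (A n : Set Λ)) e, e⟫_ℂ)
      = ∑' n, ∑ e ∈ s, ENNReal.ofReal (RCLike.re ⟪ν.toFun (A n) e, e⟫_ℂ) := by
        rw [Summable.tsum_finsetSum (fun _ _ => ENNReal.summable)]
        exact Finset.sum_congr rfl fun e _ => hsum e
    _ ≤ ∑' n, eTraceNorm (ν.toFun (A n)) := by
        refine ENNReal.tsum_le_tsum fun n => ?_
        rw [habs _ (hm n)]
        exact sum_le_eTrace _ s hs

/-- The variation measure `‖ν‖₁`: its value at a measurable set `A` is the supremum of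
`∑ ‖ν(Aᵢ)‖₁` over the measurable partitions of `A`. -/
noncomputable def variation (ν : POVM Λ H) : Measure Λ :=
  preVariation (fun A => eTraceNorm (ν.toFun A)) ν.isSigmaSubadditive
    (by rw [toFun_empty, eTraceNorm_zero])

/-- `f ∈ L¹(Λ, S₁(H), ‖ν‖₁)` is a density of `ν` with respect to `‖ν‖₁`. -/
structure IsDensity (ν : POVM Λ H) (f : Λ → TraceClass H H) : Prop where
  integrable : Integrable f ν.variation
  setIntegral_eq : ∀ A, MeasurableSet A → (∫ l in A, f l ∂ν.variation).toOp = ν.toFun A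

open scoped Classical in
/-- The density `f = dν / d‖ν‖₁` (a fixed version of it). -/
noncomputable def density (ν : POVM Λ H) : Λ → TraceClass H H :=
  if h : ∃ f, ν.IsDensity f then h.choose else 0

/-- The pointwise square root `f^{1/2}` of the density. -/
noncomputable def sqrtDensity (ν : POVM Λ H) (l : Λ) : H →L[ℂ] H := CFC.sqrt (ν.density l).toOp

/-- The integrand `(Φ f^{1/2}) (Ψ f^{1/2})ᴴ`. -/
noncomputable def integrand (ν : POVM Λ H) (Φ : Λ → H →ₗ.[ℂ] G) (Ψ : Λ → H →ₗ.[ℂ] I) (l : Λ) :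
    I →L[ℂ] G :=
  pcomp (Φ l) (ν.sqrtDensity l) ∘L adjoint (pcomp (Ψ l) (ν.sqrtDensity l))

/-- The pair `(Φ, Ψ)` of `O`-measurable functions is `ν`-integrable. -/
structure IntegrablePair (ν : POVM Λ H) (Φ : Λ → H →ₗ.[ℂ] G) (Ψ : Λ → H →ₗ.[ℂ] I) : Prop where
  measurable_left : OMeasurable Φ
  measurable_right : OMeasurable Ψ
  range_left : ∀ᵐ l ∂ν.variation, ∀ x, ν.sqrtDensity l x ∈ (Φ l).domain
  range_right : ∀ᵐ l ∂ν.variation, ∀ x, ν.sqrtDensity l x ∈ (Ψ l).domain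
  hilbertSchmidt_left : ∀ᵐ l ∂ν.variation, ∃ T, IsComp (Φ l) (ν.sqrtDensity l) T ∧
    IsHilbertSchmidt T
  hilbertSchmidt_right : ∀ᵐ l ∂ν.variation, ∃ T, IsComp (Ψ l) (ν.sqrtDensity l) T ∧
    IsHilbertSchmidt T
  traceClass : ∀ᵐ l ∂ν.variation, PovmL2.IsTraceClass (ν.integrand Φ Ψ l)
  integrable : Integrable (fun l => TraceClass.ofOp (ν.integrand Φ Ψ l)) ν.variation

/-- The integral `∫ Φ dν Ψᴴ := ∫ (Φ f^{1/2}) (Ψ f^{1/2})ᴴ d‖ν‖₁ ∈ S₁(I, G)`, a Bochner integral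
in the space of trace-class operators. -/
noncomputable def integral (ν : POVM Λ H) (Φ : Λ → H →ₗ.[ℂ] G) (Ψ : Λ → H →ₗ.[ℂ] I) :
    TraceClass I G :=
  ∫ l, TraceClass.ofOp (ν.integrand Φ Ψ l) ∂ν.variation

/-- The space of square `ν`-integrable functions with values in `O(H, G)`. -/
def SqIntegrable (ν : POVM Λ H) (G : Type*) [NormedAddCommGroup G] [InnerProductSpace ℂ G]
    [CompleteSpace G] : Set (Λ → H →ₗ.[ℂ] G) :=
  {Φ | ν.IntegrablePair Φ Φ}

/-- `‖Φ‖_ν = ‖∫ Φ dν Φᴴ‖₁^{1/2}`. -/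
noncomputable def pseudoNorm (ν : POVM Λ H) (Φ : Λ → H →ₗ.[ℂ] G) : ℝ :=
  gramianNorm ν.integral Φ

/-- The relation `‖Φ - Ψ‖_ν = 0` on the space of square `ν`-integrable functions. -/
def nullRel (ν : POVM Λ H) (G : Type*) [NormedAddCommGroup G] [InnerProductSpace ℂ G]
    [CompleteSpace G] (Φ Ψ : ν.SqIntegrable G) : Prop :=
  ν.pseudoNorm ((Φ : Λ → H →ₗ.[ℂ] G) - (Ψ : Λ → H →ₗ.[ℂ] G)) = 0

/-- The quotient of the space of square `ν`-integrable functions by `{‖·‖_ν = 0}`. -/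
def L2 (ν : POVM Λ H) (G : Type*) [NormedAddCommGroup G] [InnerProductSpace ℂ G]
    [CompleteSpace G] : Type _ :=
  Quot (ν.nullRel G)

/-- The class of a square `ν`-integrable function. -/
def toL2 (ν : POVM Λ H) (Φ : ν.SqIntegrable G) : ν.L2 G := Quot.mk _ Φ

end POVM

end PovmL2

/-! Everything is read off the functions `T_Φ = Φ f^{1/2}` (`factor`). Almost everywhere `T_Φ` is
additive in `Φ` and compatible with the action of bounded operators, and `[Φ, Ψ] = ∫ T_Φ T_Ψᴴ d‖ν‖₁`
depends only on the classes of `T_Φ` and `T_Ψ`. Hölder's inequality for Schatten classes makes the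
integrand trace-class with `‖T_Φ T_Ψᴴ‖₁ ≤ ‖T_Φ‖₂² + ‖T_Ψ‖₂²`. Since `T Tᴴ` is positive, its trace
norm is `‖T‖₂²`, and since the trace norm is additive on positive operators, `‖Φ‖_ν² = ∫ ‖T_Φ‖₂²
d‖ν‖₁` (`norm_integral_self`). So `Φ ↦ T_Φ` identifies the quotient isometrically with a space of
square integrable Hilbert-Schmidt valued functions, and the algebra of parts 1 to 4 follows
pointwise.

Completeness needs the image of this embedding to be closed. A limit `S` of functions `T_{Φ_n}`
exists in the Hilbert-Schmidt valued space (`exists_hilbertSchmidt_limit`) and vanishes almost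
everywhere on `ker f^{1/2}`. Such an `S` is again of the form `Φ f^{1/2}` (`exists_isComp`): put `s
= f^{1/2}` and choose `c > 0` with `c ‖s‖ ≤ 1`. By the mean ergodic theorem the averages of the
powers of `1 - c s` converge strongly to the projection onto `ker s`. One minus such an average is a
polynomial `p_n(s)` times `s`, so `S p_n(s) s → S`. Then `Φ` is the pointwise limit of `S p_n(s)`,
with the points of convergence as its domain. Polynomials keep the approximants measurable, which
gives `O`-measurability.

The density `f` is built first (`exists_isDensity`). Each matrix entry of `ν` has a scalar
Radon-Nikodym density, by polarization from the diagonal. Finite sections of the resulting matrix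
are positive almost everywhere and its trace is integrable. A positive infinite matrix of finite
trace has finite sections that are Cauchy in trace norm (`cauchySeq_compressOp`), and dominated
convergence identifies their limit as the density. -/

set_option linter.unusedSectionVars false

namespace PovmL2

/-! ### Hilbert-Schmidt operators -/

section HilbertSchmidt

variable {E H G : Type*} [NormedAddCommGroup E] [InnerProductSpace ℂ E] [CompleteSpace E]
  [NormedAddCommGroup H] [InnerProductSpace ℂ H] [CompleteSpace H]
  [NormedAddCommGroup G] [InnerProductSpace ℂ G] [CompleteSpace G] {ι κ : Type*}

/-- The square of the Hilbert-Schmidt norm, `Tr (Tᴴ T) ∈ [0, ∞]`. -/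
noncomputable def hsNormSq (T : H →L[ℂ] G) : ℝ≥0∞ := eTrace (adjoint T ∘L T)

theorem enorm_sq_eq_ofReal (x : H) : ‖x‖ₑ ^ 2 = ENNReal.ofReal (‖x‖ ^ 2) := by
  rw [ENNReal.ofReal_pow (norm_nonneg _), ofReal_norm]

theorem ofReal_re_inner_adjoint_comp (T : H →L[ℂ] G) (e : H) :
    ENNReal.ofReal (RCLike.re ⟪(adjoint T ∘L T) e, e⟫_ℂ) = ‖T e‖ₑ ^ 2 := by
  rw [ContinuousLinearMap.coe_comp, Function.comp_apply, adjoint_inner_left,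
    inner_self_eq_norm_sq, enorm_sq_eq_ofReal]

theorem sum_enorm_sq_le_hsNormSq (T : H →L[ℂ] G) (s : Finset H)
    (hs : Orthonormal ℂ (fun e : s => (e : H))) : ∑ e ∈ s, ‖T e‖ₑ ^ 2 ≤ hsNormSq T := by
  rw [hsNormSq]
  have h := sum_le_eTrace (adjoint T ∘L T) s hs
  simpa only [ofReal_re_inner_adjoint_comp] using h

theorem hsNormSq_le {T : H →L[ℂ] G} {c : ℝ≥0∞}
    (h : ∀ s : Finset H, Orthonormal ℂ (fun e : s => (e : H)) → ∑ e ∈ s, ‖T e‖ₑ ^ 2 ≤ c) :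
    hsNormSq T ≤ c := by
  refine iSup₂_le fun s hs => ?_
  simpa only [ofReal_re_inner_adjoint_comp] using h s hs

theorem enorm_sq_eq_tsum (b : HilbertBasis ι ℂ H) (x : H) :
    ‖x‖ₑ ^ 2 = ∑' i, ‖⟪b i, x⟫_ℂ‖ₑ ^ 2 := by
  have h2 : HasSum (fun i => ‖⟪b i, x⟫_ℂ‖ ^ 2) (‖x‖ ^ 2) := by
    have h3 := RCLike.hasSum_re (𝕜 := ℂ) (b.hasSum_inner_mul_inner x x)
    rw [inner_self_eq_norm_sq] at h3
    convert h3 using 2 with i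
    rw [← inner_conj_symm x (b i), RCLike.conj_mul]
    norm_cast
  rw [enorm_sq_eq_ofReal, ← h2.tsum_eq,
    ENNReal.ofReal_tsum_of_nonneg (fun _ => sq_nonneg _) h2.summable]
  exact tsum_congr fun i => (enorm_sq_eq_ofReal _).symm

theorem orthonormal_image_finset [DecidableEq H] {v : ι → H} (hv : Orthonormal ℂ v)
    (t : Finset ι) : Orthonormal ℂ (fun e : (t.image v : Finset H) => (e : H)) := by
  have h : Orthonormal ℂ ((↑) : Set.range v → H) := Orthonormal.toSubtypeRange hv
  exact h.comp (fun e : (t.image v : Finset H) => (⟨(e : H), by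
    obtain ⟨i, -, hi⟩ := Finset.mem_image.1 e.2
    exact ⟨i, hi⟩⟩ : Set.range v)) (fun e e' h => by
      have h' := congrArg (fun z : Set.range v => (z : H)) h
      exact Subtype.ext h')

theorem tsum_le_eTrace {v : ι → H} (hv : Orthonormal ℂ v) (A : H →L[ℂ] H) :
    ∑' i, ENNReal.ofReal (RCLike.re ⟪A (v i), v i⟫_ℂ) ≤ eTrace A := by
  classical
  refine ENNReal.summable.tsum_le_of_sum_le fun t => ?_
  rw [← Finset.sum_image (f := fun e => ENNReal.ofReal (RCLike.re ⟪A e, e⟫_ℂ)) (g := v)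
    (fun i _ j _ h => hv.linearIndependent.injective h)]
  exact sum_le_eTrace _ _ (orthonormal_image_finset hv t)

theorem tsum_enorm_sq_le_hsNormSq {v : ι → H} (hv : Orthonormal ℂ v) (T : H →L[ℂ] G) :
    ∑' i, ‖T (v i)‖ₑ ^ 2 ≤ hsNormSq T := by
  rw [hsNormSq]
  simpa only [ofReal_re_inner_adjoint_comp] using tsum_le_eTrace hv (adjoint T ∘L T)

theorem sum_enorm_inner_sq_le (x : H) (s : Finset H) (hs : Orthonormal ℂ (fun e : s => (e : H))) :
    ∑ e ∈ s, ‖⟪x, e⟫_ℂ‖ₑ ^ 2 ≤ ‖x‖ₑ ^ 2 := by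
  have h2 := hs.sum_inner_products_le x (s := Finset.univ)
  rw [Finset.univ_eq_attach, Finset.sum_attach s (fun e => ‖⟪e, x⟫_ℂ‖ ^ 2)] at h2
  simp only [enorm_sq_eq_ofReal]
  rw [← ENNReal.ofReal_sum_of_nonneg (fun _ _ => sq_nonneg _)]
  refine ENNReal.ofReal_le_ofReal (le_trans (le_of_eq ?_) h2)
  exact Finset.sum_congr rfl fun e _ => by rw [norm_inner_symm]

/-- Parseval in `c` expands each `‖T e‖²`; after exchanging the sums, Bessel's inequality for the
system `s` bounds each term. Applied to `T` and to its adjoint, this yields both the invariance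
under adjoints and the independence of the basis. -/
theorem hsNormSq_le_tsum_adjoint (T : H →L[ℂ] G) (c : HilbertBasis κ ℂ G) :
    hsNormSq T ≤ ∑' j, ‖adjoint T (c j)‖ₑ ^ 2 := by
  refine hsNormSq_le fun s hs => ?_
  calc ∑ e ∈ s, ‖T e‖ₑ ^ 2 = ∑' j, ∑ e ∈ s, ‖⟪adjoint T (c j), e⟫_ℂ‖ₑ ^ 2 := by
        rw [Summable.tsum_finsetSum (fun _ _ => ENNReal.summable)]
        refine Finset.sum_congr rfl fun e _ => ?_
        rw [enorm_sq_eq_tsum c]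
        simp only [adjoint_inner_left]
    _ ≤ ∑' j, ‖adjoint T (c j)‖ₑ ^ 2 :=
        ENNReal.tsum_le_tsum fun j => sum_enorm_inner_sq_le _ s hs

theorem hsNormSq_adjoint_le (T : H →L[ℂ] G) : hsNormSq T ≤ hsNormSq (adjoint T) := by
  obtain ⟨w, c, -⟩ := exists_hilbertBasis ℂ G
  exact (hsNormSq_le_tsum_adjoint T c).trans (tsum_enorm_sq_le_hsNormSq c.orthonormal _)

theorem hsNormSq_adjoint (T : H →L[ℂ] G) : hsNormSq (adjoint T) = hsNormSq T :=
  le_antisymm ((hsNormSq_adjoint_le _).trans_eq (by rw [adjoint_adjoint])) (hsNormSq_adjoint_le T)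

theorem hsNormSq_eq_tsum (b : HilbertBasis ι ℂ H) (T : H →L[ℂ] G) :
    hsNormSq T = ∑' i, ‖T (b i)‖ₑ ^ 2 := by
  refine le_antisymm ?_ (tsum_enorm_sq_le_hsNormSq b.orthonormal T)
  rw [← hsNormSq_adjoint]
  simpa using hsNormSq_le_tsum_adjoint (adjoint T) b

theorem hsNormSq_comp_left_le (P : G →L[ℂ] E) (T : H →L[ℂ] G) :
    hsNormSq (P ∘L T) ≤ ‖P‖ₑ ^ 2 * hsNormSq T := by
  refine hsNormSq_le fun s hs => ?_
  refine le_trans ?_ (mul_le_mul_right (sum_enorm_sq_le_hsNormSq T s hs) _)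
  rw [Finset.mul_sum]
  refine Finset.sum_le_sum fun e _ => ?_
  rw [← mul_pow]
  gcongr
  exact P.le_opENorm (T e)

theorem hsNormSq_comp_right_le (T : H →L[ℂ] G) (P : E →L[ℂ] H) :
    hsNormSq (T ∘L P) ≤ ‖P‖ₑ ^ 2 * hsNormSq T := by
  rw [← hsNormSq_adjoint, adjoint_comp, ← hsNormSq_adjoint T]
  refine (hsNormSq_comp_left_le _ _).trans_eq ?_
  rw [← ofReal_norm (adjoint P), LinearIsometryEquiv.norm_map, ofReal_norm]

theorem enorm_add_sq_le (x y : H) : ‖x + y‖ₑ ^ 2 ≤ 2 * (‖x‖ₑ ^ 2 + ‖y‖ₑ ^ 2) := by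
  simp only [enorm_sq_eq_ofReal]
  rw [← ENNReal.ofReal_add (by positivity) (by positivity), ← ENNReal.ofReal_ofNat,
    ← ENNReal.ofReal_mul (by norm_num)]
  apply ENNReal.ofReal_le_ofReal
  have h := norm_add_le x y
  nlinarith [sq_nonneg (‖x‖ - ‖y‖), norm_nonneg (x + y), norm_nonneg x, norm_nonneg y]

/-- The crude factor `2` from `(a + b)² ≤ 2 (a² + b²)` suffices, because only finiteness of such
sums is ever needed. -/
theorem hsNormSq_add_le (S T : H →L[ℂ] G) :
    hsNormSq (S + T) ≤ 2 * (hsNormSq S + hsNormSq T) := by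
  refine hsNormSq_le fun s hs => ?_
  calc ∑ e ∈ s, ‖(S + T) e‖ₑ ^ 2 ≤ ∑ e ∈ s, 2 * (‖S e‖ₑ ^ 2 + ‖T e‖ₑ ^ 2) :=
        Finset.sum_le_sum fun e _ => enorm_add_sq_le _ _
    _ = 2 * (∑ e ∈ s, ‖S e‖ₑ ^ 2 + ∑ e ∈ s, ‖T e‖ₑ ^ 2) := by
        rw [← Finset.mul_sum, Finset.sum_add_distrib]
    _ ≤ 2 * (hsNormSq S + hsNormSq T) := by
        gcongr <;> exact sum_enorm_sq_le_hsNormSq _ s hs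

theorem hsNormSq_neg (T : H →L[ℂ] G) : hsNormSq (-T) = hsNormSq T := by
  simp [hsNormSq]

theorem hsNormSq_sub_comm (S T : H →L[ℂ] G) : hsNormSq (S - T) = hsNormSq (T - S) := by
  rw [← hsNormSq_neg, neg_sub]

theorem hsNormSq_zero : hsNormSq (0 : H →L[ℂ] G) = 0 :=
  le_antisymm (hsNormSq_le fun s _ => by simp) zero_le

/-- A single unit vector is already an admissible orthonormal system. -/
theorem opNorm_sq_le_hsNormSq (T : H →L[ℂ] G) : ‖T‖ₑ ^ 2 ≤ hsNormSq T := by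
  rcases eq_or_ne (hsNormSq T) ∞ with h | h
  · rw [h]
    exact le_top
  rw [← ofReal_norm, ← ENNReal.ofReal_pow (norm_nonneg _), ENNReal.ofReal_le_iff_le_toReal h]
  rw [← Real.le_sqrt (norm_nonneg _) ENNReal.toReal_nonneg]
  refine opNorm_le_of_unit_norm (Real.sqrt_nonneg _) fun e he => ?_
  refine Real.le_sqrt_of_sq_le ?_
  have hs : Orthonormal ℂ (fun x : ({e} : Finset H) => (x : H)) := by
    refine ⟨fun x => ?_, fun x y hxy => ?_⟩
    · change ‖(x : H)‖ = 1
      rw [Finset.mem_singleton.1 x.2, he]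
    · exact absurd (Subtype.ext ((Finset.mem_singleton.1 x.2).trans
        (Finset.mem_singleton.1 y.2).symm)) hxy
  have h1 := sum_enorm_sq_le_hsNormSq T {e} hs
  rwa [Finset.sum_singleton, enorm_sq_eq_ofReal, ENNReal.ofReal_le_iff_le_toReal h] at h1

theorem hsNormSq_eq_zero {T : H →L[ℂ] G} : hsNormSq T = 0 ↔ T = 0 := by
  refine ⟨fun h => ?_, fun h => h ▸ hsNormSq_zero⟩
  have h1 := opNorm_sq_le_hsNormSq T
  rw [h, nonpos_iff_eq_zero, pow_eq_zero_iff two_ne_zero, ← ofReal_norm, ENNReal.ofReal_eq_zero] at h1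
  exact norm_le_zero_iff.1 h1

end HilbertSchmidt

/-! ### Products of Hilbert-Schmidt operators and the trace norm -/

section Ideal

variable {E H G : Type*} [NormedAddCommGroup E] [InnerProductSpace ℂ E] [CompleteSpace E]
  [NormedAddCommGroup H] [InnerProductSpace ℂ H] [CompleteSpace H]
  [NormedAddCommGroup G] [InnerProductSpace ℂ G] [CompleteSpace G] {ι κ : Type*}

theorem eTraceNorm_of_nonneg {A : H →L[ℂ] H} (hA : 0 ≤ A) : eTraceNorm A = eTrace A := by
  rw [eTraceNorm, opAbs_of_nonneg hA]

/-- The operator `T Tᴴ` is positive, so its trace norm is its trace, which is the squared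
Hilbert-Schmidt norm of `Tᴴ`. This is the link between the norm of the Gramian and the norm of
`L²(S₂)`. -/
theorem eTraceNorm_comp_adjoint_self (T : H →L[ℂ] G) :
    eTraceNorm (T ∘L adjoint T) = hsNormSq T := by
  have h := adjoint_comp_self_nonneg (adjoint T)
  have h2 := hsNormSq_adjoint T
  rw [hsNormSq, adjoint_adjoint] at h2
  rw [adjoint_adjoint] at h
  rw [eTraceNorm_of_nonneg h, h2]

/-- Hölder's inequality `‖S Tᴴ‖₁ ≤ ‖S‖₂ ‖T‖₂`. -/
theorem eTraceNorm_comp_adjoint_le (S : H →L[ℂ] G) (T : H →L[ℂ] E) :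
    eTraceNorm (S ∘L adjoint T) ≤ (hsNormSq S * hsNormSq T) ^ (2⁻¹ : ℝ) := by
  -- By duality it suffices to bound `∑ |⟪Tᴴ e, Sᴴ C e⟫|`, which is Cauchy-Schwarz first in the
  -- space and then in the sum.
  refine eTraceNorm_le _ _ fun C hC s hs => ?_
  have h1 : ∑ e ∈ s, ‖adjoint T e‖ₑ ^ 2 ≤ hsNormSq T :=
    (sum_enorm_sq_le_hsNormSq _ s hs).trans_eq (hsNormSq_adjoint T)
  have h2 : ∑ e ∈ s, ‖adjoint S (C e)‖ₑ ^ 2 ≤ hsNormSq S := by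
    refine (sum_enorm_sq_le_hsNormSq (adjoint S ∘L C) s hs).trans ?_
    refine (hsNormSq_comp_right_le _ _).trans ?_
    rw [hsNormSq_adjoint]
    refine mul_le_of_le_one_left' (pow_le_one₀ zero_le ?_)
    rw [← ofReal_norm, ← ENNReal.ofReal_one]
    exact ENNReal.ofReal_le_ofReal hC
  rw [ENNReal.le_rpow_inv_iff two_pos, ENNReal.rpow_two]
  refine le_trans ?_ (mul_le_mul' h2 h1)
  rw [← ENNReal.ofReal_sum_of_nonneg (fun _ _ => norm_nonneg _),
    ← ENNReal.ofReal_pow (Finset.sum_nonneg fun _ _ => norm_nonneg _)]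
  simp only [enorm_sq_eq_ofReal]
  rw [← ENNReal.ofReal_sum_of_nonneg (fun _ _ => sq_nonneg _),
    ← ENNReal.ofReal_sum_of_nonneg (fun _ _ => sq_nonneg _),
    ← ENNReal.ofReal_mul (Finset.sum_nonneg fun _ _ => sq_nonneg _)]
  refine ENNReal.ofReal_le_ofReal (le_trans ?_ (Finset.sum_mul_sq_le_sq_mul_sq s _ _))
  gcongr with e he
  rw [ContinuousLinearMap.coe_comp, Function.comp_apply, ← adjoint_inner_right, mul_comm]
  exact norm_inner_le_norm _ _

/-- From `√(ab) ≤ a + b`. This additive form can be integrated directly, without Hölder's inequality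
for the scalar integral. -/
theorem eTraceNorm_comp_adjoint_le_add (S : H →L[ℂ] G) (T : H →L[ℂ] E) :
    eTraceNorm (S ∘L adjoint T) ≤ hsNormSq S + hsNormSq T := by
  refine (eTraceNorm_comp_adjoint_le S T).trans ?_
  rw [ENNReal.rpow_inv_le_iff two_pos, ENNReal.rpow_two, sq]
  exact mul_le_mul' le_self_add le_add_self

/-- A trace-class operator is a product of two Hilbert-Schmidt operators. -/
theorem exists_eq_comp_adjoint (T : H →L[ℂ] G) :
    ∃ (V : H →L[ℂ] G) (W : H →L[ℂ] H), T = V ∘L adjoint W ∧ hsNormSq V ≤ eTraceNorm T ∧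
      hsNormSq W ≤ eTraceNorm T := by
  obtain ⟨U, hU, hUT, -⟩ := exists_polar T
  obtain ⟨B, hBadj, hBB⟩ := exists_sqrt_opAbs T
  have hB : hsNormSq B ≤ eTraceNorm T := by
    rw [hsNormSq, hBadj, hBB, eTraceNorm]
  -- With `B = |T|^{1/2}`, the polar decomposition reads `T = (U B) B`, and `‖B‖₂² = Tr |T|`.
  refine ⟨U ∘L B, B, ?_, ?_, hB⟩
  · rw [hBadj, ContinuousLinearMap.comp_assoc, hBB]
    exact ContinuousLinearMap.ext fun x => (hUT x).symm
  · refine (hsNormSq_comp_left_le _ _).trans (le_trans ?_ hB)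
    refine mul_le_of_le_one_left' (pow_le_one₀ zero_le ?_)
    rw [← ofReal_norm, ← ENNReal.ofReal_one]
    exact ENNReal.ofReal_le_ofReal hU

theorem exists_eq_comp_adjoint_self {A : H →L[ℂ] H} (hA : 0 ≤ A) :
    ∃ V : H →L[ℂ] H, A = V ∘L adjoint V := by
  obtain ⟨B, hBadj, hBB⟩ := exists_sqrt_opAbs A
  exact ⟨B, by rw [hBadj, hBB, opAbs_of_nonneg hA]⟩

theorem rpow_inv_two_mul_self_mul (a t : ℝ≥0∞) :
    (a ^ 2 * t * t) ^ (2⁻¹ : ℝ) = a * t := by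
  rw [mul_assoc, ← sq, ← mul_pow, ← ENNReal.rpow_two, ← ENNReal.rpow_mul]
  simp

/-- Factor `T = V Wᴴ`, absorb `P` into `V`, and apply Hölder. -/
theorem eTraceNorm_comp_left_le (P : G →L[ℂ] E) (T : H →L[ℂ] G) :
    eTraceNorm (P ∘L T) ≤ ‖P‖ₑ * eTraceNorm T := by
  obtain ⟨V, W, hT, hV, hW⟩ := exists_eq_comp_adjoint T
  calc eTraceNorm (P ∘L T) = eTraceNorm ((P ∘L V) ∘L adjoint W) := by
        rw [ContinuousLinearMap.comp_assoc, ← hT]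
    _ ≤ (hsNormSq (P ∘L V) * hsNormSq W) ^ (2⁻¹ : ℝ) := eTraceNorm_comp_adjoint_le _ _
    _ ≤ (‖P‖ₑ ^ 2 * eTraceNorm T * eTraceNorm T) ^ (2⁻¹ : ℝ) := by
        gcongr
        exact (hsNormSq_comp_left_le _ _).trans (by gcongr)
    _ = ‖P‖ₑ * eTraceNorm T := rpow_inv_two_mul_self_mul _ _

/-- Writing `A = V Vᴴ` turns the trace into a squared Hilbert-Schmidt norm, which any Hilbert basis
computes. -/
theorem eTrace_eq_tsum (b : HilbertBasis ι ℂ H) {A : H →L[ℂ] H} (hA : 0 ≤ A) :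
    eTrace A = ∑' i, ENNReal.ofReal (RCLike.re ⟪A (b i), b i⟫_ℂ) := by
  obtain ⟨V, hV⟩ := exists_eq_comp_adjoint_self hA
  have h := hsNormSq_eq_tsum b (adjoint V)
  simp only [← ofReal_re_inner_adjoint_comp] at h
  rw [hsNormSq, adjoint_adjoint] at h
  rw [hV, h]

end Ideal

/-! ### Finite-rank compressions and their convergence in trace norm -/

section Compression

variable {E H G : Type*} [NormedAddCommGroup E] [InnerProductSpace ℂ E] [CompleteSpace E]
  [NormedAddCommGroup H] [InnerProductSpace ℂ H] [CompleteSpace H]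
  [NormedAddCommGroup G] [InnerProductSpace ℂ G] [CompleteSpace G] {ι κ : Type*}

/-- Orthonormal vectors are at distance at least `1`, so the balls of radius `1/2` around them are
disjoint open sets. -/
theorem countable_of_orthonormal [TopologicalSpace.SeparableSpace H] {v : ι → H}
    (hv : Orthonormal ℂ v) : Countable ι := by
  have hdist : ∀ i j, i ≠ j → 1 ≤ dist (v i) (v j) := by
    intro i j hij
    have h := @norm_sub_sq ℂ H _ _ _ (v i) (v j)
    rw [hv.2 hij, hv.1 i, hv.1 j] at h
    rw [dist_eq_norm]
    have h0 := norm_nonneg (v i - v j)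
    simp only [map_zero, mul_zero] at h
    nlinarith
  refine Pairwise.countable_of_isOpen_disjoint (s := fun i => Metric.ball (v i) (1 / 2)) ?_
    (fun i => Metric.isOpen_ball) (fun i => ⟨v i, Metric.mem_ball_self (by norm_num)⟩)
  intro i j hij
  refine Metric.ball_disjoint_ball ?_
  linarith [hdist i j hij]

theorem exists_countable_hilbertBasis (H : Type*) [NormedAddCommGroup H] [InnerProductSpace ℂ H]
    [CompleteSpace H] [TopologicalSpace.SeparableSpace H] :
    ∃ w : Set H, Countable w ∧ Nonempty (HilbertBasis w ℂ H) := by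
  obtain ⟨w, b, -⟩ := exists_hilbertBasis ℂ H
  exact ⟨w, countable_of_orthonormal b.orthonormal, ⟨b⟩⟩

/-- The orthogonal projection onto the span of finitely many vectors of a Hilbert basis. -/
noncomputable def basisProj (b : HilbertBasis ι ℂ H) (t : Finset ι) : H →L[ℂ] H :=
  ∑ i ∈ t, InnerProductSpace.rankOne ℂ (b i) (b i)

theorem basisProj_apply (b : HilbertBasis ι ℂ H) (t : Finset ι) (x : H) :
    basisProj b t x = ∑ i ∈ t, ⟪b i, x⟫_ℂ • b i := by
  simp [basisProj, sum_apply]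

theorem adjoint_basisProj (b : HilbertBasis ι ℂ H) (t : Finset ι) :
    adjoint (basisProj b t) = basisProj b t := by
  simp [basisProj, map_sum]

theorem basisProj_apply_basis [DecidableEq ι] (b : HilbertBasis ι ℂ H) (t : Finset ι) (i : ι) :
    basisProj b t (b i) = if i ∈ t then b i else 0 := by
  have h : ∀ j, ⟪b j, b i⟫_ℂ = if j = i then 1 else 0 :=
    fun j => orthonormal_iff_ite.1 b.orthonormal j i
  simp [basisProj_apply, h]

theorem enorm_basisProj_le (b : HilbertBasis ι ℂ H) (t : Finset ι) : ‖basisProj b t‖ₑ ≤ 1 := by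
  rw [← ofReal_norm, ← ENNReal.ofReal_one]
  refine ENNReal.ofReal_le_ofReal (opNorm_le_bound _ zero_le_one fun x => ?_)
  rw [one_mul]
  refine abs_le_of_sq_le_sq' ?_ (norm_nonneg _) |>.2
  have h1 : ‖basisProj b t x‖ ^ 2 = ∑ i ∈ t, ‖⟪b i, x⟫_ℂ‖ ^ 2 := by
    rw [basisProj_apply, ← inner_self_eq_norm_sq (𝕜 := ℂ), b.orthonormal.inner_sum, map_sum]
    refine Finset.sum_congr rfl fun i _ => ?_
    rw [RCLike.conj_mul, ← RCLike.ofReal_pow, RCLike.ofReal_re]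
  rw [h1]
  exact b.orthonormal.sum_inner_products_le x

/-- The complementary projection of `basisProj`. -/
noncomputable def basisCoproj (b : HilbertBasis ι ℂ H) (t : Finset ι) : H →L[ℂ] H :=
  ContinuousLinearMap.id ℂ H - basisProj b t

theorem adjoint_basisCoproj (b : HilbertBasis ι ℂ H) (t : Finset ι) :
    adjoint (basisCoproj b t) = basisCoproj b t := by
  rw [basisCoproj, map_sub, adjoint_id, adjoint_basisProj]

/-- The complementary projection kills `b i` for `i ∈ t` and fixes the others, so computing with the
adjoint leaves the tail of a series. The tail tends to zero when `V` is Hilbert-Schmidt. -/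
theorem hsNormSq_basisCoproj_comp (b : HilbertBasis ι ℂ H) (t : Finset ι) (V : G →L[ℂ] H) :
    hsNormSq (basisCoproj b t ∘L V) = ∑' i : {i // i ∉ t}, ‖adjoint V (b i)‖ₑ ^ 2 := by
  classical
  rw [← hsNormSq_adjoint, hsNormSq_eq_tsum b, adjoint_comp, adjoint_basisCoproj]
  have h : ∀ i, ‖(adjoint V ∘L basisCoproj b t) (b i)‖ₑ ^ 2 =
      ({i | i ∉ t} : Set ι).indicator (fun i => ‖adjoint V (b i)‖ₑ ^ 2) i := by
    intro i
    simp only [basisCoproj, ContinuousLinearMap.coe_comp, Function.comp_apply, sub_apply,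
      id_apply, basisProj_apply_basis]
    by_cases hi : i ∈ t <;> simp [hi]
  rw [tsum_congr h]
  exact (tsum_subtype ({i | i ∉ t} : Set ι) fun i => ‖adjoint V (b i)‖ₑ ^ 2).symm

theorem tendsto_hsNormSq_basisCoproj_comp (b : HilbertBasis ι ℂ H) (V : G →L[ℂ] H)
    (hV : hsNormSq V ≠ ∞) :
    Tendsto (fun t => hsNormSq (basisCoproj b t ∘L V)) atTop (𝓝 0) := by
  simp only [hsNormSq_basisCoproj_comp]
  rw [← hsNormSq_adjoint, hsNormSq_eq_tsum b] at hV
  exact ENNReal.tendsto_tsum_compl_atTop_zero hV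

/-- The compression `P T P` to the span of finitely many vectors of a Hilbert basis. -/
noncomputable def compress (b : HilbertBasis ι ℂ H) (t : Finset ι) (T : H →L[ℂ] H) :
    H →L[ℂ] H := basisProj b t ∘L T ∘L basisProj b t

theorem compress_eq_sum (b : HilbertBasis ι ℂ H) (t : Finset ι) (T : H →L[ℂ] H) :
    compress b t T = ∑ i ∈ t, ∑ j ∈ t,
      ⟪b j, T (b i)⟫_ℂ • InnerProductSpace.rankOne ℂ (b j) (b i) := by
  ext x
  simp only [compress, ContinuousLinearMap.coe_comp, Function.comp_apply, sum_apply, smul_apply,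
    InnerProductSpace.rankOne_apply]
  rw [basisProj_apply b t x, map_sum, map_sum]
  refine Finset.sum_congr rfl fun i _ => ?_
  rw [map_smul, map_smul, basisProj_apply, Finset.smul_sum]
  exact Finset.sum_congr rfl fun j _ => smul_comm _ _ _

/-- With `Q = 1 - P`, one has `A - P A P = Q A + P A Q`. For `A = V Wᴴ`, the projection `Q` is
absorbed into one Hilbert-Schmidt factor of each term before applying Hölder. The bound is
quantitative because it is also used when no limit operator is known yet. -/
theorem eTraceNorm_sub_compress_le (b : HilbertBasis ι ℂ H) (t : Finset ι) (V : G →L[ℂ] H)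
    (W : G →L[ℂ] H) : eTraceNorm (V ∘L adjoint W - compress b t (V ∘L adjoint W)) ≤
      (hsNormSq (basisCoproj b t ∘L V) * hsNormSq W) ^ (2⁻¹ : ℝ) +
        (hsNormSq V * hsNormSq (basisCoproj b t ∘L W)) ^ (2⁻¹ : ℝ) := by
  have h : V ∘L adjoint W - compress b t (V ∘L adjoint W) =
      (basisCoproj b t ∘L V) ∘L adjoint W +
        basisProj b t ∘L (V ∘L adjoint (basisCoproj b t ∘L W)) := by
    rw [adjoint_comp, adjoint_basisCoproj]
    ext x
    simp [compress, basisCoproj]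
  rw [h]
  refine (eTraceNorm_add_le _ _).trans (add_le_add (eTraceNorm_comp_adjoint_le _ _) ?_)
  refine (eTraceNorm_comp_left_le _ _).trans ?_
  refine (mul_le_of_le_one_left' (enorm_basisProj_le b t)).trans ?_
  exact eTraceNorm_comp_adjoint_le _ _

theorem tendsto_eTraceNorm_sub_compress (b : HilbertBasis ι ℂ H) {T : H →L[ℂ] H}
    (hT : IsTraceClass T) :
    Tendsto (fun t => eTraceNorm (T - compress b t T)) atTop (𝓝 0) := by
  obtain ⟨V, W, hVW, hV, hW⟩ := exists_eq_comp_adjoint T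
  have hV' : hsNormSq V ≠ ∞ := (hV.trans_lt hT).ne
  have hW' : hsNormSq W ≠ ∞ := (hW.trans_lt hT).ne
  have h1 := ENNReal.Tendsto.mul_const (b := hsNormSq W) (tendsto_hsNormSq_basisCoproj_comp b V hV')
    (Or.inr hW')
  have h2 := ENNReal.Tendsto.const_mul (a := hsNormSq V) (tendsto_hsNormSq_basisCoproj_comp b W hW')
    (Or.inr hV')
  have h3 := ((ENNReal.continuous_rpow_const (y := (2⁻¹ : ℝ))).tendsto _).comp h1
  have h4 := ((ENNReal.continuous_rpow_const (y := (2⁻¹ : ℝ))).tendsto _).comp h2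
  have h5 := h3.add h4
  simp only [zero_mul, mul_zero, ENNReal.zero_rpow_of_pos (inv_pos.2 two_pos : (0 : ℝ) < 2⁻¹),
    add_zero] at h5
  refine tendsto_of_tendsto_of_tendsto_of_le_of_le tendsto_const_nhds h5 (fun _ => zero_le)
    fun t => ?_
  have h6 := eTraceNorm_sub_compress_le b t V W
  rw [← hVW] at h6
  exact h6

theorem hsNormSq_innerSL (z : H) : hsNormSq (innerSL ℂ z : H →L[ℂ] ℂ) = ‖z‖ₑ ^ 2 := by
  obtain ⟨w, c, -⟩ := exists_hilbertBasis ℂ H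
  rw [hsNormSq_eq_tsum c, enorm_sq_eq_tsum c]
  refine tsum_congr fun j => ?_
  rw [innerSL_apply_apply, ← ofReal_norm, norm_inner_symm, ofReal_norm]

/-- A rank-one operator factors through `ℂ` as a product of two Hilbert-Schmidt operators. -/
theorem isTraceClass_rankOne (x : G) (y : H) :
    IsTraceClass (InnerProductSpace.rankOne ℂ x y) := by
  have h : InnerProductSpace.rankOne ℂ x y = adjoint (innerSL ℂ x : G →L[ℂ] ℂ) ∘L
      adjoint (adjoint (innerSL ℂ y : H →L[ℂ] ℂ)) := by
    rw [adjoint_adjoint, adjoint_innerSL_apply, InnerProductSpace.rankOne_def']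
  rw [h, IsTraceClass]
  refine (eTraceNorm_comp_adjoint_le_add _ _).trans_lt ?_
  rw [hsNormSq_adjoint, hsNormSq_adjoint, hsNormSq_innerSL, hsNormSq_innerSL]
  exact ENNReal.add_lt_top.2 ⟨ENNReal.pow_lt_top enorm_lt_top, ENNReal.pow_lt_top enorm_lt_top⟩

end Compression

/-! ### Matrix entries and finite sections in the trace class -/

namespace TraceClass

variable {E H G : Type*} [NormedAddCommGroup E] [InnerProductSpace ℂ E] [CompleteSpace E]
  [NormedAddCommGroup H] [InnerProductSpace ℂ H] [CompleteSpace H]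
  [NormedAddCommGroup G] [InnerProductSpace ℂ G] [CompleteSpace G] {ι κ : Type*}

theorem toOp_ofOp {T : H →L[ℂ] G} (hT : IsTraceClass T) : (ofOp T).toOp = T := by
  have h : ofOp T = mk T hT := dif_pos hT
  rw [h]
  rfl

theorem enorm_eq (T : TraceClass H G) : ‖T‖ₑ = eTraceNorm T.toOp := by
  rw [← ofReal_norm, norm_def, ENNReal.ofReal_toReal T.eTraceNorm_ne_top]

/-- The inclusion `S₁(H, G) → L_b(H, G)`. -/
noncomputable def toOpL : TraceClass H G →L[ℂ] H →L[ℂ] G :=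
  LinearMap.mkContinuous
    { toFun := toOp
      map_add' := fun _ _ => rfl
      map_smul' := fun _ _ => rfl } 1 fun T => by
        rw [one_mul]
        exact opNorm_le_norm T

theorem toOp_sub (S T : TraceClass H G) : (S - T).toOp = S.toOp - T.toOp := rfl

theorem toOp_sum (t : Finset ι) (T : ι → TraceClass H G) :
    (∑ i ∈ t, T i).toOp = ∑ i ∈ t, (T i).toOp := map_sum toOpL T t

theorem toOp_smul (c : ℂ) (T : TraceClass H G) : (c • T).toOp = c • T.toOp := rfl

/-- The matrix entry `⟪x, T y⟫` as a functional of the trace-class operator `T`. -/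
noncomputable def entry (x : G) (y : H) : TraceClass H G →L[ℂ] ℂ :=
  innerSL ℂ x ∘L ContinuousLinearMap.apply ℂ G y ∘L toOpL

/-- The compression of a bounded operator, as a trace-class operator. -/
noncomputable def compressOp (b : HilbertBasis ι ℂ H) (t : Finset ι) (m : ι → ι → ℂ) :
    TraceClass H H :=
  ∑ i ∈ t, ∑ j ∈ t, m i j • ofOp (InnerProductSpace.rankOne ℂ (b j) (b i))

theorem toOp_compressOp (b : HilbertBasis ι ℂ H) (t : Finset ι) (m : ι → ι → ℂ) :
    (compressOp b t m).toOp = ∑ i ∈ t, ∑ j ∈ t,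
      m i j • InnerProductSpace.rankOne ℂ (b j) (b i) := by
  simp only [compressOp, toOp_sum, toOp_smul, toOp_ofOp (isTraceClass_rankOne _ _)]

theorem tendsto_compressOp (b : HilbertBasis ι ℂ H) (T : TraceClass H H) :
    Tendsto (fun t => compressOp b t fun i j => ⟪b j, T.toOp (b i)⟫_ℂ) atTop (𝓝 T) := by
  rw [tendsto_iff_edist_tendsto_0]
  refine (tendsto_eTraceNorm_sub_compress b T.2).congr fun t => ?_
  rw [edist_comm, edist_eq_enorm_sub, enorm_eq, toOp_sub, toOp_compressOp, ← compress_eq_sum]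
  rfl

end TraceClass

/-! ### Bochner integrals of trace-class operators -/

section Measure

variable {Λ H G : Type*} [MeasurableSpace Λ] {μ : Measure Λ}
  [NormedAddCommGroup H] [InnerProductSpace ℂ H] [CompleteSpace H]
  [NormedAddCommGroup G] [InnerProductSpace ℂ G] [CompleteSpace G]

/-- Weakly measurable functions with values in the trace-class operators of a separable space are
strongly measurable. -/
theorem TraceClass.aestronglyMeasurable_of_entry [TopologicalSpace.SeparableSpace H]
    {g : Λ → TraceClass H H}
    (hg : ∀ x y, AEStronglyMeasurable (fun l => ⟪x, (g l).toOp y⟫_ℂ) μ) :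
    AEStronglyMeasurable g μ := by
  obtain ⟨w, hw, ⟨b⟩⟩ := exists_countable_hilbertBasis H
  -- The finite subsets of a countable basis are countable, so the net of compressions may be used
  -- as an approximating sequence. Each compression is a finite combination of fixed rank-one
  -- operators with measurable coefficients.
  refine aestronglyMeasurable_of_tendsto_ae atTop
    (f := fun t l => TraceClass.compressOp b t fun i j => ⟪b j, (g l).toOp (b i)⟫_ℂ) (fun t => ?_)
    (Eventually.of_forall fun l => TraceClass.tendsto_compressOp b (g l))
  unfold TraceClass.compressOp
  refine Finset.aestronglyMeasurable_fun_sum _ fun i _ =>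
    Finset.aestronglyMeasurable_fun_sum _ fun j _ => ?_
  exact (hg (b j) (b i)).smul_const _

theorem TraceClass.entry_integral {g : Λ → TraceClass H G} (hg : Integrable g μ) (x : G) (y : H) :
    ⟪x, (∫ l, g l ∂μ).toOp y⟫_ℂ = ∫ l, ⟪x, (g l).toOp y⟫_ℂ ∂μ :=
  ((TraceClass.entry x y).integral_comp_comm hg).symm

theorem TraceClass.integrable_entry {g : Λ → TraceClass H G} (hg : Integrable g μ) (x : G)
    (y : H) : Integrable (fun l => ⟪x, (g l).toOp y⟫_ℂ) μ :=
  (TraceClass.entry x y).integrable_comp hg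

/-- Positivity is split into real conditions on the quadratic form, each of which passes through
integrals and is closed in `x`. -/
theorem isPositive_iff_inner {A : H →L[ℂ] H} :
    A.IsPositive ↔ ∀ x, 0 ≤ RCLike.re ⟪x, A x⟫_ℂ ∧ RCLike.im ⟪x, A x⟫_ℂ = 0 := by
  rw [ContinuousLinearMap.isPositive_iff_complex]
  refine forall_congr' fun x => ?_
  rw [← inner_conj_symm x (A x), RCLike.conj_re, RCLike.conj_im, neg_eq_zero, and_comm]
  refine and_congr_right fun _ => ?_
  rw [RCLike.ext_iff (K := ℂ)]
  simp [eq_comm]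

theorem TraceClass.isPositive_integral {g : Λ → TraceClass H H} (hg : Integrable g μ)
    (hpos : ∀ᵐ l ∂μ, (g l).toOp.IsPositive) : (∫ l, g l ∂μ).toOp.IsPositive := by
  refine isPositive_iff_inner.2 fun x => ?_
  rw [TraceClass.entry_integral hg, ← integral_re (TraceClass.integrable_entry hg x x),
    ← integral_im (TraceClass.integrable_entry hg x x)]
  constructor
  · refine integral_nonneg_of_ae ?_
    filter_upwards [hpos] with l hl
    exact (isPositive_iff_inner.1 hl x).1
  · refine integral_eq_zero_of_ae ?_
    filter_upwards [hpos] with l hl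
    exact (isPositive_iff_inner.1 hl x).2

/-- For each fixed `x` this is the scalar criterion by integrals over sets. A dense sequence of
vectors needs only one null set, and continuity in `x` covers the remaining vectors. -/
theorem TraceClass.ae_isPositive_of_setIntegral [TopologicalSpace.SeparableSpace H]
    {g : Λ → TraceClass H H} (hg : Integrable g μ)
    (hpos : ∀ A, MeasurableSet A → (∫ l in A, g l ∂μ).toOp.IsPositive) :
    ∀ᵐ l ∂μ, (g l).toOp.IsPositive := by
  have key : ∀ x, ∀ᵐ l ∂μ, 0 ≤ RCLike.re ⟪x, (g l).toOp x⟫_ℂ ∧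
      RCLike.im ⟪x, (g l).toOp x⟫_ℂ = 0 := by
    intro x
    have hi := TraceClass.integrable_entry hg x x
    have hA : ∀ A, MeasurableSet A → 0 ≤ ∫ l in A, RCLike.re ⟪x, (g l).toOp x⟫_ℂ ∂μ ∧
        ∫ l in A, RCLike.im ⟪x, (g l).toOp x⟫_ℂ ∂μ = 0 := by
      intro A hA
      have h := isPositive_iff_inner.1 (hpos A hA) x
      rwa [TraceClass.entry_integral hg.integrableOn, ← integral_re hi.integrableOn,
        ← integral_im hi.integrableOn] at h
    have h1 := ae_nonneg_of_forall_setIntegral_nonneg hi.re fun A hm _ => (hA A hm).1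
    have h2 := ae_nonneg_of_forall_setIntegral_nonneg hi.im fun A hm _ => (hA A hm).2.ge
    have h3 := ae_nonneg_of_forall_setIntegral_nonneg hi.im.neg fun A hm _ => by
      simp only [Pi.neg_apply]
      rw [integral_neg, (hA A hm).2, neg_zero]
    filter_upwards [h1, h2, h3] with l h1 h2 h3
    refine ⟨h1, le_antisymm ?_ h2⟩
    simpa using h3
  have hd := ae_all_iff.2 fun n => key (TopologicalSpace.denseSeq H n)
  filter_upwards [hd] with l hl
  refine isPositive_iff_inner.2 ((TopologicalSpace.denseRange_denseSeq H).induction_on · ?_ hl)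
  have hc : Continuous fun x => ⟪x, (g l).toOp x⟫_ℂ := by fun_prop
  exact (isClosed_le continuous_const (RCLike.continuous_re.comp hc)).inter
    (isClosed_eq (RCLike.continuous_im.comp hc) continuous_const)

/-- The trace norm is additive on positive operators. -/
theorem TraceClass.eTraceNorm_integral_of_isPositive [TopologicalSpace.SeparableSpace H]
    {g : Λ → TraceClass H H} (hg : Integrable g μ) (hpos : ∀ᵐ l ∂μ, (g l).toOp.IsPositive) :
    eTraceNorm (∫ l, g l ∂μ).toOp = ∫⁻ l, eTraceNorm (g l).toOp ∂μ := by
  obtain ⟨w, hw, ⟨b⟩⟩ := exists_countable_hilbertBasis H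
  have hre : ∀ (A : H →L[ℂ] H) (x : H), RCLike.re ⟪A x, x⟫_ℂ = RCLike.re ⟪x, A x⟫_ℂ :=
    fun A x => inner_re_symm _ _
  have h1 : ∀ {A : H →L[ℂ] H}, A.IsPositive →
      eTraceNorm A = ∑' i, ENNReal.ofReal (RCLike.re ⟪b i, A (b i)⟫_ℂ) := fun {A} hA => by
    have hA' := (nonneg_iff_isPositive A).2 hA
    rw [eTraceNorm_of_nonneg hA', eTrace_eq_tsum b hA']
    simp only [hre]
  -- For positive operators the trace norm is the sum of the diagonal entries; these are
  -- nonnegative, so sum and integral commute.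
  rw [h1 (TraceClass.isPositive_integral hg hpos),
    lintegral_congr_ae (hpos.mono fun l hl => h1 hl), lintegral_tsum]
  · refine tsum_congr fun i => ?_
    have hi := TraceClass.integrable_entry hg (b i) (b i)
    rw [TraceClass.entry_integral hg, ← integral_re hi, ofReal_integral_eq_lintegral_ofReal hi.re]
    filter_upwards [hpos] with l hl
    exact (isPositive_iff_inner.1 hl (b i)).1
  · intro i
    have hi := (TraceClass.integrable_entry hg (b i) (b i)).re
    exact hi.aestronglyMeasurable.aemeasurable.ennreal_ofReal

end Measure

/-! ### The variation measure and scalar densities -/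

namespace POVM

variable {Λ H : Type*} [MeasurableSpace Λ]
  [NormedAddCommGroup H] [InnerProductSpace ℂ H] [CompleteSpace H]

/-- The scalar measure `A ↦ ⟪ν(A) x, x⟫`. -/
noncomputable def diag (ν : POVM Λ H) (x : H) : Measure Λ :=
  Measure.ofMeasurable (fun A _ => ENNReal.ofReal (RCLike.re ⟪ν.toFun A x, x⟫_ℂ))
    (by rw [toFun_empty, zero_apply, inner_zero_left, map_zero, ENNReal.ofReal_zero])
    (fun A hA hd => by
      have h := RCLike.hasSum_re (𝕜 := ℂ) (ν.hasSum_iUnion A hA hd x x)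
      rw [← h.tsum_eq, ENNReal.ofReal_tsum_of_nonneg
        (fun n => (ν.isPositive _ (hA n)).re_inner_nonneg_left x) h.summable])

theorem diag_apply (ν : POVM Λ H) (x : H) {A : Set Λ} (hA : MeasurableSet A) :
    ν.diag x A = ENNReal.ofReal (RCLike.re ⟪ν.toFun A x, x⟫_ℂ) :=
  Measure.ofMeasurable_apply _ hA

theorem variation_apply (ν : POVM Λ H) {A : Set Λ} (hA : MeasurableSet A) :
    ν.variation A = preVariationFun (fun A => eTraceNorm (ν.toFun A)) A := by
  rw [variation, preVariation_apply, VectorMeasure.ennrealToMeasure_apply hA,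
    ennrealPreVariation_apply]

theorem eTraceNorm_le_variation (ν : POVM Λ H) {A : Set Λ} (hA : MeasurableSet A) :
    eTraceNorm (ν.toFun A) ≤ ν.variation A := by
  -- The partition `{A}` has a nonempty part only when `A` is nonempty.
  rcases eq_or_ne A ∅ with rfl | hne
  · rw [toFun_empty, eTraceNorm_zero]
    exact zero_le
  rw [variation_apply ν hA]
  refine le_trans (le_of_eq ?_) (preVariation.sum_le' (fun A => eTraceNorm (ν.toFun A)) hA
    (Finpartition.indiscrete (a := A) hne) fun p hp => ?_)
  · simp
  · rw [Finpartition.indiscrete_parts, Finset.mem_singleton] at hp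
    rwa [hp]

theorem eTraceNorm_toFun (ν : POVM Λ H) {ι : Type*} (b : HilbertBasis ι ℂ H) {A : Set Λ}
    (hA : MeasurableSet A) : eTraceNorm (ν.toFun A) = ∑' i, ν.diag (b i) A := by
  have h := (nonneg_iff_isPositive _).2 (ν.isPositive A hA)
  rw [eTraceNorm_of_nonneg h, eTrace_eq_tsum b h]
  exact tsum_congr fun i => (diag_apply ν _ hA).symm

/-- On positive values the trace norm is a sum of scalar measures `diag (b i)`. Hence the sum over
any partition is at most `Tr ν(Λ)`, which is finite. -/
theorem variation_univ_lt_top (ν : POVM Λ H) (hν : ν.IsTraceClass) :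
    ν.variation Set.univ < ∞ := by
  obtain ⟨w, b, -⟩ := exists_hilbertBasis ℂ H
  refine lt_of_le_of_lt ?_ (hν Set.univ MeasurableSet.univ)
  rw [variation_apply ν MeasurableSet.univ, preVariationFun_apply _ MeasurableSet.univ]
  refine iSup_le fun P => ?_
  calc ∑ p ∈ P.parts, eTraceNorm (ν.toFun p)
      = ∑' i, ∑ p ∈ P.parts, ν.diag (b i) (p : Set Λ) := by
        rw [Summable.tsum_finsetSum (fun _ _ => ENNReal.summable)]
        exact Finset.sum_congr rfl fun p _ => eTraceNorm_toFun ν b p.2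
    _ ≤ ∑' i, ν.diag (b i) Set.univ := by
        refine ENNReal.tsum_le_tsum fun i => ?_
        refine sum_measure_le_measure_univ (fun p _ => p.2.nullMeasurableSet) ?_
        intro p hp q hq hpq
        have h := disjoint_iff.1 (P.disjoint hp hq hpq)
        refine Disjoint.aedisjoint (Set.disjoint_iff_inter_eq_empty.2 ?_)
        exact congrArg Subtype.val h
    _ = eTraceNorm (ν.toFun Set.univ) := (eTraceNorm_toFun ν b MeasurableSet.univ).symm

theorem isFiniteMeasure_variation (ν : POVM Λ H) (hν : ν.IsTraceClass) :
    IsFiniteMeasure ν.variation := ⟨variation_univ_lt_top ν hν⟩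

instance isFiniteMeasure_diag (ν : POVM Λ H) (x : H) : IsFiniteMeasure (ν.diag x) :=
  ⟨by rw [diag_apply ν x MeasurableSet.univ]; exact ENNReal.ofReal_lt_top⟩

theorem diag_absolutelyContinuous (ν : POVM Λ H) (x : H) : ν.diag x ≪ ν.variation := by
  refine Measure.AbsolutelyContinuous.mk fun A hA h0 => ?_
  have h := (opNorm_le_eTraceNorm (ν.toFun A)).trans (eTraceNorm_le_variation ν hA)
  rw [h0, nonpos_iff_eq_zero, ← ofReal_norm, ENNReal.ofReal_eq_zero] at h
  rw [diag_apply ν x hA, norm_le_zero_iff.1 h, zero_apply, inner_zero_left, map_zero,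
    ENNReal.ofReal_zero]

theorem exists_diag_density (ν : POVM Λ H) (hν : ν.IsTraceClass) (x : H) :
    ∃ m : Λ → ℂ, Integrable m ν.variation ∧
      ∀ A, MeasurableSet A → ∫ l in A, m l ∂ν.variation = ⟪ν.toFun A x, x⟫_ℂ := by
  have := isFiniteMeasure_variation ν hν
  refine ⟨fun l => (((ν.diag x).rnDeriv ν.variation l).toReal : ℂ),
    Measure.integrable_toReal_rnDeriv.ofReal, fun A hA => ?_⟩
  have hp := ν.isPositive A hA
  change ∫ l in A, (((ν.diag x).rnDeriv ν.variation l).toReal : ℂ) ∂ν.variation = _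
  rw [integral_complex_ofReal, Measure.setIntegral_toReal_rnDeriv' (diag_absolutelyContinuous ν x) hA,
    measureReal_def, diag_apply ν x hA, ENNReal.toReal_ofReal (hp.re_inner_nonneg_left x)]
  exact ((ContinuousLinearMap.isPositive_iff_complex _).1 hp x).1

/-- Polarization expresses an entry by four diagonal values, whose densities come from the
Radon-Nikodym theorem for finite positive measures. -/
theorem exists_entry_density (ν : POVM Λ H) (hν : ν.IsTraceClass) (x y : H) :
    ∃ m : Λ → ℂ, Integrable m ν.variation ∧
      ∀ A, MeasurableSet A → ∫ l in A, m l ∂ν.variation = ⟪x, ν.toFun A y⟫_ℂ := by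
  choose d hd hdA using exists_diag_density ν hν
  refine ⟨fun l => (d (y + x) l - d (y - x) l + Complex.I * d (y + Complex.I • x) l -
    Complex.I * d (y - Complex.I • x) l) / 4, ?_, fun A hA => ?_⟩
  · exact ((((hd _).sub (hd _)).add ((hd _).const_mul _)).sub ((hd _).const_mul _)).div_const _
  · have h := inner_map_polarization (ν.toFun A).toLinearMap y x
    have hsym : ⟪x, ν.toFun A y⟫_ℂ = ⟪ν.toFun A x, y⟫_ℂ :=
      ((ν.isPositive A hA).isSymmetric x y).symm
    simp only [ContinuousLinearMap.coe_coe] at h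
    rw [hsym, h, integral_div, integral_sub, integral_add, integral_sub, integral_const_mul,
      integral_const_mul, hdA _ A hA, hdA _ A hA, hdA _ A hA, hdA _ A hA]
    · exact (hd _).integrableOn
    · exact (hd _).integrableOn
    · exact ((hd _).sub (hd _)).integrableOn
    · exact ((hd _).const_mul _).integrableOn
    · exact (((hd _).sub (hd _)).add ((hd _).const_mul _)).integrableOn
    · exact ((hd _).const_mul _).integrableOn

end POVM

/-! ### Positive infinite matrices of finite trace -/

namespace TraceClass

variable {H : Type*} [NormedAddCommGroup H] [InnerProductSpace ℂ H] [CompleteSpace H] {ι : Type*}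

theorem inner_compressOp_basis [DecidableEq ι] (b : HilbertBasis ι ℂ H) (t : Finset ι)
    (m : ι → ι → ℂ) (i j : ι) :
    ⟪b j, (compressOp b t m).toOp (b i)⟫_ℂ = if i ∈ t ∧ j ∈ t then m i j else 0 := by
  have h : ∀ i j, ⟪b i, b j⟫_ℂ = if i = j then 1 else 0 :=
    fun i j => orthonormal_iff_ite.1 b.orthonormal i j
  rw [toOp_compressOp]
  simp only [sum_apply, smul_apply, InnerProductSpace.rankOne_apply, inner_sum, inner_smul_right, h]
  by_cases hi : i ∈ t <;> by_cases hj : j ∈ t <;> simp [hi, hj, Finset.sum_ite_eq]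

theorem compress_toOp_compressOp (b : HilbertBasis ι ℂ H) {t u : Finset ι} (htu : t ⊆ u)
    (m : ι → ι → ℂ) : compress b t (compressOp b u m).toOp = (compressOp b t m).toOp := by
  classical
  rw [compress_eq_sum, toOp_compressOp b t]
  refine Finset.sum_congr rfl fun i hi => Finset.sum_congr rfl fun j hj => ?_
  rw [inner_compressOp_basis, if_pos ⟨htu hi, htu hj⟩]

theorem eTraceNorm_compressOp (b : HilbertBasis ι ℂ H) (t : Finset ι) (m : ι → ι → ℂ)
    (hpos : (compressOp b t m).toOp.IsPositive) :
    eTraceNorm (compressOp b t m).toOp = ∑ i ∈ t, ENNReal.ofReal (RCLike.re (m i i)) := by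
  classical
  have h := (nonneg_iff_isPositive _).2 hpos
  rw [eTraceNorm_of_nonneg h, eTrace_eq_tsum b h, tsum_eq_sum (s := t)]
  · refine Finset.sum_congr rfl fun i hi => ?_
    rw [inner_re_symm, inner_compressOp_basis, if_pos ⟨hi, hi⟩]
  · intro i hi
    rw [inner_re_symm, inner_compressOp_basis, if_neg fun h => hi h.1, map_zero,
      ENNReal.ofReal_zero]

/-- An infinite positive matrix of finite trace is the matrix of a trace-class operator. -/
theorem cauchySeq_compressOp (b : HilbertBasis ι ℂ H) (m : ι → ι → ℂ)
    (hpos : ∀ t, (compressOp b t m).toOp.IsPositive)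
    (hsum : ∑' i, ENNReal.ofReal (RCLike.re (m i i)) ≠ ∞) :
    CauchySeq fun t => compressOp b t m := by
  classical
  set S := ∑' i, ENNReal.ofReal (RCLike.re (m i i)) with hS
  -- The tail of the trace controls the distance between nested finite sections.
  set τ : Finset ι → ℝ≥0∞ := fun t => ∑' i : {i // i ∉ t}, ENNReal.ofReal (RCLike.re (m i i))
  have hτ : Tendsto τ atTop (𝓝 0) := ENNReal.tendsto_tsum_compl_atTop_zero hsum
  have h1 : Tendsto (fun t => (τ t * S) ^ (2⁻¹ : ℝ) + (S * τ t) ^ (2⁻¹ : ℝ)) atTop (𝓝 0) := by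
    have h1 := ENNReal.Tendsto.mul_const (b := S) hτ (Or.inr hsum)
    have h2 := ENNReal.Tendsto.const_mul (a := S) hτ (Or.inr hsum)
    have h3 := (((ENNReal.continuous_rpow_const (y := (2⁻¹ : ℝ))).tendsto _).comp h1).add
      (((ENNReal.continuous_rpow_const (y := (2⁻¹ : ℝ))).tendsto _).comp h2)
    simpa only [Function.comp_apply, zero_mul, mul_zero, ENNReal.zero_rpow_of_pos (inv_pos.2 two_pos : (0 : ℝ) < 2⁻¹),
      add_zero] using h3
  rw [EMetric.cauchySeq_iff']
  intro ε hε
  obtain ⟨t, ht⟩ := (h1.eventually (gt_mem_nhds hε)).exists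
  refine ⟨t, fun u hu => lt_of_le_of_lt ?_ ht⟩
  -- The larger section is `V Vᴴ`, and `‖Vᴴ (b i)‖²` is its diagonal entry: `m i i` inside `u` and
  -- `0` outside. So `‖V‖₂² ≤ S` and `‖Q V‖₂² ≤ τ t`, with bounds independent of `u`.
  obtain ⟨V, hV⟩ := exists_eq_comp_adjoint_self ((nonneg_iff_isPositive _).2 (hpos u))
  have hVV : ∀ i, ‖adjoint V (b i)‖ₑ ^ 2 ≤ ENNReal.ofReal (RCLike.re (m i i)) := fun i => by
    have h := ofReal_re_inner_adjoint_comp (adjoint V) (b i)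
    rw [adjoint_adjoint, ← hV, inner_re_symm, inner_compressOp_basis] at h
    rw [← h]
    split_ifs
    · exact le_rfl
    · simp
  have hVS : hsNormSq V ≤ S := by
    rw [← hsNormSq_adjoint, hsNormSq_eq_tsum b]
    exact ENNReal.tsum_le_tsum hVV
  have hQV : hsNormSq (basisCoproj b t ∘L V) ≤ τ t := by
    rw [hsNormSq_basisCoproj_comp]
    exact ENNReal.tsum_le_tsum fun i => hVV i
  -- The smaller section is the compression of the larger one, so the compression estimate applies.
  rw [edist_eq_enorm_sub, enorm_eq, toOp_sub, ← compress_toOp_compressOp b hu, hV]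
  refine (eTraceNorm_sub_compress_le b t V V).trans ?_
  gcongr

end TraceClass

/-! ### The Radon-Nikodym theorem for `ν` -/

namespace POVM

variable {Λ H : Type*} [MeasurableSpace Λ]
  [NormedAddCommGroup H] [InnerProductSpace ℂ H] [CompleteSpace H]

/-- The Radon-Nikodym theorem for trace-class positive operator valued measures. -/
theorem exists_isDensity [TopologicalSpace.SeparableSpace H] (ν : POVM Λ H)
    (hν : ν.IsTraceClass) : ∃ f, ν.IsDensity f := by
  classical
  have := isFiniteMeasure_variation ν hν
  obtain ⟨w, hw, ⟨b⟩⟩ := exists_countable_hilbertBasis H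
  choose m hm hmA using fun i j => exists_entry_density ν hν (b j) (b i)
  set F : Finset w → Λ → TraceClass H H :=
    fun t l => TraceClass.compressOp b t fun i j => m i j l with hF
  have hFint : ∀ t, Integrable (F t) ν.variation := fun t => by
    simp only [hF, TraceClass.compressOp]
    exact integrable_finsetSum _ fun i _ => integrable_finsetSum _ fun j _ =>
      (hm i j).smul_const _
  have hFA : ∀ t A, MeasurableSet A → ∫ l in A, F t l ∂ν.variation =
      TraceClass.compressOp b t fun i j => ⟪b j, ν.toFun A (b i)⟫_ℂ := fun t A hA => by
    simp only [hF, TraceClass.compressOp]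
    have hint : ∀ i j, Integrable
        (fun l => m i j l • TraceClass.ofOp (InnerProductSpace.rankOne ℂ (b j) (b i)))
        (ν.variation.restrict A) := fun i j => ((hm i j).smul_const _).integrableOn
    rw [integral_finsetSum _ fun i _ => integrable_finsetSum _ fun j _ => hint i j]
    refine Finset.sum_congr rfl fun i _ => ?_
    rw [integral_finsetSum _ fun j _ => hint i j]
    refine Finset.sum_congr rfl fun j _ => ?_
    rw [integral_smul_const, hmA i j A hA]
  -- The integral of `F t` over `A` is `P ν(A) P` with `P` the basis projection, which is positive.
  have hpos : ∀ t, ∀ᵐ l ∂ν.variation, (F t l).toOp.IsPositive := fun t => by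
    refine TraceClass.ae_isPositive_of_setIntegral (hFint t) fun A hA => ?_
    rw [hFA t A hA, TraceClass.toOp_compressOp, ← compress_eq_sum, compress]
    have h := (ν.isPositive A hA).conj_adjoint (basisProj b t)
    rwa [adjoint_basisProj] at h
  have hpos' := ae_all_iff.2 hpos
  -- The trace of the matrix of densities. Its integral is `Tr ν(Λ)`, so it is finite almost
  -- everywhere and dominates all the norms `‖F t‖`.
  set S : Λ → ℝ≥0∞ := fun l => ∑' i, ENNReal.ofReal (RCLike.re (m i i l))
  have hSm : AEMeasurable S ν.variation := AEMeasurable.tsum fun i =>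
    (hm i i).re.aestronglyMeasurable.aemeasurable.ennreal_ofReal
  have hSint : ∫⁻ l, S l ∂ν.variation < ∞ := by
    refine lt_of_eq_of_lt ?_ (hν Set.univ MeasurableSet.univ)
    rw [lintegral_tsum fun i =>
      (hm i i).re.aestronglyMeasurable.aemeasurable.ennreal_ofReal,
      eTraceNorm_toFun ν b MeasurableSet.univ]
    refine tsum_congr fun i => ?_
    rw [diag_apply ν _ MeasurableSet.univ, inner_re_symm, ← hmA i i _ MeasurableSet.univ,
      setIntegral_univ, ← integral_re (hm i i), ofReal_integral_eq_lintegral_ofReal (hm i i).re]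
    -- The one-element section shows that the diagonal density is nonnegative.
    filter_upwards [hpos {i}] with l hl
    have h := (isPositive_iff_inner.1 hl (b i)).1
    rwa [TraceClass.inner_compressOp_basis, if_pos (by simp)] at h
  have hSfin : ∀ᵐ l ∂ν.variation, S l < ∞ := ae_lt_top' hSm hSint.ne
  have hlim : ∀ᵐ l ∂ν.variation, ∃ T, Tendsto (fun t => F t l) atTop (𝓝 T) := by
    filter_upwards [hpos', hSfin] with l h1 h2
    exact cauchySeq_tendsto_of_complete (TraceClass.cauchySeq_compressOp b _ h1 h2.ne)
  set f : Λ → TraceClass H H :=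
    fun l => if h : ∃ T, Tendsto (fun t => F t l) atTop (𝓝 T) then h.choose else 0
  have hf : ∀ᵐ l ∂ν.variation, Tendsto (fun t => F t l) atTop (𝓝 (f l)) := by
    filter_upwards [hlim] with l hl
    simp only [f, dif_pos hl]
    exact hl.choose_spec
  have hbound : ∀ t, ∀ᵐ l ∂ν.variation, ‖F t l‖ ≤ (S l).toReal := fun t => by
    filter_upwards [hpos t, hSfin] with l h1 h2
    rw [TraceClass.norm_def, TraceClass.eTraceNorm_compressOp b t _ h1]
    exact ENNReal.toReal_mono h2.ne (ENNReal.sum_le_tsum t)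
  have hSi : Integrable (fun l => (S l).toReal) ν.variation :=
    integrable_toReal_of_lintegral_ne_top hSm hSint.ne
  have hfint : Integrable f ν.variation := by
    refine hSi.mono' (aestronglyMeasurable_of_tendsto_ae atTop
      (fun t => (hFint t).aestronglyMeasurable) hf) ?_
    filter_upwards [hf, ae_all_iff.2 hbound] with l h1 h2
    exact le_of_tendsto h1.norm (Eventually.of_forall h2)
  refine ⟨f, hfint, fun A hA => ?_⟩
  have h1 : Tendsto (fun t => ∫ l in A, F t l ∂ν.variation) atTop
      (𝓝 (∫ l in A, f l ∂ν.variation)) :=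
    tendsto_integral_filter_of_dominated_convergence (fun l => (S l).toReal)
      (Eventually.of_forall fun t => (hFint t).aestronglyMeasurable.restrict)
      (Eventually.of_forall fun t => ae_restrict_of_ae (hbound t)) hSi.integrableOn
      (ae_restrict_of_ae hf)
  have h2 := TraceClass.tendsto_compressOp b (TraceClass.mk (ν.toFun A) (hν A hA))
  simp only [hFA _ A hA] at h1
  rw [tendsto_nhds_unique h1 h2]
  rfl

theorem isDensity_density [TopologicalSpace.SeparableSpace H] (ν : POVM Λ H)
    (hν : ν.IsTraceClass) : ν.IsDensity ν.density := by
  have h := exists_isDensity ν hν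
  rw [density, dif_pos h]
  exact h.choose_spec

theorem ae_isPositive_density [TopologicalSpace.SeparableSpace H] (ν : POVM Λ H)
    (hν : ν.IsTraceClass) : ∀ᵐ l ∂ν.variation, (ν.density l).toOp.IsPositive := by
  have h := isDensity_density ν hν
  refine TraceClass.ae_isPositive_of_setIntegral h.integrable fun A hA => ?_
  rw [h.setIntegral_eq A hA]
  exact ν.isPositive A hA

end POVM

/-! ### Simple measurability of operator-valued functions -/

section SimpleMeasurability

variable {Λ E H G : Type*} [MeasurableSpace Λ] {μ : Measure Λ}
  [NormedAddCommGroup E] [InnerProductSpace ℂ E] [CompleteSpace E]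
  [NormedAddCommGroup H] [InnerProductSpace ℂ H] [CompleteSpace H]
  [NormedAddCommGroup G] [InnerProductSpace ℂ G] [CompleteSpace G] {ι : Type*}

theorem tendsto_sum_inner_smul (b : HilbertBasis ι ℂ H) (F : H →L[ℂ] G) (x : H) :
    Tendsto (fun t : Finset ι => ∑ i ∈ t, ⟪b i, x⟫_ℂ • F (b i)) atTop (𝓝 (F x)) := by
  have h := (F.hasSum (b.hasSum_repr x))
  simp only [map_smul, HilbertBasis.repr_apply_apply] at h
  exact h

/-- Almost everywhere simple measurability of an operator-valued function. -/
def AESimplyMeasurable (T : Λ → H →L[ℂ] G) (μ : Measure Λ) : Prop :=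
  ∀ x, AEStronglyMeasurable (fun l => T l x) μ

theorem SimplyMeasurable.aeSimplyMeasurable {T : Λ → H →L[ℂ] G} (hT : SimplyMeasurable T) :
    AESimplyMeasurable T μ := fun x => (hT x).aestronglyMeasurable

theorem AESimplyMeasurable.congr {S T : Λ → H →L[ℂ] G} (hS : AESimplyMeasurable S μ)
    (h : ∀ᵐ l ∂μ, S l = T l) : AESimplyMeasurable T μ := fun x =>
  (hS x).congr (h.mono fun l hl => by simp only [hl])

theorem AESimplyMeasurable.add {S T : Λ → H →L[ℂ] G} (hS : AESimplyMeasurable S μ)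
    (hT : AESimplyMeasurable T μ) : AESimplyMeasurable (fun l => S l + T l) μ := fun x =>
  (hS x).add (hT x)

theorem AESimplyMeasurable.sub {S T : Λ → H →L[ℂ] G} (hS : AESimplyMeasurable S μ)
    (hT : AESimplyMeasurable T μ) : AESimplyMeasurable (fun l => S l - T l) μ := fun x =>
  (hS x).sub (hT x)

theorem AESimplyMeasurable.smul {T : Λ → H →L[ℂ] G} (hT : AESimplyMeasurable T μ) {c : Λ → ℂ}
    (hc : AEStronglyMeasurable c μ) : AESimplyMeasurable (fun l => c l • T l) μ := fun x =>
  hc.smul (hT x)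

theorem aeSimplyMeasurable_const (T : H →L[ℂ] G) : AESimplyMeasurable (fun _ : Λ => T) μ :=
  fun _ => aestronglyMeasurable_const

theorem AESimplyMeasurable.sum {T : ι → Λ → H →L[ℂ] G} (t : Finset ι)
    (hT : ∀ i ∈ t, AESimplyMeasurable (T i) μ) :
    AESimplyMeasurable (fun l => ∑ i ∈ t, T i l) μ := fun x => by
  simp only [sum_apply]
  exact Finset.aestronglyMeasurable_fun_sum _ fun i hi => hT i hi x

/-- Expanding the variable vector in a countable basis leaves only values of `T` at fixed vectors.
Closure under composition and powers rests on this. -/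
theorem AESimplyMeasurable.apply [TopologicalSpace.SeparableSpace H] {T : Λ → H →L[ℂ] G}
    (hT : AESimplyMeasurable T μ) {v : Λ → H} (hv : AEStronglyMeasurable v μ) :
    AEStronglyMeasurable (fun l => T l (v l)) μ := by
  obtain ⟨w, hw, ⟨b⟩⟩ := exists_countable_hilbertBasis H
  refine aestronglyMeasurable_of_tendsto_ae atTop
    (f := fun (t : Finset w) l => ∑ i ∈ t, ⟪b i, v l⟫_ℂ • T l (b i)) (fun t => ?_)
    (Eventually.of_forall fun l => tendsto_sum_inner_smul b (T l) (v l))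
  exact Finset.aestronglyMeasurable_fun_sum _ fun i _ =>
    (aestronglyMeasurable_const.inner hv).smul (hT _)

theorem AESimplyMeasurable.comp [TopologicalSpace.SeparableSpace H] {S : Λ → H →L[ℂ] G}
    {T : Λ → E →L[ℂ] H} (hS : AESimplyMeasurable S μ) (hT : AESimplyMeasurable T μ) :
    AESimplyMeasurable (fun l => S l ∘L T l) μ := fun x => hS.apply (hT x)

theorem AESimplyMeasurable.pow [TopologicalSpace.SeparableSpace H] {T : Λ → H →L[ℂ] H}
    (hT : AESimplyMeasurable T μ) (n : ℕ) : AESimplyMeasurable (fun l => T l ^ n) μ := by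
  induction n with
  | zero => simpa only [pow_zero] using aeSimplyMeasurable_const 1
  | succ n ih =>
    simp only [pow_succ]
    exact ih.comp hT

theorem AESimplyMeasurable.adjoint [TopologicalSpace.SeparableSpace H] {T : Λ → H →L[ℂ] G}
    (hT : AESimplyMeasurable T μ) :
    AESimplyMeasurable (fun l => ContinuousLinearMap.adjoint (T l)) μ := by
  obtain ⟨w, hw, ⟨b⟩⟩ := exists_countable_hilbertBasis H
  intro y
  refine aestronglyMeasurable_of_tendsto_ae atTop
    (f := fun (t : Finset w) l => ∑ i ∈ t, ⟪T l (b i), y⟫_ℂ • b i) (fun t => ?_)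
    (Eventually.of_forall fun l => ?_)
  · exact Finset.aestronglyMeasurable_fun_sum _ fun i _ =>
      ((hT _).inner aestronglyMeasurable_const).smul_const _
  · have h := tendsto_sum_inner_smul b (ContinuousLinearMap.id ℂ H)
      (ContinuousLinearMap.adjoint (T l) y)
    simpa only [adjoint_inner_right, id_apply] using h

theorem AESimplyMeasurable.hsNormSq [TopologicalSpace.SeparableSpace H] {T : Λ → H →L[ℂ] G}
    (hT : AESimplyMeasurable T μ) : AEMeasurable (fun l => hsNormSq (T l)) μ := by
  obtain ⟨w, hw, ⟨b⟩⟩ := exists_countable_hilbertBasis H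
  simp only [hsNormSq_eq_tsum b]
  exact AEMeasurable.tsum fun i => (hT (b i)).enorm.pow_const 2

/-- The definition of `OMeasurable` asks for measurability without exceptional sets. Countably many
basis vectors have a common conull measurable set, and the function is set to zero off it. -/
theorem AESimplyMeasurable.exists_simplyMeasurable [TopologicalSpace.SeparableSpace H]
    {T : Λ → H →L[ℂ] G} (hT : AESimplyMeasurable T μ) :
    ∃ S : Λ → H →L[ℂ] G, SimplyMeasurable S ∧ ∀ᵐ l ∂μ, S l = T l := by
  classical
  obtain ⟨w, hw, ⟨b⟩⟩ := exists_countable_hilbertBasis H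
  obtain ⟨s, hs, hsm, hsT⟩ :=
    (ae_all_iff.2 fun i : w => (hT (b i)).ae_eq_mk).exists_measurable_mem
  refine ⟨s.indicator T, fun x => ?_, ?_⟩
  · refine stronglyMeasurable_of_tendsto atTop
      (f := fun (t : Finset w) l => ∑ i ∈ t, ⟪b i, x⟫_ℂ • s.indicator T l (b i)) (fun t => ?_)
      (tendsto_pi_nhds.2 fun l => tendsto_sum_inner_smul b (s.indicator T l) x)
    refine Finset.stronglyMeasurable_fun_sum _ fun i _ => StronglyMeasurable.const_smul ?_ _
    have h : (fun l => s.indicator T l (b i)) = s.indicator ((hT (b i)).mk _) := by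
      ext l
      by_cases hl : l ∈ s
      · simp only [Set.indicator_of_mem hl, hsT l hl i]
      · simp only [Set.indicator_of_notMem hl, zero_apply]
    rw [h]
    exact (hT (b i)).stronglyMeasurable_mk.indicator hsm
  · filter_upwards [hs] with l hl
    exact Set.indicator_of_mem hl T

/-- The square root is norm-continuous on the closed cone of positive operators. A measurable
representative is set to zero where it leaves the cone, so that the continuous map can be composed
with it everywhere. -/
theorem aestronglyMeasurable_sqrt {g : Λ → H →L[ℂ] H} (hg : AEStronglyMeasurable g μ)
    (hpos : ∀ᵐ l ∂μ, 0 ≤ g l) : AEStronglyMeasurable (fun l => CFC.sqrt (g l)) μ := by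
  classical
  borelize (H →L[ℂ] H)
  set s := {l | 0 ≤ hg.mk g l}
  have hc : IsClosed {a : H →L[ℂ] H | 0 ≤ a} := CStarAlgebra.isClosed_nonneg
  have hs : MeasurableSet s := hg.stronglyMeasurable_mk.measurable hc.measurableSet
  have hh : StronglyMeasurable (s.indicator (hg.mk g)) := hg.stronglyMeasurable_mk.indicator hs
  have hpos' : ∀ l, s.indicator (hg.mk g) l ∈ {a : H →L[ℂ] H | 0 ≤ a} := fun l => by
    by_cases hl : l ∈ s
    · rw [Set.indicator_of_mem hl]
      exact hl
    · rw [Set.indicator_of_notMem hl]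
      exact le_rfl (a := (0 : H →L[ℂ] H))
  let k : Λ → {a : H →L[ℂ] H | 0 ≤ a} := fun l => ⟨_, hpos' l⟩
  have hk : StronglyMeasurable k :=
    (Embedding.comp_stronglyMeasurable_iff Topology.IsEmbedding.subtypeVal).1 hh
  have hcont : Continuous fun a : {a : H →L[ℂ] H | 0 ≤ a} => CFC.sqrt (a : H →L[ℂ] H) :=
    continuousOn_iff_continuous_domRestrict.1 CFC.continuousOn_sqrt
  refine (hcont.comp_stronglyMeasurable hk).aestronglyMeasurable.congr ?_
  filter_upwards [hpos, hg.ae_eq_mk] with l h1 h2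
  have h3 : l ∈ s := by
    change 0 ≤ hg.mk g l
    rwa [← h2]
  change CFC.sqrt (s.indicator (hg.mk g) l) = _
  rw [Set.indicator_of_mem h3, ← h2]

end SimpleMeasurability

/-! ### Composition of an unbounded operator with a bounded one -/

section PartialComposition

variable {H G E : Type*} [NormedAddCommGroup H] [InnerProductSpace ℂ H]
  [NormedAddCommGroup G] [InnerProductSpace ℂ G] [NormedAddCommGroup E] [InnerProductSpace ℂ E]

theorem IsComp.unique {Φ : H →ₗ.[ℂ] G} {A : H →L[ℂ] H} {S T : H →L[ℂ] G} (hS : IsComp Φ A S)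
    (hT : IsComp Φ A T) : S = T := by
  ext x
  obtain ⟨h1, h2⟩ := hS x
  obtain ⟨h3, h4⟩ := hT x
  rw [← h2, ← h4]

theorem IsComp.pcomp_eq {Φ : H →ₗ.[ℂ] G} {A : H →L[ℂ] H} {T : H →L[ℂ] G} (hT : IsComp Φ A T) :
    pcomp Φ A = T := by
  have h : ∃ T, IsComp Φ A T := ⟨T, hT⟩
  rw [pcomp, dif_pos h]
  exact h.choose_spec.unique hT

theorem IsComp.add {Φ Ψ : H →ₗ.[ℂ] G} {A : H →L[ℂ] H} {S T : H →L[ℂ] G} (hS : IsComp Φ A S)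
    (hT : IsComp Ψ A T) : IsComp (Φ + Ψ) A (S + T) := fun x => by
  obtain ⟨h1, h2⟩ := hS x
  obtain ⟨h3, h4⟩ := hT x
  refine ⟨⟨h1, h3⟩, ?_⟩
  rw [LinearPMap.add_apply, _root_.add_apply, ← h2, ← h4]

theorem IsComp.neg {Φ : H →ₗ.[ℂ] G} {A : H →L[ℂ] H} {T : H →L[ℂ] G} (hT : IsComp Φ A T) :
    IsComp (-Φ) A (-T) := fun x => by
  obtain ⟨h1, h2⟩ := hT x
  refine ⟨h1, ?_⟩
  rw [LinearPMap.neg_apply, _root_.neg_apply, ← h2]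

theorem isComp_zero (A : H →L[ℂ] H) : IsComp (0 : H →ₗ.[ℂ] G) A 0 := fun _ =>
  ⟨Submodule.mem_top, rfl⟩

theorem IsComp.compPMap {Φ : H →ₗ.[ℂ] G} {A : H →L[ℂ] H} {T : H →L[ℂ] G} (hT : IsComp Φ A T)
    (P : G →L[ℂ] E) : IsComp (P.toLinearMap.compPMap Φ) A (P ∘L T) := fun x => by
  obtain ⟨h1, h2⟩ := hT x
  refine ⟨h1, ?_⟩
  rw [ContinuousLinearMap.coe_comp, Function.comp_apply, ← h2]
  rfl

end PartialComposition

/-! ### Stability of `O`-measurability -/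

section OMeasurable

variable {Λ H G : Type*} [MeasurableSpace Λ]
  [NormedAddCommGroup H] [InnerProductSpace ℂ H] [NormedAddCommGroup G] [InnerProductSpace ℂ G]

theorem OMeasurable.zero : OMeasurable (0 : Λ → H →ₗ.[ℂ] G) where
  measurableSet_domain x := by
    have h : {l : Λ | x ∈ ((0 : Λ → H →ₗ.[ℂ] G) l).domain} = Set.univ :=
      Set.eq_univ_of_forall fun _ => trivial
    rw [h]
    exact MeasurableSet.univ
  exists_approx := ⟨fun _ _ => 0, fun _ x => by
    simpa using stronglyMeasurable_const, fun l x => tendsto_const_nhds⟩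

theorem OMeasurable.add {Φ Ψ : Λ → H →ₗ.[ℂ] G} (hΦ : OMeasurable Φ) (hΨ : OMeasurable Ψ) :
    OMeasurable (Φ + Ψ) where
  measurableSet_domain x := (hΦ.measurableSet_domain x).inter (hΨ.measurableSet_domain x)
  exists_approx := by
    obtain ⟨F, hF, hF'⟩ := hΦ.exists_approx
    obtain ⟨K, hK, hK'⟩ := hΨ.exists_approx
    refine ⟨fun n l => F n l + K n l, fun n x => (hF n x).add (hK n x), fun l x => ?_⟩
    exact (hF' l ⟨x, x.2.1⟩).add (hK' l ⟨x, x.2.2⟩)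

theorem OMeasurable.opAct {Φ : Λ → H →ₗ.[ℂ] G} (hΦ : OMeasurable Φ) (P : G →L[ℂ] G) :
    OMeasurable (PovmL2.opAct P Φ) where
  measurableSet_domain x := hΦ.measurableSet_domain x
  exists_approx := by
    obtain ⟨F, hF, hF'⟩ := hΦ.exists_approx
    refine ⟨fun n l => P ∘L F n l, fun n x => P.continuous.comp_stronglyMeasurable (hF n x),
      fun l x => ?_⟩
    exact (P.continuous.tendsto _).comp (hF' l x)

theorem OMeasurable.neg {Φ : Λ → H →ₗ.[ℂ] G} (hΦ : OMeasurable Φ) : OMeasurable (-Φ) where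
  measurableSet_domain x := hΦ.measurableSet_domain x
  exists_approx := by
    obtain ⟨F, hF, hF'⟩ := hΦ.exists_approx
    exact ⟨fun n l => -F n l, fun n x => (hF n x).neg, fun l x => (hF' l x).neg⟩

/-- The pointwise limit, where it exists, of a sequence of simply measurable functions. -/
noncomputable def limPMap (F : ℕ → Λ → H →L[ℂ] G) (l : Λ) : H →ₗ.[ℂ] G where
  domain :=
    { carrier := {x | ∃ y, Tendsto (fun n => F n l x) atTop (𝓝 y)}
      zero_mem' := ⟨0, by simp⟩
      add_mem' := fun ⟨a, ha⟩ ⟨b, hb⟩ => ⟨a + b, by simpa using ha.add hb⟩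
      smul_mem' := fun c x ⟨a, ha⟩ => ⟨c • a, by simpa using ha.const_smul c⟩ }
  toFun :=
    { toFun := fun x => x.2.choose
      map_add' := fun x y => tendsto_nhds_unique (x + y).2.choose_spec (by
        simpa using x.2.choose_spec.add y.2.choose_spec)
      map_smul' := fun c x => tendsto_nhds_unique (c • x).2.choose_spec (by
        simpa using x.2.choose_spec.const_smul c) }

theorem mem_limPMap_domain {F : ℕ → Λ → H →L[ℂ] G} {l : Λ} {x : H} :
    x ∈ (limPMap F l).domain ↔ ∃ y, Tendsto (fun n => F n l x) atTop (𝓝 y) := Iff.rfl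

theorem tendsto_limPMap (F : ℕ → Λ → H →L[ℂ] G) (l : Λ) (x : (limPMap F l).domain) :
    Tendsto (fun n => F n l (x : H)) atTop (𝓝 (limPMap F l x)) :=
  (mem_limPMap_domain.1 x.2).choose_spec

/-- The domain condition is the measurability of the set where a sequence of measurable functions
converges; `F` itself is the approximating sequence. -/
theorem oMeasurable_limPMap [CompleteSpace G] {F : ℕ → Λ → H →L[ℂ] G}
    (hF : ∀ n, SimplyMeasurable (F n)) : OMeasurable (limPMap F) where
  measurableSet_domain x := StronglyMeasurable.measurableSet_exists_tendsto fun n => hF n x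
  exists_approx := ⟨F, hF, tendsto_limPMap F⟩

end OMeasurable

/-! ### The factor `Φ f^{1/2}`, the pseudo-Gramian and the null relation -/

namespace POVM

variable {Λ H G : Type*} [MeasurableSpace Λ]
  [NormedAddCommGroup H] [InnerProductSpace ℂ H] [CompleteSpace H]
  [NormedAddCommGroup G] [InnerProductSpace ℂ G] [CompleteSpace G]

theorem sqrtDensity_nonneg (ν : POVM Λ H) (l : Λ) : 0 ≤ ν.sqrtDensity l := CFC.sqrt_nonneg _

theorem aeSimplyMeasurable_sqrtDensity [TopologicalSpace.SeparableSpace H] (ν : POVM Λ H)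
    (hν : ν.IsTraceClass) : AESimplyMeasurable ν.sqrtDensity ν.variation := by
  have h1 : AEStronglyMeasurable (fun l => (ν.density l).toOp) ν.variation :=
    (TraceClass.toOpL (H := H) (G := H)).continuous.comp_aestronglyMeasurable
      (isDensity_density ν hν).integrable.aestronglyMeasurable
  have h2 := aestronglyMeasurable_sqrt h1 ((ae_isPositive_density ν hν).mono fun l hl =>
    (nonneg_iff_isPositive _).2 hl)
  exact fun x => (ContinuousLinearMap.apply ℂ H x).continuous.comp_aestronglyMeasurable h2

/-- The operator-valued function `Φ f^{1/2}`. -/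
noncomputable def factor (ν : POVM Λ H) (Φ : Λ → H →ₗ.[ℂ] G) (l : Λ) : H →L[ℂ] G :=
  pcomp (Φ l) (ν.sqrtDensity l)

/-- `Φ` is `O`-measurable and `Φ f^{1/2}` is a Hilbert-Schmidt operator almost everywhere. -/
structure HasFactor (ν : POVM Λ H) (Φ : Λ → H →ₗ.[ℂ] G) : Prop where
  oMeasurable : OMeasurable Φ
  isComp : ∀ᵐ l ∂ν.variation, IsComp (Φ l) (ν.sqrtDensity l) (ν.factor Φ l)
  isHilbertSchmidt : ∀ᵐ l ∂ν.variation, hsNormSq (ν.factor Φ l) < ∞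

variable {ν : POVM Λ H} {Φ Ψ : Λ → H →ₗ.[ℂ] G}

theorem factor_eq {l : Λ} {T : H →L[ℂ] G} (h : IsComp (Φ l) (ν.sqrtDensity l) T) :
    ν.factor Φ l = T := h.pcomp_eq

theorem HasFactor.of_isComp (hΦ : OMeasurable Φ) {T : Λ → H →L[ℂ] G}
    (hT : ∀ᵐ l ∂ν.variation, IsComp (Φ l) (ν.sqrtDensity l) (T l))
    (hT' : ∀ᵐ l ∂ν.variation, hsNormSq (T l) < ∞) : ν.HasFactor Φ where
  oMeasurable := hΦ
  isComp := hT.mono fun l hl => by rwa [factor_eq hl]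
  isHilbertSchmidt := by
    filter_upwards [hT, hT'] with l h1 h2
    rwa [factor_eq h1]

theorem HasFactor.zero : ν.HasFactor (0 : Λ → H →ₗ.[ℂ] G) :=
  .of_isComp .zero (.of_forall fun _ => isComp_zero _)
    (.of_forall fun _ => by rw [hsNormSq_zero]; exact ENNReal.zero_lt_top)

/-- Equality holds only almost everywhere: where a composite is not bounded and everywhere defined,
`factor` takes the default value `0`. -/
theorem HasFactor.factor_add (hΦ : ν.HasFactor Φ) (hΨ : ν.HasFactor Ψ) :
    ∀ᵐ l ∂ν.variation, ν.factor (Φ + Ψ) l = ν.factor Φ l + ν.factor Ψ l := by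
  filter_upwards [hΦ.isComp, hΨ.isComp] with l h1 h2
  exact factor_eq (h1.add h2)

theorem HasFactor.factor_neg (hΦ : ν.HasFactor Φ) :
    ∀ᵐ l ∂ν.variation, ν.factor (-Φ) l = -ν.factor Φ l := by
  filter_upwards [hΦ.isComp] with l h1
  exact factor_eq h1.neg

theorem HasFactor.factor_opAct (hΦ : ν.HasFactor Φ) (P : G →L[ℂ] G) :
    ∀ᵐ l ∂ν.variation, ν.factor (opAct P Φ) l = P ∘L ν.factor Φ l := by
  filter_upwards [hΦ.isComp] with l h1
  exact factor_eq (h1.compPMap P)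

theorem HasFactor.add (hΦ : ν.HasFactor Φ) (hΨ : ν.HasFactor Ψ) : ν.HasFactor (Φ + Ψ) := by
  refine .of_isComp (T := fun l => ν.factor Φ l + ν.factor Ψ l)
    (hΦ.oMeasurable.add hΨ.oMeasurable) ?_ ?_
  · filter_upwards [hΦ.isComp, hΨ.isComp] with l h1 h2
    exact h1.add h2
  · filter_upwards [hΦ.isHilbertSchmidt, hΨ.isHilbertSchmidt] with l h1 h2
    exact (hsNormSq_add_le _ _).trans_lt
      (ENNReal.mul_lt_top ENNReal.ofNat_lt_top (ENNReal.add_lt_top.2 ⟨h1, h2⟩))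

theorem HasFactor.neg (hΦ : ν.HasFactor Φ) : ν.HasFactor (-Φ) := by
  refine .of_isComp (T := fun l => -ν.factor Φ l) hΦ.oMeasurable.neg ?_ ?_
  · filter_upwards [hΦ.isComp] with l h1
    exact h1.neg
  · filter_upwards [hΦ.isHilbertSchmidt] with l h1
    rwa [hsNormSq_neg]

theorem HasFactor.opAct (hΦ : ν.HasFactor Φ) (P : G →L[ℂ] G) : ν.HasFactor (opAct P Φ) := by
  refine .of_isComp (T := fun l => P ∘L ν.factor Φ l) (hΦ.oMeasurable.opAct P) ?_ ?_
  · filter_upwards [hΦ.isComp] with l h1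
    exact h1.compPMap P
  · filter_upwards [hΦ.isHilbertSchmidt] with l h1
    exact (hsNormSq_comp_left_le _ _).trans_lt
      (ENNReal.mul_lt_top (ENNReal.pow_lt_top enorm_lt_top) h1)

/-- The vector `f^{1/2} x` lies in the domain of `Φ` almost everywhere, so the approximants of `Φ`
converge there. -/
theorem HasFactor.aeSimplyMeasurable [TopologicalSpace.SeparableSpace H] (hν : ν.IsTraceClass)
    (hΦ : ν.HasFactor Φ) : AESimplyMeasurable (ν.factor Φ) ν.variation := by
  intro x
  obtain ⟨F, hF, hF'⟩ := hΦ.oMeasurable.exists_approx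
  refine aestronglyMeasurable_of_tendsto_ae atTop
    (f := fun n l => F n l (ν.sqrtDensity l x))
    (fun n => (hF n).aeSimplyMeasurable.apply (aeSimplyMeasurable_sqrtDensity ν hν x)) ?_
  filter_upwards [hΦ.isComp] with l hl
  obtain ⟨h1, h2⟩ := hl x
  rw [← h2]
  exact hF' l ⟨_, h1⟩

theorem integrand_eq (ν : POVM Λ H) (Φ Ψ : Λ → H →ₗ.[ℂ] G) (l : Λ) :
    ν.integrand Φ Ψ l = ν.factor Φ l ∘L adjoint (ν.factor Ψ l) := rfl

theorem HasFactor.ae_isTraceClass (hΦ : ν.HasFactor Φ) (hΨ : ν.HasFactor Ψ) :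
    ∀ᵐ l ∂ν.variation, PovmL2.IsTraceClass (ν.integrand Φ Ψ l) := by
  filter_upwards [hΦ.isHilbertSchmidt, hΨ.isHilbertSchmidt] with l h1 h2
  exact (eTraceNorm_comp_adjoint_le_add _ _).trans_lt (ENNReal.add_lt_top.2 ⟨h1, h2⟩)

variable [TopologicalSpace.SeparableSpace H] [TopologicalSpace.SeparableSpace G]

theorem HasFactor.aestronglyMeasurable_integrand (hν : ν.IsTraceClass) (hΦ : ν.HasFactor Φ)
    (hΨ : ν.HasFactor Ψ) :
    AEStronglyMeasurable (fun l => TraceClass.ofOp (ν.integrand Φ Ψ l)) ν.variation := by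
  refine TraceClass.aestronglyMeasurable_of_entry fun x y => ?_
  have h := ((hΦ.aeSimplyMeasurable hν).comp (hΨ.aeSimplyMeasurable hν).adjoint) y
  refine ((aestronglyMeasurable_const (b := x)).inner h).congr ?_
  filter_upwards [hΦ.ae_isTraceClass hΨ] with l hl
  rw [TraceClass.toOp_ofOp hl, integrand_eq]

theorem HasFactor.enorm_integrand_self (hΦ : ν.HasFactor Φ) :
    ∀ᵐ l ∂ν.variation, ‖TraceClass.ofOp (ν.integrand Φ Φ l)‖ₑ = hsNormSq (ν.factor Φ l) := by
  filter_upwards [hΦ.ae_isTraceClass hΦ] with l hl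
  rw [TraceClass.enorm_eq, TraceClass.toOp_ofOp hl, integrand_eq, eTraceNorm_comp_adjoint_self]

/-- The square of the norm of `Φ`, as an element of `[0, ∞]`. -/
noncomputable def energy (ν : POVM Λ H) (Φ : Λ → H →ₗ.[ℂ] G) : ℝ≥0∞ :=
  ∫⁻ l, hsNormSq (ν.factor Φ l) ∂ν.variation

theorem integrablePair (hν : ν.IsTraceClass) (hΦ : ν.HasFactor Φ) (hΦ' : ν.energy Φ < ∞)
    (hΨ : ν.HasFactor Ψ) (hΨ' : ν.energy Ψ < ∞) : ν.IntegrablePair Φ Ψ where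
  measurable_left := hΦ.oMeasurable
  measurable_right := hΨ.oMeasurable
  range_left := hΦ.isComp.mono fun l hl x => (hl x).1
  range_right := hΨ.isComp.mono fun l hl x => (hl x).1
  hilbertSchmidt_left := by
    filter_upwards [hΦ.isComp, hΦ.isHilbertSchmidt] with l h1 h2
    exact ⟨_, h1, h2⟩
  hilbertSchmidt_right := by
    filter_upwards [hΨ.isComp, hΨ.isHilbertSchmidt] with l h1 h2
    exact ⟨_, h1, h2⟩
  traceClass := hΦ.ae_isTraceClass hΨ
  integrable := by
    refine ⟨hΦ.aestronglyMeasurable_integrand hν hΨ, ?_⟩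
    rw [hasFiniteIntegral_iff_enorm]
    refine lt_of_le_of_lt ?_ (ENNReal.add_lt_top.2 ⟨hΦ', hΨ'⟩)
    rw [energy, energy, ← lintegral_add_left' (hΦ.aeSimplyMeasurable hν).hsNormSq]
    refine lintegral_mono_ae ?_
    filter_upwards [hΦ.ae_isTraceClass hΨ] with l hl
    rw [TraceClass.enorm_eq, TraceClass.toOp_ofOp hl, integrand_eq]
    exact eTraceNorm_comp_adjoint_le_add _ _

/-- Since `‖T Tᴴ‖₁ = ‖T‖₂²`, Bochner integrability of the integrand amounts to finite energy;
measurability is automatic. From here on membership is checked on factors. -/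
theorem sqIntegrable_iff (hν : ν.IsTraceClass) :
    Φ ∈ ν.SqIntegrable G ↔ ν.HasFactor Φ ∧ ν.energy Φ < ∞ := by
  refine ⟨fun h => ?_, fun h => integrablePair hν h.1 h.2 h.1 h.2⟩
  have h : ν.IntegrablePair Φ Φ := h
  have hΦ : ν.HasFactor Φ := by
    refine ⟨h.measurable_left, ?_, ?_⟩
    · filter_upwards [h.hilbertSchmidt_left] with l ⟨T, hT, _⟩
      rwa [factor_eq hT]
    · filter_upwards [h.hilbertSchmidt_left] with l ⟨T, hT, hT'⟩
      rwa [factor_eq hT]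
  refine ⟨hΦ, ?_⟩
  have h1 := h.integrable.hasFiniteIntegral
  rwa [hasFiniteIntegral_iff_enorm, lintegral_congr_ae hΦ.enorm_integrand_self] at h1

theorem zero_mem_sqIntegrable (hν : ν.IsTraceClass) :
    (0 : Λ → H →ₗ.[ℂ] G) ∈ ν.SqIntegrable G := by
  refine (sqIntegrable_iff hν).2 ⟨.zero, ?_⟩
  have h : ∀ l, ν.factor (0 : Λ → H →ₗ.[ℂ] G) l = 0 := fun l => factor_eq (isComp_zero _)
  simp [energy, h, hsNormSq_zero]

theorem add_mem_sqIntegrable (hν : ν.IsTraceClass) (hΦ : Φ ∈ ν.SqIntegrable G)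
    (hΨ : Ψ ∈ ν.SqIntegrable G) : Φ + Ψ ∈ ν.SqIntegrable G := by
  rw [sqIntegrable_iff hν] at *
  refine ⟨hΦ.1.add hΨ.1, ?_⟩
  calc ν.energy (Φ + Ψ)
      ≤ ∫⁻ l, 2 * (hsNormSq (ν.factor Φ l) + hsNormSq (ν.factor Ψ l)) ∂ν.variation := by
        refine lintegral_mono_ae ?_
        filter_upwards [hΦ.1.factor_add hΨ.1] with l hl
        rw [hl]
        exact hsNormSq_add_le _ _
    _ = 2 * (ν.energy Φ + ν.energy Ψ) := by
        rw [lintegral_const_mul' _ _ ENNReal.ofNat_ne_top,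
          lintegral_add_left' (hΦ.1.aeSimplyMeasurable hν).hsNormSq, energy, energy]
    _ < ∞ := ENNReal.mul_lt_top ENNReal.ofNat_lt_top (ENNReal.add_lt_top.2 ⟨hΦ.2, hΨ.2⟩)

theorem neg_mem_sqIntegrable (hν : ν.IsTraceClass) (hΦ : Φ ∈ ν.SqIntegrable G) :
    -Φ ∈ ν.SqIntegrable G := by
  rw [sqIntegrable_iff hν] at *
  refine ⟨hΦ.1.neg, lt_of_eq_of_lt (lintegral_congr_ae ?_) hΦ.2⟩
  filter_upwards [hΦ.1.factor_neg] with l hl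
  rw [hl, hsNormSq_neg]

theorem opAct_mem_sqIntegrable (hν : ν.IsTraceClass) (P : G →L[ℂ] G)
    (hΦ : Φ ∈ ν.SqIntegrable G) : opAct P Φ ∈ ν.SqIntegrable G := by
  rw [sqIntegrable_iff hν] at *
  refine ⟨hΦ.1.opAct P, ?_⟩
  calc ν.energy (opAct P Φ)
      ≤ ∫⁻ l, ‖P‖ₑ ^ 2 * hsNormSq (ν.factor Φ l) ∂ν.variation := by
        refine lintegral_mono_ae ?_
        filter_upwards [hΦ.1.factor_opAct P] with l hl
        rw [hl]
        exact hsNormSq_comp_left_le _ _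
    _ = ‖P‖ₑ ^ 2 * ν.energy Φ := by
        rw [lintegral_const_mul' _ _ (ENNReal.pow_ne_top enorm_ne_top), energy]
    _ < ∞ := ENNReal.mul_lt_top (ENNReal.pow_lt_top enorm_lt_top) hΦ.2

theorem sub_eq_add_neg_pfun (Φ Ψ : Λ → H →ₗ.[ℂ] G) : Φ - Ψ = Φ + -Ψ :=
  funext fun _ => sub_eq_add_neg _ _

theorem sub_mem_sqIntegrable (hν : ν.IsTraceClass) (hΦ : Φ ∈ ν.SqIntegrable G)
    (hΨ : Ψ ∈ ν.SqIntegrable G) : Φ - Ψ ∈ ν.SqIntegrable G := by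
  rw [sub_eq_add_neg_pfun]
  exact add_mem_sqIntegrable hν hΦ (neg_mem_sqIntegrable hν hΨ)

theorem HasFactor.factor_sub (hΦ : ν.HasFactor Φ) (hΨ : ν.HasFactor Ψ) :
    ∀ᵐ l ∂ν.variation, ν.factor (Φ - Ψ) l = ν.factor Φ l - ν.factor Ψ l := by
  rw [sub_eq_add_neg_pfun]
  filter_upwards [hΦ.factor_add hΨ.neg, hΨ.factor_neg] with l h1 h2
  rw [h1, h2, sub_eq_add_neg]

theorem integrablePair_of_mem (hν : ν.IsTraceClass) (hΦ : Φ ∈ ν.SqIntegrable G)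
    (hΨ : Ψ ∈ ν.SqIntegrable G) : ν.IntegrablePair Φ Ψ := by
  rw [sqIntegrable_iff hν] at *
  exact integrablePair hν hΦ.1 hΦ.2 hΨ.1 hΨ.2

/-- Matrix entries reduce the Gramian identities to identities between scalar integrands, and so
avoid manipulating `TraceClass.ofOp`. -/
theorem inner_integral (hν : ν.IsTraceClass) (hΦ : Φ ∈ ν.SqIntegrable G)
    (hΨ : Ψ ∈ ν.SqIntegrable G) (x y : G) :
    ⟪x, (ν.integral Φ Ψ).toOp y⟫_ℂ =
      ∫ l, ⟪x, ν.factor Φ l (adjoint (ν.factor Ψ l) y)⟫_ℂ ∂ν.variation := by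
  have h := integrablePair_of_mem hν hΦ hΨ
  rw [integral, TraceClass.entry_integral h.integrable]
  refine integral_congr_ae ?_
  filter_upwards [h.traceClass] with l hl
  rw [TraceClass.toOp_ofOp hl, integrand_eq]
  rfl

theorem integrable_inner (hν : ν.IsTraceClass) (hΦ : Φ ∈ ν.SqIntegrable G)
    (hΨ : Ψ ∈ ν.SqIntegrable G) (x y : G) :
    Integrable (fun l => ⟪x, ν.factor Φ l (adjoint (ν.factor Ψ l) y)⟫_ℂ) ν.variation := by
  have h := integrablePair_of_mem hν hΦ hΨ
  refine (TraceClass.integrable_entry h.integrable x y).congr ?_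
  filter_upwards [h.traceClass] with l hl
  rw [TraceClass.toOp_ofOp hl, integrand_eq]
  rfl

theorem ext_inner_op {S T : G →L[ℂ] G} (h : ∀ x y, ⟪x, S y⟫_ℂ = ⟪x, T y⟫_ℂ) : S = T :=
  ContinuousLinearMap.ext fun y => ext_inner_left ℂ fun x => h x y

theorem integral_adjoint (hν : ν.IsTraceClass) (hΦ : Φ ∈ ν.SqIntegrable G)
    (hΨ : Ψ ∈ ν.SqIntegrable G) :
    (ν.integral Ψ Φ).toOp = adjoint (ν.integral Φ Ψ).toOp := by
  refine ext_inner_op fun x y => ?_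
  rw [adjoint_inner_right, ← inner_conj_symm ((ν.integral Φ Ψ).toOp x) y,
    inner_integral hν hΦ hΨ, inner_integral hν hΨ hΦ, ← integral_conj]
  refine integral_congr_ae (.of_forall fun l => ?_)
  simp only
  rw [inner_conj_symm, ← adjoint_inner_right (ν.factor Φ l), adjoint_inner_left (ν.factor Ψ l)]

theorem integral_add_opAct {Θ : Λ → H →ₗ.[ℂ] G} (hν : ν.IsTraceClass)
    (hΦ : Φ ∈ ν.SqIntegrable G) (hΨ : Ψ ∈ ν.SqIntegrable G) (hΘ : Θ ∈ ν.SqIntegrable G)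
    (P : G →L[ℂ] G) : (ν.integral (Φ + opAct P Ψ) Θ).toOp =
      (ν.integral Φ Θ).toOp + P ∘L (ν.integral Ψ Θ).toOp := by
  refine ext_inner_op fun x y => ?_
  have hP := opAct_mem_sqIntegrable hν P hΨ
  rw [inner_integral hν (add_mem_sqIntegrable hν hΦ hP) hΘ, _root_.add_apply, inner_add_right,
    ContinuousLinearMap.coe_comp, Function.comp_apply, ← adjoint_inner_left P,
    inner_integral hν hΦ hΘ, inner_integral hν hΨ hΘ,
    ← integral_add (integrable_inner hν hΦ hΘ x y) (integrable_inner hν hΨ hΘ _ y)]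
  have h1 := ((sqIntegrable_iff hν).1 hΦ).1
  have h2 := ((sqIntegrable_iff hν).1 hΨ).1
  refine integral_congr_ae ?_
  filter_upwards [h1.factor_add (h2.opAct P), h2.factor_opAct P] with l h3 h4
  rw [h3, h4, _root_.add_apply, inner_add_right, adjoint_inner_left]
  rfl

/-- This is what lets the Gramian descend to the quotient. -/
theorem integral_congr_factor {Φ' Ψ' : Λ → H →ₗ.[ℂ] G}
    (h1 : ∀ᵐ l ∂ν.variation, ν.factor Φ l = ν.factor Φ' l)
    (h2 : ∀ᵐ l ∂ν.variation, ν.factor Ψ l = ν.factor Ψ' l) :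
    ν.integral Φ Ψ = ν.integral Φ' Ψ' := by
  refine integral_congr_ae ?_
  filter_upwards [h1, h2] with l h1 h2
  rw [integrand_eq, integrand_eq, h1, h2]

theorem ae_isPositive_integrand (hν : ν.IsTraceClass) (hΦ : Φ ∈ ν.SqIntegrable G) :
    ∀ᵐ l ∂ν.variation, (TraceClass.ofOp (ν.integrand Φ Φ l)).toOp.IsPositive := by
  filter_upwards [(integrablePair_of_mem hν hΦ hΦ).traceClass] with l hl
  rw [TraceClass.toOp_ofOp hl, integrand_eq]
  exact isPositive_self_comp_adjoint _

theorem isPositive_integral (hν : ν.IsTraceClass) (hΦ : Φ ∈ ν.SqIntegrable G) :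
    (ν.integral Φ Φ).toOp.IsPositive :=
  TraceClass.isPositive_integral (integrablePair_of_mem hν hΦ hΦ).integrable
    (ae_isPositive_integrand hν hΦ)

/-- The integrand is positive, so its trace norm commutes with the integral, and pointwise it equals
the squared Hilbert-Schmidt norm of the factor. -/
theorem norm_integral_self (hν : ν.IsTraceClass) (hΦ : Φ ∈ ν.SqIntegrable G) :
    ‖ν.integral Φ Φ‖ = (ν.energy Φ).toReal := by
  rw [TraceClass.norm_def, integral, TraceClass.eTraceNorm_integral_of_isPositive
    (integrablePair_of_mem hν hΦ hΦ).integrable (ae_isPositive_integrand hν hΦ)]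
  congr 1
  refine lintegral_congr_ae ?_
  filter_upwards [((sqIntegrable_iff hν).1 hΦ).1.enorm_integrand_self] with l hl
  rw [← TraceClass.enorm_eq, hl]

theorem pseudoNorm_eq (hν : ν.IsTraceClass) (hΦ : Φ ∈ ν.SqIntegrable G) :
    ν.pseudoNorm Φ = Real.sqrt (ν.energy Φ).toReal := by
  rw [pseudoNorm, gramianNorm, norm_integral_self hν hΦ]

theorem energy_eq_zero_iff (hν : ν.IsTraceClass) (hΦ : Φ ∈ ν.SqIntegrable G) :
    ν.energy Φ = 0 ↔ ∀ᵐ l ∂ν.variation, ν.factor Φ l = 0 := by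
  have h := ((sqIntegrable_iff hν).1 hΦ).1
  rw [energy, lintegral_eq_zero_iff' (h.aeSimplyMeasurable hν).hsNormSq]
  exact eventually_congr (.of_forall fun l => hsNormSq_eq_zero)

theorem integral_self_eq_zero_iff (hν : ν.IsTraceClass) (hΦ : Φ ∈ ν.SqIntegrable G) :
    ν.integral Φ Φ = 0 ↔ ∀ᵐ l ∂ν.variation, ν.factor Φ l = 0 := by
  rw [← norm_eq_zero, norm_integral_self hν hΦ, ENNReal.toReal_eq_zero_iff,
    or_iff_left ((sqIntegrable_iff hν).1 hΦ).2.ne, energy_eq_zero_iff hν hΦ]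

theorem pseudoNorm_eq_zero_iff (hν : ν.IsTraceClass) (hΦ : Φ ∈ ν.SqIntegrable G) :
    ν.pseudoNorm Φ = 0 ↔ ∀ᵐ l ∂ν.variation, ν.factor Φ l = 0 := by
  rw [pseudoNorm, gramianNorm, Real.sqrt_eq_zero (norm_nonneg _), norm_eq_zero,
    integral_self_eq_zero_iff hν hΦ]

/-- Stated with `IsComp`, so that vanishing cannot come from the default value of `pcomp`. -/
theorem pseudoNorm_eq_zero_iff_isComp (hν : ν.IsTraceClass) (hΦ : Φ ∈ ν.SqIntegrable G) :
    ν.pseudoNorm Φ = 0 ↔ ∀ᵐ l ∂ν.variation, IsComp (Φ l) (ν.sqrtDensity l) 0 := by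
  rw [pseudoNorm_eq_zero_iff hν hΦ]
  constructor
  · intro h
    filter_upwards [h, ((sqIntegrable_iff hν).1 hΦ).1.isComp] with l h1 h2
    rwa [h1] at h2
  · intro h
    filter_upwards [h] with l h1
    exact factor_eq h1

/-- Makes the null relation an almost everywhere equality, from which its being an equivalence and
its compatibility with the operations are immediate. -/
theorem nullRel_iff (hν : ν.IsTraceClass) (Φ Ψ : ν.SqIntegrable G) :
    ν.nullRel G Φ Ψ ↔ ∀ᵐ l ∂ν.variation, ν.factor Φ.1 l = ν.factor Ψ.1 l := by
  rw [nullRel, pseudoNorm_eq_zero_iff hν (sub_mem_sqIntegrable hν Φ.2 Ψ.2)]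
  have h := ((sqIntegrable_iff hν).1 Φ.2).1.factor_sub ((sqIntegrable_iff hν).1 Ψ.2).1
  constructor
  · intro h1
    filter_upwards [h, h1] with l h2 h3
    exact sub_eq_zero.1 (h2.symm.trans h3)
  · intro h1
    filter_upwards [h, h1] with l h2 h3
    rw [h2, h3, sub_self]

theorem equivalence_nullRel (hν : ν.IsTraceClass) : Equivalence (ν.nullRel G) where
  refl Φ := (nullRel_iff hν Φ Φ).2 (.of_forall fun _ => rfl)
  symm {Φ Ψ} h := (nullRel_iff hν Ψ Φ).2 (((nullRel_iff hν Φ Ψ).1 h).mono fun _ h => h.symm)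
  trans {Φ Ψ Θ} h1 h2 := by
    rw [nullRel_iff hν] at *
    filter_upwards [h1, h2] with l h1 h2
    exact h1.trans h2

end POVM

/-! ### Completeness of `L²(S₂)` and approximate left inverses -/

section Limits

variable {Λ H G : Type*} [MeasurableSpace Λ] {μ : Measure Λ}
  [NormedAddCommGroup H] [InnerProductSpace ℂ H] [CompleteSpace H]
  [NormedAddCommGroup G] [InnerProductSpace ℂ G] [CompleteSpace G]

/-- A supremum of finite sums that are continuous in the operator is lower semicontinuous. -/
theorem hsNormSq_le_liminf {U : ℕ → H →L[ℂ] G} {T : H →L[ℂ] G}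
    (hU : Tendsto U atTop (𝓝 T)) : hsNormSq T ≤ liminf (fun n => hsNormSq (U n)) atTop := by
  refine hsNormSq_le fun s hs => ?_
  have h : Tendsto (fun n => ∑ e ∈ s, ‖U n e‖ₑ ^ 2) atTop (𝓝 (∑ e ∈ s, ‖T e‖ₑ ^ 2)) := by
    refine tendsto_finsetSum s fun e _ => ?_
    exact ((ENNReal.continuous_pow 2).tendsto _).comp
      ((((ContinuousLinearMap.apply ℂ G e).continuous.tendsto _).comp hU).enorm)
  rw [← h.liminf_eq]
  exact liminf_le_liminf (.of_forall fun n => sum_enorm_sq_le_hsNormSq (U n) s hs)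

/-- The weight `4 ^ k` on squares gives steps of norm at most `(1 + C) 2⁻ᵏ`; using `C ≤ (1 + C)²`
avoids a square root of `C`. -/
theorem cauchySeq_of_tsum_hsNormSq {U : ℕ → H →L[ℂ] G}
    (hU : ∑' k, 4 ^ k * hsNormSq (U k - U (k + 1)) ≠ ∞) : CauchySeq U := by
  set C := ∑' k, 4 ^ k * hsNormSq (U k - U (k + 1))
  refine cauchySeq_of_edist_le_geometric 2⁻¹ (1 + C) (ENNReal.inv_lt_one.2 ENNReal.one_lt_two)
    (ENNReal.add_ne_top.2 ⟨ENNReal.one_ne_top, hU⟩) fun k => ?_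
  have h1 : (‖U k - U (k + 1)‖ₑ * 2 ^ k) ^ 2 ≤ (1 + C) ^ 2 := by
    calc (‖U k - U (k + 1)‖ₑ * 2 ^ k) ^ 2 = 4 ^ k * ‖U k - U (k + 1)‖ₑ ^ 2 := by
          rw [mul_pow, mul_comm, ← pow_mul, mul_comm k, pow_mul]
          norm_num
      _ ≤ 4 ^ k * hsNormSq (U k - U (k + 1)) := by
          gcongr
          exact opNorm_sq_le_hsNormSq _
      _ ≤ C := ENNReal.le_tsum k
      _ ≤ (1 + C) ^ 2 := by
          rw [sq]
          exact le_mul_of_one_le_of_le le_self_add le_add_self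
  have h2 : ‖U k - U (k + 1)‖ₑ * 2 ^ k ≤ 1 + C := (ENNReal.pow_le_pow_left_iff two_ne_zero).1 h1
  rw [edist_eq_enorm_sub, ← ENNReal.inv_pow, ← div_eq_mul_inv]
  exact (ENNReal.le_div_iff_mul_le (Or.inl (by simp)) (Or.inl (by simp))).2 h2

/-- Completeness of the space of square integrable functions with values in the Hilbert-Schmidt
operators. -/
theorem exists_hilbertSchmidt_limit [TopologicalSpace.SeparableSpace H] {T : ℕ → Λ → H →L[ℂ] G}
    (hT : ∀ n, AESimplyMeasurable (T n) μ)
    (hC : ∀ ε : ℝ≥0∞, 0 < ε → ∃ N, ∀ m ≥ N, ∀ n ≥ N, ∫⁻ l, hsNormSq (T m l - T n l) ∂μ < ε) :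
    ∃ (S : Λ → H →L[ℂ] G) (φ : ℕ → ℕ),
      (∀ᵐ l ∂μ, Tendsto (fun k => T (φ k) l) atTop (𝓝 (S l))) ∧ AESimplyMeasurable S μ ∧
        Tendsto (fun n => ∫⁻ l, hsNormSq (T n l - S l) ∂μ) atTop (𝓝 0) := by
  classical
  have hmeas : ∀ m n, AEMeasurable (fun l => hsNormSq (T m l - T n l)) μ := fun m n =>
    ((hT m).sub (hT n)).hsNormSq
  -- The rate `8⁻ᵏ` leaves `4ᵏ 8⁻ᵏ = 2⁻ᵏ`, summable after weighting, so the subsequence converges in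
  -- operator norm almost everywhere.
  obtain ⟨φ, hφ, hφ'⟩ := extraction_forall_of_eventually
    (P := fun k n => ∀ m ≥ n, ∫⁻ l, hsNormSq (T n l - T m l) ∂μ < (8⁻¹ : ℝ≥0∞) ^ k) fun k => by
      obtain ⟨N, hN⟩ := hC ((8⁻¹ : ℝ≥0∞) ^ k) (ENNReal.pow_pos (by simp) k)
      exact eventually_atTop.2 ⟨N, fun n hn m hm => hN n hn m (hn.trans hm)⟩
  have hsum : ∫⁻ l, ∑' k, 4 ^ k * hsNormSq (T (φ k) l - T (φ (k + 1)) l) ∂μ ≠ ∞ := by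
    rw [lintegral_tsum fun k => (hmeas _ _).const_mul _]
    refine ne_top_of_le_ne_top (b := ∑' k : ℕ, (2⁻¹ : ℝ≥0∞) ^ k) ?_
      (ENNReal.tsum_le_tsum fun k => ?_)
    · rw [ENNReal.tsum_geometric_two]
      exact ENNReal.ofNat_ne_top
    · rw [lintegral_const_mul' _ _ (by simp)]
      calc (4 : ℝ≥0∞) ^ k * ∫⁻ l, hsNormSq (T (φ k) l - T (φ (k + 1)) l) ∂μ
          ≤ 4 ^ k * 8⁻¹ ^ k := by
            gcongr
            exact (hφ' k _ (hφ (Nat.lt_succ_self k)).le).le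
        _ = 2⁻¹ ^ k := by
            rw [← mul_pow]
            congr 1
            rw [show (8 : ℝ≥0∞) = 4 * 2 by norm_num,
              ENNReal.mul_inv (Or.inl (by simp)) (Or.inl (by simp)), ← mul_assoc,
              ENNReal.mul_inv_cancel (by simp) (by simp), one_mul]
  have hlim : ∀ᵐ l ∂μ, ∃ A, Tendsto (fun k => T (φ k) l) atTop (𝓝 A) := by
    filter_upwards [ae_lt_top' (AEMeasurable.tsum fun k => (hmeas _ _).const_mul _) hsum]
      with l hl
    exact cauchySeq_tendsto_of_complete (cauchySeq_of_tsum_hsNormSq hl.ne)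
  set S : Λ → H →L[ℂ] G :=
    fun l => if h : ∃ A, Tendsto (fun k => T (φ k) l) atTop (𝓝 A) then h.choose else 0
  have hS : ∀ᵐ l ∂μ, Tendsto (fun k => T (φ k) l) atTop (𝓝 (S l)) := by
    filter_upwards [hlim] with l hl
    simp only [S, dif_pos hl]
    exact hl.choose_spec
  refine ⟨S, φ, hS, fun x => ?_, ?_⟩
  · refine aestronglyMeasurable_of_tendsto_ae atTop (fun k => hT (φ k) x) ?_
    filter_upwards [hS] with l hl
    exact ((ContinuousLinearMap.apply ℂ G x).continuous.tendsto _).comp hl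
  · rw [ENNReal.tendsto_atTop_zero]
    intro ε hε
    obtain ⟨N, hN⟩ := hC ε hε
    refine ⟨N, fun n hn => ?_⟩
    -- Lower semicontinuity and Fatou's lemma along the subsequence pass the Cauchy bound to the
    -- limit, for the full sequence in `n`.
    calc ∫⁻ l, hsNormSq (T n l - S l) ∂μ
        ≤ ∫⁻ l, liminf (fun k => hsNormSq (T n l - T (φ k) l)) atTop ∂μ := by
          refine lintegral_mono_ae ?_
          filter_upwards [hS] with l hl
          exact hsNormSq_le_liminf (tendsto_const_nhds.sub hl)
      _ ≤ liminf (fun k => ∫⁻ l, hsNormSq (T n l - T (φ k) l) ∂μ) atTop :=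
          lintegral_liminf_le' fun k => hmeas _ _
      _ ≤ ε := by
          refine liminf_le_of_le (by isBoundedDefault) fun b hb => ?_
          obtain ⟨k, hk, hk'⟩ := (hb.and (eventually_ge_atTop N)).exists
          exact hk.trans (hN n hn _ (hk'.trans (hφ.id_le k))).le

/-- Polynomials in `s` that approximate a left inverse of `s`. -/
noncomputable def approxInverse (c : ℂ) (s : H →L[ℂ] H) (n : ℕ) : H →L[ℂ] H :=
  (n : ℂ)⁻¹ • ∑ k ∈ Finset.range n, ∑ j ∈ Finset.range k,
    c • (ContinuousLinearMap.id ℂ H - c • s) ^ j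

/-- With `A = 1 - c s`, the geometric sum gives `(∑_{j<k} c Aʲ) s = 1 - Aᵏ`; averaging over `k < n`
produces the Birkhoff average. -/
theorem approxInverse_apply (c : ℂ) (s : H →L[ℂ] H) {n : ℕ} (hn : n ≠ 0) (y : H) :
    approxInverse c s n (s y) =
      y - birkhoffAverage ℂ (ContinuousLinearMap.id ℂ H - c • s) _root_.id n y := by
  set A : H →L[ℂ] H := ContinuousLinearMap.id ℂ H - c • s with hA
  have h1 : ∀ k, ∑ j ∈ Finset.range k, (c • A ^ j) (s y) = y - A^[k] y := fun k => by
    have h := congrArg (fun B : H →L[ℂ] H => B y) (geom_sum_mul_neg A k)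
    have h2 : (1 : H →L[ℂ] H) - A = c • s := by
      rw [hA]
      exact sub_sub_cancel _ _
    rw [h2] at h
    have h3 : ∀ k, (A ^ k) y = A^[k] y := fun k => by
      induction k with
      | zero => rfl
      | succ k ih => rw [Function.iterate_succ_apply', ← ih, pow_succ']; rfl
    simp only [sub_apply, h3] at h
    refine Eq.trans ?_ h
    simp [sum_apply, Finset.smul_sum]
  have hn' : (n : ℂ) ≠ 0 := Nat.cast_ne_zero.2 hn
  simp only [approxInverse, smul_apply, sum_apply, birkhoffAverage, birkhoffSum, id_eq]
  simp only [← hA, ← smul_apply, h1, Finset.sum_sub_distrib, smul_sub, Finset.sum_const,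
    Finset.card_range]
  rw [← Nat.cast_smul_eq_nsmul ℂ, smul_smul, inv_mul_cancel₀ hn', one_smul]

/-- From `0 ≤ c s ≤ 1` the operator `A = 1 - c s` is a contraction, and its fixed space is `ker s`.
The mean ergodic theorem sends the averages of `y` to its projection on `ker s`, which `S` kills. No
spectral gap of `s` at `0` is needed. -/
theorem tendsto_comp_approxInverse {s : H →L[ℂ] H} (hs : 0 ≤ s) {c : ℝ} (hc : 0 < c)
    (hcs : c * ‖s‖ ≤ 1) (S : H →L[ℂ] G) (hS : ∀ y, s y = 0 → S y = 0) (y : H) :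
    Tendsto (fun n => S (approxInverse c s n (s y))) atTop (𝓝 (S y)) := by
  set A : H →L[ℂ] H := ContinuousLinearMap.id ℂ H - (c : ℂ) • s with hA
  have hcs0 : 0 ≤ (c : ℂ) • s := by
    have h : (c : ℂ) • s = c • s := by ext; simp
    rw [h]
    exact smul_nonneg hc.le hs
  have hcs1 : (c : ℂ) • s ≤ 1 := by
    rw [← CStarAlgebra.norm_le_one_iff_of_nonneg _ hcs0, norm_smul, Complex.norm_real,
      Real.norm_of_nonneg hc.le]
    exact hcs
  have hA0 : 0 ≤ A := sub_nonneg.2 hcs1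
  have hA1 : ‖A‖ ≤ 1 := by
    rw [CStarAlgebra.norm_le_one_iff_of_nonneg A hA0]
    exact sub_le_self _ hcs0
  have h := ContinuousLinearMap.tendsto_birkhoffAverage_orthogonalProjection A hA1 y
  set p : H := ((A.eqLocus (1 : H →L[ℂ] H)).orthogonalProjectionOnto y : H)
  have hp : A p = p := ((A.eqLocus (1 : H →L[ℂ] H)).orthogonalProjectionOnto y).2
  have hsp : s p = 0 := by
    rw [hA, sub_apply, smul_apply, id_apply, sub_eq_self, smul_eq_zero] at hp
    exact hp.resolve_left (Complex.ofReal_ne_zero.2 hc.ne')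
  have h2 : Tendsto (fun n => S (y - birkhoffAverage ℂ A _root_.id n y)) atTop
      (𝓝 (S (y - p))) := (S.continuous.tendsto _).comp (tendsto_const_nhds.sub h)
  rw [map_sub, hS p hsp, sub_zero] at h2
  refine h2.congr' ?_
  filter_upwards [eventually_ne_atTop 0] with n hn
  rw [approxInverse_apply _ _ hn]

theorem AESimplyMeasurable.approxInverse [TopologicalSpace.SeparableSpace H]
    {s : Λ → H →L[ℂ] H} (hs : AESimplyMeasurable s μ) {c : Λ → ℂ}
    (hc : AEStronglyMeasurable c μ) (n : ℕ) :
    AESimplyMeasurable (fun l => approxInverse (c l) (s l) n) μ := by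
  unfold PovmL2.approxInverse
  refine AESimplyMeasurable.smul (.sum _ fun k _ => .sum _ fun j _ => .smul (.pow ?_ j) hc)
    aestronglyMeasurable_const
  exact (aeSimplyMeasurable_const _).sub (hs.smul hc)

end Limits

/-! ### Completeness of the space of square integrable functions -/

namespace POVM

variable {Λ H G : Type*} [MeasurableSpace Λ]
  [NormedAddCommGroup H] [InnerProductSpace ℂ H] [CompleteSpace H]
  [NormedAddCommGroup G] [InnerProductSpace ℂ G] [CompleteSpace G]
  [TopologicalSpace.SeparableSpace H] {ν : POVM Λ H}

/-- Every measurable function `S` with `ker f^{1/2} ⊆ ker S` is of the form `Φ f^{1/2}`. -/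
theorem exists_isComp (hν : ν.IsTraceClass) {S : Λ → H →L[ℂ] G}
    (hS : AESimplyMeasurable S ν.variation)
    (hker : ∀ᵐ l ∂ν.variation, ∀ y, ν.sqrtDensity l y = 0 → S l y = 0) :
    ∃ Φ : Λ → H →ₗ.[ℂ] G, OMeasurable Φ ∧
      ∀ᵐ l ∂ν.variation, IsComp (Φ l) (ν.sqrtDensity l) (S l) := by
  -- A measurable choice with `c ‖f^{1/2}‖ ≤ 1`, since `‖f^{1/2}‖ = ‖f‖^{1/2} ≤ ‖f‖₁^{1/2} ≤ 1 +
  -- ‖f‖₁`.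
  set c : Λ → ℝ := fun l => (1 + ‖ν.density l‖)⁻¹
  have hc : AEStronglyMeasurable (fun l => (c l : ℂ)) ν.variation := by
    have h1 := (isDensity_density ν hν).integrable.aestronglyMeasurable.norm.aemeasurable
    exact Complex.measurable_ofReal.comp_aemeasurable
      ((h1.const_add 1).inv) |>.aestronglyMeasurable
  -- Strictly measurable versions of `S p_n(f^{1/2})`; their pointwise limit is `Φ`.
  choose F hF hFS using fun n => AESimplyMeasurable.exists_simplyMeasurable
    (hS.comp ((aeSimplyMeasurable_sqrtDensity ν hν).approxInverse hc n))
  refine ⟨limPMap F, oMeasurable_limPMap hF, ?_⟩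
  filter_upwards [ae_all_iff.2 hFS, hker, ae_isPositive_density ν hν] with l h1 h2 h3 y
  have hc0 : 0 < c l := inv_pos.2 (by positivity)
  have hcs : c l * ‖ν.sqrtDensity l‖ ≤ 1 := by
    rw [inv_mul_le_one₀ (by positivity), sqrtDensity,
      CFC.norm_sqrt _ ((nonneg_iff_isPositive _).2 h3)]
    refine Real.sqrt_le_iff.2 ⟨by positivity, ?_⟩
    have h4 := TraceClass.opNorm_le_norm (ν.density l)
    nlinarith [norm_nonneg (ν.density l)]
  have h5 : Tendsto (fun n => F n l (ν.sqrtDensity l y)) atTop (𝓝 (S l y)) := by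
    simp only [h1]
    exact tendsto_comp_approxInverse (ν.sqrtDensity_nonneg l) hc0 hcs (S l) h2 y
  exact ⟨⟨S l y, h5⟩, tendsto_nhds_unique (tendsto_limPMap F l ⟨_, ⟨S l y, h5⟩⟩) h5⟩

variable [TopologicalSpace.SeparableSpace G]

theorem exists_energy_limit (hν : ν.IsTraceClass) {Φ : ℕ → Λ → H →ₗ.[ℂ] G}
    (hΦ : ∀ n, Φ n ∈ ν.SqIntegrable G)
    (hC : ∀ ε : ℝ≥0∞, 0 < ε → ∃ N, ∀ m ≥ N, ∀ n ≥ N, ν.energy (Φ m - Φ n) < ε) :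
    ∃ Ψ ∈ ν.SqIntegrable G, Tendsto (fun n => ν.energy (Φ n - Ψ)) atTop (𝓝 0) := by
  have hfac : ∀ n, ν.HasFactor (Φ n) := fun n => ((sqIntegrable_iff hν).1 (hΦ n)).1
  have henergy : ∀ m n, ν.energy (Φ m - Φ n) =
      ∫⁻ l, hsNormSq (ν.factor (Φ m) l - ν.factor (Φ n) l) ∂ν.variation := fun m n =>
    lintegral_congr_ae (((hfac m).factor_sub (hfac n)).mono fun l hl => by simp only [hl])
  simp only [henergy] at hC
  obtain ⟨S, φ, hφ, hS, hlim⟩ := exists_hilbertSchmidt_limit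
    (fun n => (hfac n).aeSimplyMeasurable hν) hC
  -- Every `Φ_n f^{1/2}` vanishes on the kernel of `f^{1/2}`, and this survives convergence along
  -- the subsequence.
  have hker : ∀ᵐ l ∂ν.variation, ∀ y, ν.sqrtDensity l y = 0 → S l y = 0 := by
    filter_upwards [hφ, ae_all_iff.2 fun n => (hfac n).isComp] with l h1 h2 y hy
    have h3 : ∀ n, ν.factor (Φ n) l y = 0 := fun n => by
      obtain ⟨h4, h5⟩ := h2 n y
      have h6 : (⟨ν.sqrtDensity l y, h4⟩ : (Φ n l).domain) = 0 := Subtype.ext hy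
      rw [← h5, h6, LinearPMap.map_zero]
    have h4 := ((ContinuousLinearMap.apply ℂ G y).continuous.tendsto _).comp h1
    refine tendsto_nhds_unique h4 (tendsto_const_nhds.congr fun k => ?_)
    exact (h3 (φ k)).symm
  obtain ⟨Ψ, hΨ, hΨS⟩ := exists_isComp hν hS hker
  have hSint : ∫⁻ l, hsNormSq (S l) ∂ν.variation < ∞ := by
    obtain ⟨n, hn⟩ := (hlim.eventually (gt_mem_nhds ENNReal.zero_lt_top)).exists
    calc ∫⁻ l, hsNormSq (S l) ∂ν.variation
        ≤ ∫⁻ l, 2 * (hsNormSq (ν.factor (Φ n) l) + hsNormSq (ν.factor (Φ n) l - S l))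
            ∂ν.variation := by
          refine lintegral_mono fun l => ?_
          have h := hsNormSq_add_le (ν.factor (Φ n) l) (S l - ν.factor (Φ n) l)
          rwa [add_sub_cancel, hsNormSq_sub_comm (S l)] at h
      _ = 2 * (ν.energy (Φ n) + ∫⁻ l, hsNormSq (ν.factor (Φ n) l - S l) ∂ν.variation) := by
          rw [lintegral_const_mul' _ _ ENNReal.ofNat_ne_top,
            lintegral_add_left' ((hfac n).aeSimplyMeasurable hν).hsNormSq, energy]
      _ < ∞ := ENNReal.mul_lt_top ENNReal.ofNat_lt_top
          (ENNReal.add_lt_top.2 ⟨((sqIntegrable_iff hν).1 (hΦ n)).2, hn⟩)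
  have hfacΨ : ν.HasFactor Ψ := .of_isComp hΨ hΨS (ae_lt_top' hS.hsNormSq hSint.ne)
  have hΨeq : ∀ᵐ l ∂ν.variation, ν.factor Ψ l = S l := hΨS.mono fun l hl => factor_eq hl
  refine ⟨Ψ, (sqIntegrable_iff hν).2 ⟨hfacΨ, ?_⟩, hlim.congr fun n => ?_⟩
  · have h : ν.energy Ψ = ∫⁻ l, hsNormSq (S l) ∂ν.variation :=
      lintegral_congr_ae (hΨeq.mono fun l hl => by simp only [hl])
    rwa [h]
  · refine (lintegral_congr_ae ?_).symm
    filter_upwards [(hfac n).factor_sub hfacΨ, hΨeq] with l h1 h2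
    rw [h1, h2]

end POVM

/-! ### The quotient as a normal Hilbert module -/

namespace POVM

variable {Λ H G : Type*} [MeasurableSpace Λ]
  [NormedAddCommGroup H] [InnerProductSpace ℂ H] [CompleteSpace H]
  [NormedAddCommGroup G] [InnerProductSpace ℂ G] [CompleteSpace G]
  [TopologicalSpace.SeparableSpace H] [TopologicalSpace.SeparableSpace G]
  {ν : POVM Λ H} {Φ Ψ Θ : Λ → H →ₗ.[ℂ] G}

theorem toL2_eq_iff (hν : ν.IsTraceClass) {Φ Ψ : ν.SqIntegrable G} :
    ν.toL2 Φ = ν.toL2 Ψ ↔ ∀ᵐ l ∂ν.variation, ν.factor Φ.1 l = ν.factor Ψ.1 l :=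
  (Equivalence.quot_mk_eq_iff (equivalence_nullRel hν) Φ Ψ).trans (nullRel_iff hν Φ Ψ)

theorem hasFactor_coe (hν : ν.IsTraceClass) (Φ : ν.SqIntegrable G) :
    ν.HasFactor Φ.1 := ((sqIntegrable_iff hν).1 Φ.2).1

/-- Addition of square integrable functions. -/
def sqAdd (hν : ν.IsTraceClass) (Φ Ψ : ν.SqIntegrable G) : ν.SqIntegrable G :=
  ⟨Φ.1 + Ψ.1, add_mem_sqIntegrable hν Φ.2 Ψ.2⟩

/-- The opposite of a square integrable function. -/
def sqNeg (hν : ν.IsTraceClass) (Φ : ν.SqIntegrable G) : ν.SqIntegrable G :=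
  ⟨-Φ.1, neg_mem_sqIntegrable hν Φ.2⟩

/-- The zero function, as a square integrable function. -/
def sqZero (hν : ν.IsTraceClass) : ν.SqIntegrable G := ⟨0, zero_mem_sqIntegrable hν⟩

/-- The action of a bounded operator on a square integrable function. -/
def sqAct (hν : ν.IsTraceClass) (P : G →L[ℂ] G) (Φ : ν.SqIntegrable G) : ν.SqIntegrable G :=
  ⟨opAct P Φ.1, opAct_mem_sqIntegrable hν P Φ.2⟩

theorem factor_sqAdd (hν : ν.IsTraceClass) (Φ Ψ : ν.SqIntegrable G) :
    ∀ᵐ l ∂ν.variation, ν.factor (sqAdd hν Φ Ψ).1 l = ν.factor Φ.1 l + ν.factor Ψ.1 l :=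
  (hasFactor_coe hν Φ).factor_add (hasFactor_coe hν Ψ)

theorem factor_sqNeg (hν : ν.IsTraceClass) (Φ : ν.SqIntegrable G) :
    ∀ᵐ l ∂ν.variation, ν.factor (sqNeg hν Φ).1 l = -ν.factor Φ.1 l :=
  (hasFactor_coe hν Φ).factor_neg

theorem factor_sqZero (hν : ν.IsTraceClass) (l : Λ) :
    ν.factor (sqZero (G := G) hν).1 l = 0 := factor_eq (isComp_zero _)

theorem factor_sqAct (hν : ν.IsTraceClass) (P : G →L[ℂ] G) (Φ : ν.SqIntegrable G) :
    ∀ᵐ l ∂ν.variation, ν.factor (sqAct hν P Φ).1 l = P ∘L ν.factor Φ.1 l :=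
  (hasFactor_coe hν Φ).factor_opAct P

theorem opAct_add (P : G →L[ℂ] G) (Φ Ψ : Λ → H →ₗ.[ℂ] G) :
    opAct P (Φ + Ψ) = opAct P Φ + opAct P Ψ := by
  funext l
  exact LinearPMap.ext rfl fun x hx hx' => map_add P _ _

theorem add_opAct (P Q : G →L[ℂ] G) (Φ : Λ → H →ₗ.[ℂ] G) :
    opAct (P + Q) Φ = opAct P Φ + opAct Q Φ := by
  funext l
  refine LinearPMap.ext ?_ fun x hx hx' => rfl
  exact (inf_idem _).symm

theorem opAct_opAct (P Q : G →L[ℂ] G) (Φ : Λ → H →ₗ.[ℂ] G) :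
    opAct (P ∘L Q) Φ = opAct P (opAct Q Φ) := rfl

theorem id_opAct (Φ : Λ → H →ₗ.[ℂ] G) : opAct (ContinuousLinearMap.id ℂ G) Φ = Φ := rfl

/-- The sum `Φ + (-Φ)` is zero only on the domain of `Φ`, hence is in general a null function and
not `0`. -/
theorem pseudoNorm_add_neg (hν : ν.IsTraceClass) (hΦ : Φ ∈ ν.SqIntegrable G) :
    ν.pseudoNorm (Φ + -Φ) = 0 := by
  have h := (equivalence_nullRel (G := G) hν).refl ⟨Φ, hΦ⟩
  rwa [nullRel, sub_eq_add_neg_pfun] at h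

/-- Addition on `L²`. -/
noncomputable def l2Add (hν : ν.IsTraceClass) : ν.L2 G → ν.L2 G → ν.L2 G :=
  Quot.map₂ (sqAdd hν)
    (fun Φ Ψ Ψ' h => by
      rw [nullRel_iff hν] at *
      filter_upwards [factor_sqAdd hν Φ Ψ, factor_sqAdd hν Φ Ψ', h] with l h1 h2 h3
      rw [h1, h2, h3])
    (fun Φ Φ' Ψ h => by
      rw [nullRel_iff hν] at *
      filter_upwards [factor_sqAdd hν Φ Ψ, factor_sqAdd hν Φ' Ψ, h] with l h1 h2 h3
      rw [h1, h2, h3])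

/-- Negation on `L²`. -/
noncomputable def l2Neg (hν : ν.IsTraceClass) : ν.L2 G → ν.L2 G :=
  Quot.map (sqNeg hν) fun Φ Φ' h => by
    rw [nullRel_iff hν] at *
    filter_upwards [factor_sqNeg hν Φ, factor_sqNeg hν Φ', h] with l h1 h2 h3
    rw [h1, h2, h3]

theorem l2Neg_add_self (hν : ν.IsTraceClass) (x : ν.L2 G) :
    l2Add hν (l2Neg hν x) x = ν.toL2 (sqZero hν) := by
  induction x using Quot.ind with
  | _ Φ =>
    refine (toL2_eq_iff hν (Φ := sqAdd hν (sqNeg hν Φ) Φ) (Ψ := sqZero hν)).2 ?_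
    filter_upwards [factor_sqAdd hν (sqNeg hν Φ) Φ, factor_sqNeg hν Φ] with l h1 h2
    rw [h1, h2, neg_add_cancel, factor_sqZero]

/-- The additive group structure of `L²`. -/
noncomputable abbrev l2AddCommGroup (hν : ν.IsTraceClass) : AddCommGroup (ν.L2 G) :=
  letI : Add (ν.L2 G) := ⟨l2Add hν⟩
  letI : Zero (ν.L2 G) := ⟨ν.toL2 (sqZero hν)⟩
  letI : Neg (ν.L2 G) := ⟨l2Neg hν⟩
  { AddGroup.ofLeftAxioms
      (fun x y z => by
        induction x, y, z using Quot.induction_on₃ with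
        | _ Φ Ψ Θ => exact congrArg ν.toL2 (Subtype.ext (add_assoc Φ.1 Ψ.1 Θ.1)))
      (fun x => by
        induction x using Quot.ind with
        | _ Φ => exact congrArg ν.toL2 (Subtype.ext (zero_add Φ.1)))
      (l2Neg_add_self hν) with
    add_comm := fun x y => by
      induction x, y using Quot.induction_on₂ with
      | _ Φ Ψ => exact congrArg ν.toL2 (Subtype.ext (add_comm Φ.1 Ψ.1)) }

/-- The `L_b(G)`-module structure of `L²`. -/
noncomputable abbrev l2Module (hν : ν.IsTraceClass) :
    letI := l2AddCommGroup (G := G) hν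
    Module (G →L[ℂ] G) (ν.L2 G) :=
  letI := l2AddCommGroup (G := G) hν
  { smul := fun P => Quot.map (sqAct hν P) fun Φ Φ' h => by
      rw [nullRel_iff hν] at *
      filter_upwards [factor_sqAct hν P Φ, factor_sqAct hν P Φ', h] with l h1 h2 h3
      rw [h1, h2, h3]
    one_smul := fun x => by
      induction x using Quot.ind with
      | _ Φ => exact congrArg ν.toL2 (Subtype.ext (id_opAct Φ.1))
    mul_smul := fun P Q x => by
      induction x using Quot.ind with
      | _ Φ => exact congrArg ν.toL2 (Subtype.ext (opAct_opAct P Q Φ.1))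
    smul_zero := fun P => by
      refine (toL2_eq_iff hν (Φ := sqAct hν P (sqZero hν)) (Ψ := sqZero hν)).2 ?_
      filter_upwards [factor_sqAct hν P (sqZero hν)] with l h1
      rw [h1, factor_sqZero, comp_zero]
    smul_add := fun P x y => by
      induction x, y using Quot.induction_on₂ with
      | _ Φ Ψ => exact congrArg ν.toL2 (Subtype.ext (opAct_add P Φ.1 Ψ.1))
    add_smul := fun P Q x => by
      induction x using Quot.ind with
      | _ Φ => exact congrArg ν.toL2 (Subtype.ext (add_opAct P Q Φ.1))
    -- The function `0 • Φ` keeps the domain of `Φ`, so this axiom holds only in the quotient.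
    zero_smul := fun x => by
      induction x using Quot.ind with
      | _ Φ =>
        refine (toL2_eq_iff hν (Φ := sqAct hν 0 Φ) (Ψ := sqZero hν)).2 ?_
        filter_upwards [factor_sqAct hν 0 Φ] with l h1
        rw [h1, factor_sqZero, zero_comp] }

/-- The Gramian of `L²`. -/
noncomputable def l2Gram (hν : ν.IsTraceClass) : ν.L2 G → ν.L2 G → TraceClass G G :=
  Quot.lift₂ (fun Φ Ψ => ν.integral Φ.1 Ψ.1)
    (fun _ Ψ Ψ' h => integral_congr_factor (.of_forall fun _ => rfl) ((nullRel_iff hν Ψ Ψ').1 h))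
    (fun Φ Φ' _ h => integral_congr_factor ((nullRel_iff hν Φ Φ').1 h) (.of_forall fun _ => rfl))

theorem isNormalPreHilbertModule_l2Gram (hν : ν.IsTraceClass) :
    letI := l2AddCommGroup (G := G) hν
    letI := l2Module (G := G) hν
    IsNormalPreHilbertModule (l2Gram (G := G) hν) := by
  let := l2AddCommGroup (G := G) hν
  let := l2Module (G := G) hν
  refine ⟨fun x => ?_, fun x => ?_, fun x y z P => ?_, fun x y => ?_⟩
  · induction x using Quot.ind with
    | _ Φ => exact isPositive_integral hν Φ.2
  · induction x using Quot.ind with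
    | _ Φ =>
      refine (integral_self_eq_zero_iff hν Φ.2).trans ?_
      refine Iff.trans ?_ (toL2_eq_iff hν (Φ := Φ) (Ψ := sqZero hν)).symm
      simp only [factor_sqZero]
  · induction x, y, z using Quot.induction_on₃ with
    | _ Φ Ψ Θ => exact integral_add_opAct hν Φ.2 Ψ.2 Θ.2 P
  · induction x, y using Quot.induction_on₂ with
    | _ Φ Ψ => exact integral_adjoint hν Φ.2 Ψ.2

theorem gramianNorm_l2Gram_sub (hν : ν.IsTraceClass) (Φ Ψ : ν.SqIntegrable G) :
    letI := l2AddCommGroup (G := G) hν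
    gramianNorm (l2Gram hν) (ν.toL2 Φ - ν.toL2 Ψ) = Real.sqrt (ν.energy (Φ.1 - Ψ.1)).toReal := by
  let := l2AddCommGroup (G := G) hν
  rw [← pseudoNorm_eq hν (sub_mem_sqIntegrable hν Φ.2 Ψ.2), sub_eq_add_neg, sub_eq_add_neg_pfun]
  rfl

theorem isNormalHilbertModule_l2Gram (hν : ν.IsTraceClass) :
    letI := l2AddCommGroup (G := G) hν
    letI := l2Module (G := G) hν
    IsNormalHilbertModule (l2Gram (G := G) hν) := by
  let := l2AddCommGroup (G := G) hν
  let := l2Module (G := G) hν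
  refine { isNormalPreHilbertModule_l2Gram hν with complete := fun u hu => ?_ }
  choose Φ hΦ using fun n => Quot.exists_rep (u n)
  have hΦ' : ∀ n, u n = ν.toL2 (Φ n) := fun n => (hΦ n).symm
  simp only [hΦ', gramianNorm_l2Gram_sub] at hu ⊢
  have hfin : ∀ Ψ Θ : ν.SqIntegrable G, ν.energy (Ψ.1 - Θ.1) ≠ ∞ := fun Ψ Θ =>
    ((sqIntegrable_iff hν).1 (sub_mem_sqIntegrable hν Ψ.2 Θ.2)).2.ne
  obtain ⟨Ψ, hΨ, hlim⟩ := exists_energy_limit hν (fun n => (Φ n).2) fun ε hε => by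
    -- Truncating at `1` keeps the real value meaningful when `ε = ∞`.
    have hδ : 0 < (min ε 1).toReal := ENNReal.toReal_pos (lt_min hε one_pos).ne'
      (min_lt_of_right_lt ENNReal.one_lt_top).ne
    obtain ⟨N, hN⟩ := hu _ (Real.sqrt_pos.2 hδ)
    refine ⟨N, fun m hm n hn => lt_of_lt_of_le ?_ (min_le_left ε 1)⟩
    have h := (Real.sqrt_lt_sqrt_iff ENNReal.toReal_nonneg).1 (hN m hm n hn)
    exact (ENNReal.toReal_lt_toReal (hfin _ _) (min_lt_of_right_lt ENNReal.one_lt_top).ne).1 h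
  refine ⟨ν.toL2 ⟨Ψ, hΨ⟩, ?_⟩
  simp only [gramianNorm_l2Gram_sub]
  have h := (ENNReal.tendsto_toReal ENNReal.zero_ne_top).comp hlim
  have h2 := (Real.continuous_sqrt.tendsto _).comp h
  simpa only [Function.comp_def, ENNReal.toReal_zero, Real.sqrt_zero] using h2

end POVM

end PovmL2

/-! ### The main theorem -/

theorem mainTheorem10 {Λ H₀ G₀ : Type*} [MeasurableSpace Λ]
    [NormedAddCommGroup H₀] [InnerProductSpace ℂ H₀] [CompleteSpace H₀]
    [TopologicalSpace.SeparableSpace H₀]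
    [NormedAddCommGroup G₀] [InnerProductSpace ℂ G₀] [CompleteSpace G₀]
    [TopologicalSpace.SeparableSpace G₀]
    (ν : PovmL2.POVM Λ H₀) (hν : ν.IsTraceClass) :
    -- the density `f = dν / d‖ν‖₁` exists, and `ν.density` is a version of it
    ν.IsDensity ν.density ∧
    -- the square `ν`-integrable functions are stable under the module operations
    ((0 : Λ → H₀ →ₗ.[ℂ] G₀) ∈ ν.SqIntegrable G₀ ∧
      (∀ Φ ∈ ν.SqIntegrable G₀, ∀ Ψ ∈ ν.SqIntegrable G₀, Φ + Ψ ∈ ν.SqIntegrable G₀) ∧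
      (∀ Φ ∈ ν.SqIntegrable G₀, -Φ ∈ ν.SqIntegrable G₀) ∧
      (∀ P : G₀ →L[ℂ] G₀, ∀ Φ ∈ ν.SqIntegrable G₀, PovmL2.opAct P Φ ∈ ν.SqIntegrable G₀)) ∧
    -- they satisfy the axioms of a module, with additive inverses up to null functions
    ((∀ Φ ∈ ν.SqIntegrable G₀, ∀ Ψ ∈ ν.SqIntegrable G₀, ∀ Θ ∈ ν.SqIntegrable G₀,
        Φ + Ψ + Θ = Φ + (Ψ + Θ)) ∧
      (∀ Φ ∈ ν.SqIntegrable G₀, ∀ Ψ ∈ ν.SqIntegrable G₀, Φ + Ψ = Ψ + Φ) ∧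
      (∀ Φ ∈ ν.SqIntegrable G₀, Φ + 0 = Φ) ∧
      (∀ Φ ∈ ν.SqIntegrable G₀, ν.pseudoNorm (Φ + -Φ) = 0) ∧
      (∀ P : G₀ →L[ℂ] G₀, ∀ Φ ∈ ν.SqIntegrable G₀, ∀ Ψ ∈ ν.SqIntegrable G₀,
        PovmL2.opAct P (Φ + Ψ) = PovmL2.opAct P Φ + PovmL2.opAct P Ψ) ∧
      (∀ P Q : G₀ →L[ℂ] G₀, ∀ Φ ∈ ν.SqIntegrable G₀,
        PovmL2.opAct (P + Q) Φ = PovmL2.opAct P Φ + PovmL2.opAct Q Φ) ∧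
      (∀ P Q : G₀ →L[ℂ] G₀, ∀ Φ ∈ ν.SqIntegrable G₀,
        PovmL2.opAct (P ∘L Q) Φ = PovmL2.opAct P (PovmL2.opAct Q Φ)) ∧
      (∀ Φ ∈ ν.SqIntegrable G₀, PovmL2.opAct (ContinuousLinearMap.id ℂ G₀) Φ = Φ)) ∧
    -- `∫ Φ dν Ψᴴ` is a well-defined pseudo-Gramian
    ((∀ Φ ∈ ν.SqIntegrable G₀, ∀ Ψ ∈ ν.SqIntegrable G₀, ν.IntegrablePair Φ Ψ) ∧
      (∀ Φ ∈ ν.SqIntegrable G₀, (ν.integral Φ Φ).toOp.IsPositive) ∧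
      (∀ Φ ∈ ν.SqIntegrable G₀, ∀ Ψ ∈ ν.SqIntegrable G₀, ∀ Θ ∈ ν.SqIntegrable G₀,
        ∀ P : G₀ →L[ℂ] G₀, (ν.integral (Φ + PovmL2.opAct P Ψ) Θ).toOp =
          (ν.integral Φ Θ).toOp + P ∘L (ν.integral Ψ Θ).toOp) ∧
      (∀ Φ ∈ ν.SqIntegrable G₀, ∀ Ψ ∈ ν.SqIntegrable G₀,
        (ν.integral Ψ Φ).toOp = ContinuousLinearMap.adjoint (ν.integral Φ Ψ).toOp)) ∧
    -- `‖Φ‖_ν = 0` if and only if `Φ f^{1/2} = 0` almost everywhere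
    (∀ Φ ∈ ν.SqIntegrable G₀, ν.pseudoNorm Φ = 0 ↔
      ∀ᵐ l ∂ν.variation, PovmL2.IsComp (Φ l) (ν.sqrtDensity l) 0) ∧
    -- the quotient is a normal Hilbert module for the induced operations and Gramian
    Equivalence (ν.nullRel G₀) ∧
    ∃ (_ : AddCommGroup (ν.L2 G₀)) (_ : Module (G₀ →L[ℂ] G₀) (ν.L2 G₀))
      (gram : ν.L2 G₀ → ν.L2 G₀ → PovmL2.TraceClass G₀ G₀),
      (∀ Φ Ψ Θ : ν.SqIntegrable G₀, (Θ : Λ → H₀ →ₗ.[ℂ] G₀) = (Φ : Λ → H₀ →ₗ.[ℂ] G₀) + Ψ →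
        ν.toL2 Θ = ν.toL2 Φ + ν.toL2 Ψ) ∧
      (∀ (P : G₀ →L[ℂ] G₀) (Φ Θ : ν.SqIntegrable G₀),
        (Θ : Λ → H₀ →ₗ.[ℂ] G₀) = PovmL2.opAct P (Φ : Λ → H₀ →ₗ.[ℂ] G₀) →
          ν.toL2 Θ = P • ν.toL2 Φ) ∧
      (∀ Φ Ψ : ν.SqIntegrable G₀, gram (ν.toL2 Φ) (ν.toL2 Ψ) = ν.integral Φ.1 Ψ.1) ∧
      PovmL2.IsNormalHilbertModule gram := by
  refine ⟨ν.isDensity_density hν,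
    ⟨PovmL2.POVM.zero_mem_sqIntegrable hν,
      fun Φ hΦ Ψ hΨ => PovmL2.POVM.add_mem_sqIntegrable hν hΦ hΨ,
      fun Φ hΦ => PovmL2.POVM.neg_mem_sqIntegrable hν hΦ,
      fun P Φ hΦ => PovmL2.POVM.opAct_mem_sqIntegrable hν P hΦ⟩,
    ⟨fun Φ _ Ψ _ Θ _ => add_assoc Φ Ψ Θ, fun Φ _ Ψ _ => add_comm Φ Ψ, fun Φ _ => add_zero Φ,
      fun Φ hΦ => PovmL2.POVM.pseudoNorm_add_neg hν hΦ,
      fun P Φ _ Ψ _ => PovmL2.POVM.opAct_add P Φ Ψ, fun P Q Φ _ => PovmL2.POVM.add_opAct P Q Φ,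
      fun P Q Φ _ => PovmL2.POVM.opAct_opAct P Q Φ, fun Φ _ => PovmL2.POVM.id_opAct Φ⟩,
    ⟨fun Φ hΦ Ψ hΨ => PovmL2.POVM.integrablePair_of_mem hν hΦ hΨ,
      fun Φ hΦ => PovmL2.POVM.isPositive_integral hν hΦ,
      fun Φ hΦ Ψ hΨ Θ hΘ P => PovmL2.POVM.integral_add_opAct hν hΦ hΨ hΘ P,
      fun Φ hΦ Ψ hΨ => PovmL2.POVM.integral_adjoint hν hΦ hΨ⟩,
    fun Φ hΦ => PovmL2.POVM.pseudoNorm_eq_zero_iff_isComp hν hΦ,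
    PovmL2.POVM.equivalence_nullRel hν,
    PovmL2.POVM.l2AddCommGroup hν, PovmL2.POVM.l2Module hν, PovmL2.POVM.l2Gram hν,
    fun Φ Ψ Θ h => ?_, fun P Φ Θ h => ?_, fun _ _ => rfl,
    PovmL2.POVM.isNormalHilbertModule_l2Gram hν⟩
  · have h' : Θ = PovmL2.POVM.sqAdd hν Φ Ψ := Subtype.ext h
    rw [h']
    rfl
  · have h' : Θ = PovmL2.POVM.sqAct hν P Φ := Subtype.ext h
    rw [h']
    rfl
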